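/- Throughout, $K$ is a smooth ($C^\infty$), nowhere vanishing real function on a nonempty open interval $U\subseteq\mathbb R$, and a *point symmetry* of a second-order PDE on an open set $B$ of (independent, dependent) variables is a smooth vector field on $B$ whose second prolongation is tangent to (annihilates the equation on) the manifold defined by the PDE in the space of 2-jets over $B$. **I. The class $w_t=\left(\dfrac{K(1/w)\,w_v}{w^2}\right)_v$**, with $0\notin U$, on $B=\{(t,v,w): (t,v)\in S,\ w\ne 0,\ 1/w\in U\}$, where $S\subseteq\mathbb R^2$ is open and connected. The transformations $\bar v=a_3v+a_1,\ \bar t=a_5t+a_6,\ \bar w=a_4w+a_2,\ \bar K(1/\bar w)=\dfrac{a_3^2(a_4w+a_2)^2}{a_5w^2}K(1/w)$ with $a_3a_4a_5\neq0$ (and $\bar w\neq 0$ on the domain) carry the point symmetries of the PDE with $K$ bijectively to those of the PDE with $\bar K$. Every $K$ admits $V_1=\partial_t$, $V_2=\partial_v$, $V_3=2t\partial_t+v\partial_v$. Modulo these transformations the classification is as follows (in each row the listed fields form a basis of all point symmetries, unless said otherwise): * $K$ not equivalent to any of the functions below: $V_1,V_2,V_3$ (dimension 3); * $K(u)=u^\mu$,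 $u>0$, $\mu\ne-\frac23,-2$: $V_1,V_2,V_3$, $V_4=(2+\mu)v\partial_v-2w\partial_w$ (dimension 4); * $K(u)=u^{-2/3}$, $u>0$: $V_1,V_2,V_3$, $V_4$ with $\mu=-\frac23$, $V_5=3vw\partial_w-v^2\partial_v$ (dimension 5); * $K(u)=u^{-2}$, $u>0$: the point symmetries are exactly the sums of a linear combination of $V_1,V_2,V_3$, $V_4$ with $\mu=-2$, $V_6=-vw\partial_w+2t\partial_v$, $V_7=4t^2\partial_t+4vt\partial_v-(2t+v^2)w\partial_w$ and a field $V_\infty=G(t,v)\partial_w$, where $G$ is a smooth solution of $G_t=G_{vv}$ on $S$ (infinite dimension); * $K(u)=e^{1/u}u^{-2}$: $V_1,V_2,V_3$, $V_8=v\partial_v+2\partial_w$ (dimension 4). The functions $u^\mu$ ($\mu\in\mathbb R$) and $e^{1/u}u^{-2}$ are pairwise inequivalent. In the coordinates $(t,v,u)$ with $u=1/w$ the fields $V_1,V_2,V_3$ keep their form, and $V_4=(2+\mu)v\partial_v+2u\partial_u$, $V_5=-3uv\partial_u-v^2\partial_v$, $V_6=uv\partial_u+2t\partial_v$, $V_7=4t^2\partial_t+4vt\partial_v+(2t+v^2)u\partial_u$,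 $V_\infty=-u^2G(t,v)\partial_u$, $V_8=v\partial_v-2u^2\partial_u$. **II. The class $p_t=-\left(\dfrac{K(u)}{p}\right)_{uu}$**, on a connected open set $B$ of points $(t,u,p)$ with $p\neq0$ whose set of $u$-values is $U$. The transformations (a) $\bar u=a_2u+a_1,\ \bar t=a_4t+a_5,\ \bar p=a_3p,\ \bar K=\dfrac{a_2^2a_3^2}{a_4}K$ with $a_2a_3a_4\ne0$, and (b) $\bar u=\dfrac{u}{1-a_6u},\ \bar t=t,\ \bar p=(1-a_6u)^3p,\ \bar K=(1-a_6u)^2K$ (with $1-a_6u\ne0$ on $U$) carry the point symmetries of the PDE with $K$ bijectively to those of the PDE with $\bar K$. Every $K$ admits $W_1=\partial_t$, $W_2=2t\partial_t+p\partial_p$. For nonconstant $K$, modulo the group generated by (a) and (b), the classification is as follows (in each row the listed fields form a basis of all point symmetries): * $K$ not equivalent to any of the functions below: $W_1,W_2$ (dimension 2); * $K=u^\mu$, $u>0$, $\mu\neq0,-2$: $W_1,W_2$, $W_3=2u\partial_u+(\mu-2)p\partial_p$ (dimension 3); * $K=e^u$: $W_1,W_2$, $W_4=2\partial_u+p\partial_p$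 (dimension 3); * $K=\frac1{1+u^2}e^{\lambda\arctan u}$, $\lambda\in\mathbb R$: $W_1,W_2$, $W_5=2(1+u^2)\partial_u-p(6u-\lambda)\partial_p$ (dimension 3); * $K=u^{-2}$, $u>0$: $W_1,W_2$, $W_3$ with $\mu=-2$, $W_6=u^2\partial_u-3pu\partial_p$ (dimension 4). Functions from different ones of the last four rows are inequivalent. **III. Nonlocal symmetries.** Solutions of $v_t=K(v_x)v_{xx}$ (1) give solutions $u=v_x$ of $u_t=(K(u)u_x)_x$ (2), and $w=x_v=1/v_x$, as a function of $(t,v)$, solves the PDE of I; likewise for solutions $u(t,x)$ of (2), $p=x_u=1/u_x$, as a function of $(t,u)$, solves the PDE of II. A point symmetry of the PDE of I or II *yields a nonlocal symmetry* of (1) or (2) if it is induced under this correspondence by no local symmetry of that equation (with characteristic a smooth function of $t$, $x$, the dependent variable and finitely many of its $x$-derivatives), not even over a nonempty open set of jets on which the field is not identically zero. Then: * for $K=u^{-2/3}$, $V_5$ yields a nonlocal symmetry of (1) and of (2); * for $K=u^{-2}$, $V_6$, $V_7$ and $V_\infty$ with $G\not\equiv0$ yield nonlocal symmetries of (2); *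 for $K=e^{1/u}u^{-2}$, $V_8$ yields a nonlocal symmetry of (2); * for $K=\frac{1}{1+u^2}e^{\lambda\arctan u}$, every $\lambda\in\mathbb R$, $W_5$ yields a nonlocal symmetry of (2); * for $K=u^{-2}$, $W_6$ yields a nonlocal symmetry of (2). -/

import Mathlib

open scoped ContDiff

noncomputable section

/-! ### Point symmetries of scalar second order PDEs in two independent variables

The independent variables are `(t, x)` and the dependent variable is `z`.  Coordinates:
* points `Fin 3 → ℝ` : `(t, x, z)`;
* 1-jets `Fin 5 → ℝ` : `(t, x, z, z_t, z_x)`;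
* 2-jets `Fin 8 → ℝ` : `(t, x, z, z_t, z_x, z_tt, z_tx, z_xx)`. -/

/-- A vector field `τ ∂_t + ξ ∂_x + η ∂_z`, as the map `(t, x, z) ↦ (τ, ξ, η)`. -/
abbrev VField := (Fin 3 → ℝ) → (Fin 3 → ℝ)

/-- Total `t`-derivative `φ_t + z_t φ_z` of a function on points. -/
def totalT0 (φ : (Fin 3 → ℝ) → ℝ) (i : Fin 5 → ℝ) : ℝ :=
  lineDeriv ℝ φ ![i 0, i 1, i 2] ![1, 0, i 3]

/-- Total `x`-derivative `φ_x + z_x φ_z` of a function on points. -/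
def totalX0 (φ : (Fin 3 → ℝ) → ℝ) (i : Fin 5 → ℝ) : ℝ :=
  lineDeriv ℝ φ ![i 0, i 1, i 2] ![0, 1, i 4]

/-- The 1-jet underlying a 2-jet. -/
def jet1 (j : Fin 8 → ℝ) : Fin 5 → ℝ := ![j 0, j 1, j 2, j 3, j 4]

/-- Total `t`-derivative of a function on 1-jets. -/
def totalT1 (φ : (Fin 5 → ℝ) → ℝ) (j : Fin 8 → ℝ) : ℝ :=
  lineDeriv ℝ φ (jet1 j) ![1, 0, j 3, j 5, j 6]

/-- Total `x`-derivative of a function on 1-jets. -/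
def totalX1 (φ : (Fin 5 → ℝ) → ℝ) (j : Fin 8 → ℝ) : ℝ :=
  lineDeriv ℝ φ (jet1 j) ![0, 1, j 4, j 6, j 7]

/-- `η^t = D_t η - z_t D_t τ - z_x D_t ξ`. -/
def coefT (X : VField) (i : Fin 5 → ℝ) : ℝ :=
  totalT0 (fun q => X q 2) i - i 3 * totalT0 (fun q => X q 0) i
    - i 4 * totalT0 (fun q => X q 1) i

/-- `η^x = D_x η - z_t D_x τ - z_x D_x ξ`. -/
def coefX (X : VField) (i : Fin 5 → ℝ) : ℝ :=
  totalX0 (fun q => X q 2) i - i 3 * totalX0 (fun q => X q 0) i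
    - i 4 * totalX0 (fun q => X q 1) i

/-- `η^tt = D_t η^t - z_tt D_t τ - z_tx D_t ξ`. -/
def coefTT (X : VField) (j : Fin 8 → ℝ) : ℝ :=
  totalT1 (coefT X) j - j 5 * totalT0 (fun q => X q 0) (jet1 j)
    - j 6 * totalT0 (fun q => X q 1) (jet1 j)

/-- `η^tx = D_x η^t - z_tt D_x τ - z_tx D_x ξ`. -/
def coefTX (X : VField) (j : Fin 8 → ℝ) : ℝ :=
  totalX1 (coefT X) j - j 5 * totalX0 (fun q => X q 0) (jet1 j)
    - j 6 * totalX0 (fun q => X q 1) (jet1 j)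

/-- `η^xx = D_x η^x - z_tx D_x τ - z_xx D_x ξ`. -/
def coefXX (X : VField) (j : Fin 8 → ℝ) : ℝ :=
  totalX1 (coefX X) j - j 6 * totalX0 (fun q => X q 0) (jet1 j)
    - j 7 * totalX0 (fun q => X q 1) (jet1 j)

/-- The second prolongation of `X`, a vector field on 2-jets. -/
def prolong (X : VField) (j : Fin 8 → ℝ) : Fin 8 → ℝ :=
  ![X ![j 0, j 1, j 2] 0, X ![j 0, j 1, j 2] 1, X ![j 0, j 1, j 2] 2,
    coefT X (jet1 j), coefX X (jet1 j), coefTT X j, coefTX X j, coefXX X j]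

/-- `X`, smooth on the domain `B`, generates a point symmetry of the PDE `F = 0`: the prolonged
field annihilates `F` on the manifold `F = 0` (over `B`) in the space of 2-jets. -/
def IsPointSymmetry (F : (Fin 8 → ℝ) → ℝ) (B : Set (Fin 3 → ℝ)) (X : VField) : Prop :=
  ContDiffOn ℝ ∞ X B ∧
    ∀ j : Fin 8 → ℝ, ![j 0, j 1, j 2] ∈ B → F j = 0 → lineDeriv ℝ F j (prolong X j) = 0

/-- The real vector space of (restrictions to `B` of) the point symmetries of `F = 0`. -/
def symSpace (F : (Fin 8 → ℝ) → ℝ) (B : Set (Fin 3 → ℝ)) :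
    Submodule ℝ (B → (Fin 3 → ℝ)) :=
  Submodule.span ℝ {Y | ∃ X : VField, IsPointSymmetry F B X ∧ Y = B.domRestrict X}

/-- The point symmetries of `F = 0` on `B` are exactly the linear combinations of the `n` fields
`V i`, and they form an `n`-dimensional space. -/
def SymmetryAlgebraIs (F : (Fin 8 → ℝ) → ℝ) (B : Set (Fin 3 → ℝ)) {n : ℕ}
    (V : Fin n → VField) : Prop :=
  (∀ X : VField, IsPointSymmetry F B X ↔
    ∃ c : Fin n → ℝ, ∀ q ∈ B, X q = ∑ i, c i • V i q) ∧
  Module.finrank ℝ (symSpace F B) = n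

/-- The point transformation `φ` carries the field `X` on `B` to the field `Y` on `φ(B)`. -/
def PushesTo (φ : (Fin 3 → ℝ) → (Fin 3 → ℝ)) (B : Set (Fin 3 → ℝ)) (X Y : VField) : Prop :=
  ∀ q ∈ B, Y (φ q) = fderiv ℝ φ q (X q)

/-! ### The constitutive functions -/

/-- A nonempty open interval (bounded or not). -/
def IsOpenInterval (U : Set ℝ) : Prop := IsOpen U ∧ U.Nonempty ∧ U.OrdConnected

/-- `K` is a smooth nowhere vanishing function on the open interval `U`. -/
def IsConstitutive (U : Set ℝ) (K : ℝ → ℝ) : Prop :=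
  IsOpenInterval U ∧ ContDiffOn ℝ ∞ K U ∧ ∀ u ∈ U, K u ≠ 0

/-- `K(u) = u^μ`, where `u > 0`. -/
def IsPower (μ : ℝ) (U : Set ℝ) (K : ℝ → ℝ) : Prop :=
  U ⊆ Set.Ioi 0 ∧ ∀ u ∈ U, K u = u ^ μ

/-! ### The class `w_t = (K(1/w) w_v / w^2)_v`, with coordinates `(t, v, w)` -/

/-- The PDE `w_t - (K(1/w) w_v / w^2)_v = 0`. -/
def pdeW (K : ℝ → ℝ) (j : Fin 8 → ℝ) : ℝ :=
  j 3 - totalX1 (fun i => K (1 / i 2) * i 4 / (i 2) ^ 2) j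

/-- The values of `w` for which `u = 1/w` lies in `U`. -/
def wRange (U : Set ℝ) : Set ℝ := {w | w ≠ 0 ∧ 1 / w ∈ U}

/-- The points `(t, v, w)` with `(t, v) ∈ S` and `1/w ∈ U`. -/
def domW (S : Set (ℝ × ℝ)) (U : Set ℝ) : Set (Fin 3 → ℝ) :=
  {q | (q 0, q 1) ∈ S ∧ q 2 ∈ wRange U}

/-- The point part of an equivalence transformation of the class: `t ↦ a₅ t + a₆`,
`v ↦ a₃ v + a₁`, `w ↦ a₄ w + a₂`. -/
def equivMapW (a₁ a₂ a₃ a₄ a₅ a₆ : ℝ) (q : Fin 3 → ℝ) : Fin 3 → ℝ :=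
  ![a₅ * q 0 + a₆, a₃ * q 1 + a₁, a₄ * q 2 + a₂]

/-- The equivalence transformation with parameters `a₁, …, a₆` takes `K` on `U` to `K'` on `U'`. -/
def EquivW (_a₁ a₂ a₃ a₄ a₅ _a₆ : ℝ) (U : Set ℝ) (K : ℝ → ℝ) (U' : Set ℝ) (K' : ℝ → ℝ) : Prop :=
  a₃ * a₄ * a₅ ≠ 0 ∧ 0 ∉ U' ∧ wRange U' = (fun w => a₄ * w + a₂) '' wRange U ∧
    ∀ w ∈ wRange U,
      K' (1 / (a₄ * w + a₂)) = a₃ ^ 2 * (a₄ * w + a₂) ^ 2 / (a₅ * w ^ 2) * K (1 / w)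

/-- `K(u) = e^{1/u} u^{-2}`. -/
def IsExpInv (U : Set ℝ) (K : ℝ → ℝ) : Prop :=
  ∀ u ∈ U, K u = Real.exp (1 / u) * (u ^ 2)⁻¹

def V₁ : VField := fun _ => ![1, 0, 0]
def V₂ : VField := fun _ => ![0, 1, 0]
def V₃ : VField := fun q => ![2 * q 0, q 1, 0]
def V₄ (μ : ℝ) : VField := fun q => ![0, (2 + μ) * q 1, -2 * q 2]
def V₅ : VField := fun q => ![0, -(q 1) ^ 2, 3 * q 1 * q 2]
def V₆ : VField := fun q => ![0, 2 * q 0, -(q 1 * q 2)]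
def V₇ : VField := fun q =>
  ![4 * (q 0) ^ 2, 4 * q 1 * q 0, -((2 * q 0 + (q 1) ^ 2) * q 2)]
def VInf (G : ℝ × ℝ → ℝ) : VField := fun q => ![0, 0, G (q 0, q 1)]
def V₈ : VField := fun q => ![0, q 1, 2]

/-- `G(t, v)` is a smooth solution of `G_t = G_vv` on `S`. -/
def IsHeatSolution (S : Set (ℝ × ℝ)) (G : ℝ × ℝ → ℝ) : Prop :=
  ContDiffOn ℝ ∞ G S ∧ ∀ s ∈ S,
    lineDeriv ℝ G s (1, 0) = lineDeriv ℝ (fun r => lineDeriv ℝ G r (0, 1)) s (0, 1)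

/-- The change of coordinates `(t, v, w) ↦ (t, v, u)` with `u = 1/w`. -/
def invCoord (q : Fin 3 → ℝ) : Fin 3 → ℝ := ![q 0, q 1, 1 / q 2]

/-! ### The class `p_t = -(K(u)/p)_uu`, with coordinates `(t, u, p)` -/

/-- The PDE `p_t + (K(u)/p)_uu = 0`. -/
def pdeP (K : ℝ → ℝ) (j : Fin 8 → ℝ) : ℝ :=
  j 3 + totalX1 (totalX0 (fun q => K (q 1) / q 2)) j

/-- `B` is a connected open set of points `(t, u, p)`, `p ≠ 0`, whose values of `u` fill `U`. -/
def IsDomainP (U : Set ℝ) (B : Set (Fin 3 → ℝ)) : Prop :=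
  IsOpen B ∧ IsConnected B ∧ (∀ q ∈ B, q 2 ≠ 0) ∧ (fun q : Fin 3 → ℝ => q 1) '' B = U

/-- The point part of the affine equivalence transformations: `t ↦ a₄ t + a₅`, `u ↦ a₂ u + a₁`,
`p ↦ a₃ p`. -/
def affineMapP (a₁ a₂ a₃ a₄ a₅ : ℝ) (q : Fin 3 → ℝ) : Fin 3 → ℝ :=
  ![a₄ * q 0 + a₅, a₂ * q 1 + a₁, a₃ * q 2]

/-- The affine equivalence transformation takes `K` on `U` to `K'` on `U'`. -/
def AffineStepP (a₁ a₂ a₃ a₄ _a₅ : ℝ) (U : Set ℝ) (K : ℝ → ℝ) (U' : Set ℝ) (K' : ℝ → ℝ) :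
    Prop :=
  a₂ * a₃ * a₄ ≠ 0 ∧ U' = (fun u => a₂ * u + a₁) '' U ∧
    ∀ u ∈ U, K' (a₂ * u + a₁) = a₂ ^ 2 * a₃ ^ 2 / a₄ * K u

/-- The point part of the projective equivalence transformations: `u ↦ u / (1 - a₆ u)`,
`p ↦ (1 - a₆ u)^3 p`. -/
def projMapP (a₆ : ℝ) (q : Fin 3 → ℝ) : Fin 3 → ℝ :=
  ![q 0, q 1 / (1 - a₆ * q 1), (1 - a₆ * q 1) ^ 3 * q 2]

/-- The projective equivalence transformation takes `K` on `U` to `K'` on `U'`. -/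
def ProjStepP (a₆ : ℝ) (U : Set ℝ) (K : ℝ → ℝ) (U' : Set ℝ) (K' : ℝ → ℝ) : Prop :=
  (∀ u ∈ U, 1 - a₆ * u ≠ 0) ∧ U' = (fun u => u / (1 - a₆ * u)) '' U ∧
    ∀ u ∈ U, K' (u / (1 - a₆ * u)) = (1 - a₆ * u) ^ 2 * K u

/-- Equivalence under the group generated by the affine and the projective transformations. -/
def EquivP (U : Set ℝ) (K : ℝ → ℝ) (U' : Set ℝ) (K' : ℝ → ℝ) : Prop :=
  Relation.ReflTransGen
    (fun (c d : Set ℝ × (ℝ → ℝ)) =>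
      (∃ a₁ a₂ a₃ a₄ a₅ : ℝ, AffineStepP a₁ a₂ a₃ a₄ a₅ c.1 c.2 d.1 d.2) ∨
        ∃ a₆ : ℝ, ProjStepP a₆ c.1 c.2 d.1 d.2)
    (U, K) (U', K')

/-- `K(u) = e^u`. -/
def IsExp (U : Set ℝ) (K : ℝ → ℝ) : Prop := ∀ u ∈ U, K u = Real.exp u

/-- `K(u) = e^{l arctan u} / (1 + u^2)`. -/
def IsArctan (l : ℝ) (U : Set ℝ) (K : ℝ → ℝ) : Prop :=
  ∀ u ∈ U, K u = 1 / (1 + u ^ 2) * Real.exp (l * Real.arctan u)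

/-- The four special rows of the classification of the class `p_t = -(K(u)/p)_uu`. -/
def RowP (i : Fin 4) (U : Set ℝ) (K : ℝ → ℝ) : Prop :=
  IsOpenInterval U ∧
    ![∃ μ : ℝ, μ ≠ 0 ∧ μ ≠ -2 ∧ IsPower μ U K, IsExp U K, ∃ l : ℝ, IsArctan l U K,
      IsPower (-2) U K] i

def W₁ : VField := fun _ => ![1, 0, 0]
def W₂ : VField := fun q => ![2 * q 0, 0, q 2]
def W₃ (μ : ℝ) : VField := fun q => ![0, 2 * q 1, (μ - 2) * q 2]
def W₄ : VField := fun q => ![0, 2, q 2]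
def W₅ (l : ℝ) : VField := fun q => ![0, 2 * (1 + (q 1) ^ 2), -(q 2 * (6 * q 1 - l))]
def W₆ : VField := fun q => ![0, (q 1) ^ 2, -(3 * q 2 * q 1)]

/-! ### Local symmetries of evolution equations `z_t = F[z]` and nonlocal symmetries -/

/-- Jets of solutions of an evolution equation: `(t, x, z)` with `z k` standing for `∂_x^k z`;
the `t`-derivatives are eliminated by the equation. -/
abbrev EJet := ℝ × ℝ × (ℕ → ℝ)

/-- `g` is on `Ω` a differential function: a smooth function of `t`, `x` and finitely many of
the `z_k`. -/
def IsDiffFun (Ω : Set EJet) (g : EJet → ℝ) : Prop :=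
  ∃ (n : ℕ) (ψ : ℝ × ℝ × (Fin n → ℝ) → ℝ),
    ContDiffOn ℝ ∞ ψ ((fun J : EJet => (J.1, J.2.1, fun k : Fin n => J.2.2 k)) '' Ω) ∧
    ∀ J ∈ Ω, g J = ψ (J.1, J.2.1, fun k : Fin n => J.2.2 k)

/-- Total `x`-derivative: `∂_x + ∑ z_{k+1} ∂/∂z_k`. -/
def Dx (g : EJet → ℝ) (J : EJet) : ℝ :=
  lineDeriv ℝ g J (0, 1, fun k => J.2.2 (k + 1))

/-- Total `t`-derivative on solutions of `z_t = F`: `∂_t + ∑ (D_x^k F) ∂/∂z_k`. -/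
def Dt (F : EJet → ℝ) (g : EJet → ℝ) (J : EJet) : ℝ :=
  lineDeriv ℝ g J (1, 0, fun k => (Dx^[k] F) J)

/-- The linearization `∑ (D_x^k g) ∂F/∂z_k` of `F` in the direction `g`. -/
def linearize (F : EJet → ℝ) (g : EJet → ℝ) (J : EJet) : ℝ :=
  lineDeriv ℝ F J (0, 0, fun k => (Dx^[k] g) J)

/-- The evolutionary field `g ∂/∂z` is on `Ω` a local symmetry of `z_t = F`. -/
def IsLocalSymmetry (F : EJet → ℝ) (Ω : Set EJet) (g : EJet → ℝ) : Prop :=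
  IsDiffFun Ω g ∧ ∀ J ∈ Ω, Dt F g J = linearize F g J

/-- Right-hand side of `v_t = K(v_x) v_xx`. -/
def rhsV (K : ℝ → ℝ) (J : EJet) : ℝ := K (J.2.2 1) * J.2.2 2

/-- Right-hand side of `u_t = (K(u) u_x)_x`. -/
def rhsU (K : ℝ → ℝ) : EJet → ℝ := Dx (fun J => K (J.2.2 0) * J.2.2 1)

/-- Interchange `x` and `z`: the point `(t, y, ω)` with `y = z` and `ω = x_y = 1 / z_x`. -/
def hodoPoint (J : EJet) : Fin 3 → ℝ := ![J.1, J.2.2 0, 1 / J.2.2 1]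

/-- If `z` (at fixed `x`) changes at the rate `g`, then `x` (at fixed `y = z`) changes at the rate
`-g / z_x`, and `ω = x_y` changes at the rate `D_y (-g / z_x)`, where `D_y = (1 / z_x) D_x`. -/
def hodoVariation (g : EJet → ℝ) (J : EJet) : ℝ :=
  -Dx (fun I => g I / I.2.2 1) J / J.2.2 1

/-- The characteristic `η - ξ ω_y - τ ω_t` of a field `X = τ ∂_t + ξ ∂_y + η ∂_ω`, evaluated on
the functions `ω(t, y)` that come from solutions of `z_t = F`. -/
def hodoChar (F : EJet → ℝ) (X : VField) (J : EJet) : ℝ :=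
  X (hodoPoint J) 2 - X (hodoPoint J) 1 * (Dx (fun I => 1 / I.2.2 1) J / J.2.2 1)
    - X (hodoPoint J) 0 * hodoVariation F J

/-- On `Ω`, the field `X` in the variables `(t, y, ω)` comes from a local symmetry of
`z_t = F`. -/
def InducedByLocal (F : EJet → ℝ) (X : VField) (Ω : Set EJet) : Prop :=
  ∃ g : EJet → ℝ, IsLocalSymmetry F Ω g ∧ ∀ J ∈ Ω, hodoVariation g J = hodoChar F X J

/-- Jet of `u = v_x` from that of `v`. -/
def derivJet (J : EJet) : EJet := (J.1, J.2.1, fun k => J.2.2 (k + 1))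

/-- On `Ω` (jets of the potential `v`, `v_x = u`, `v_t = K(u) u_x`), the field `X` in the variables
`(t, v, w)`, `w = 1/u`, comes from a local symmetry `g` of `u_t = (K(u) u_x)_x`; here `h` is the
rate of change of `v` that accompanies the rate of change `g` of `u`. -/
def InducedByLocalU (K : ℝ → ℝ) (X : VField) (Ω : Set EJet) : Prop :=
  ∃ g h : EJet → ℝ, IsLocalSymmetry (rhsU K) (derivJet '' Ω) g ∧ IsDiffFun Ω h ∧
    ∀ J ∈ Ω, Dx h J = g (derivJet J) ∧ hodoVariation h J = hodoChar (rhsV K) X J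

/-- `X` is a point symmetry on `B` of the PDE `P = 0`, and it comes from a local symmetry (in the
sense of `Ind`) on no nonempty open set of jets over `B` on which it is not identically zero. -/
def YieldsNonlocal (P : (Fin 8 → ℝ) → ℝ) (Ind : VField → Set EJet → Prop)
    (B : Set (Fin 3 → ℝ)) (X : VField) : Prop :=
  IsPointSymmetry P B X ∧
    ∀ Ω : Set EJet, IsOpen Ω → (∀ J ∈ Ω, hodoPoint J ∈ B) → (∃ J ∈ Ω, X (hodoPoint J) ≠ 0) →
      ¬ Ind X Ω

/-- The point symmetry `X` of `w_t = (K(1/w) w_v / w^2)_v` yields a nonlocal symmetry of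
`v_t = K(v_x) v_xx`. -/
def YieldsNonlocalV (K : ℝ → ℝ) (B : Set (Fin 3 → ℝ)) (X : VField) : Prop :=
  YieldsNonlocal (pdeW K) (InducedByLocal (rhsV K)) B X

/-- The point symmetry `X` of `w_t = (K(1/w) w_v / w^2)_v` yields a nonlocal symmetry of
`u_t = (K(u) u_x)_x`. -/
def YieldsNonlocalU (K : ℝ → ℝ) (B : Set (Fin 3 → ℝ)) (X : VField) : Prop :=
  YieldsNonlocal (pdeW K) (InducedByLocalU K) B X

/-- The point symmetry `X` of `p_t = -(K(u)/p)_uu` yields a nonlocal symmetry of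
`u_t = (K(u) u_x)_x`. -/
def YieldsNonlocalP (K : ℝ → ℝ) (B : Set (Fin 3 → ℝ)) (X : VField) : Prop :=
  YieldsNonlocal (pdeP K) (InducedByLocal (rhsU K)) B X

end

/-! An equation z_t = A z_xx + E z_x² + C z_x + D with A ≠ 0 encodes its point symmetries in linear
determining equations. Once z_t is eliminated, the invariance condition is polynomial in the free
coordinates z_x, z_tx, z_xx, and its coefficients must vanish (`isPointSymmetry_iff_detEqs`). In
particular τ depends on t alone and ξ on t and x alone.

I. With f(w) = K(1/w)/w² the class reads w_t = (f(w) w_v)_v, and an equivalence transformation is an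
affine change of the variables together with a constant rescaling of f. The determining equations
make η affine in w and give f' η = f (2ξ_v − τ_t). If η ≠ 0 at some point, this is, along the
w-fibre of that point, an ordinary differential equation f' (a w + b) = r f; hence f is a constant,
an exponential, or a power of an affine function, and K is equivalent to a row of the table
(`const_or_exp_or_power_of_ode`, `exists_equivW_of_ode`). Otherwise η = 0 and only `V₁`, `V₂`, `V₃`
survive. In the rows with nonconstant f, relations P = f E with P and E free of w split into P = 0
and E = 0 (`eq_zero_of_eq_mul`); constant f is the heat equation (`detW_heat`). Logarithmic
derivatives of f separate the rows.

II. Here everything reduces to K' ξ = (α − ξ') K with ξ a quadratic polynomial in u and α a constant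
(`detP_solution`, `detP_of_solution`). The affine and projective transformations move ξ ∂_u as a
quadratic vector field on the projective line and keep α and the discriminant of ξ. A quadratic ξ
with negative discriminant becomes proportional to 1 + u²; one with real roots has a root outside U,
which can be sent to infinity, so that ξ becomes affine and the equation of part I returns. The set
of discriminant signs that occur (`HasQuadP`) distinguishes the rows.

III. A field is induced by a variation g of z exactly when D_x(g/z₁) equals an explicit function of
the jet. After known total derivatives are subtracted, a function of low order remains that must
still be a total derivative. The commutator of ∂/∂z_k with D_x shows that a total derivative free of
z₁, z₂, … is also free of z₀ (`IsDiffFun.lineDeriv_zero_eq_zero_of_Dx`); this rules out `V₅`, `V₆`,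
`V₇`, `W₅`, `W₆`. For `VInf` and `V₈` the obstruction is different: the variation D_x h of u = v_x
would depend on the potential v itself. -/

/-- Partial derivative of a function on points. -/
noncomputable def pd (i : Fin 3) (f : (Fin 3 → ℝ) → ℝ) (q : Fin 3 → ℝ) : ℝ :=
  lineDeriv ℝ f q (Pi.single i 1)

/-- `d` is the partial derivative of `f` at `q`. -/
def HasPD (i : Fin 3) (f : (Fin 3 → ℝ) → ℝ) (d : ℝ) (q : Fin 3 → ℝ) : Prop :=
  HasLineDerivAt ℝ f d q (Pi.single i 1)

/-! ### Partial derivatives of functions of three variables. -/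

section PartialDerivatives

variable {i j : Fin 3} {f g : (Fin 3 → ℝ) → ℝ} {d d' : ℝ} {q : Fin 3 → ℝ} {B : Set (Fin 3 → ℝ)}

theorem HasPD.pd_eq (h : HasPD i f d q) : pd i f q = d := HasLineDerivAt.lineDeriv h

theorem HasPD.unique (h : HasPD i f d q) (h' : HasPD i f d' q) : d = d' :=
  h.pd_eq.symm.trans h'.pd_eq

theorem HasPD.add (hf : HasPD i f d q) (hg : HasPD i g d' q) :
    HasPD i (fun q => f q + g q) (d + d') q := HasDerivAt.add hf hg

theorem HasPD.sub (hf : HasPD i f d q) (hg : HasPD i g d' q) :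
    HasPD i (fun q => f q - g q) (d - d') q := HasDerivAt.sub hf hg

theorem HasPD.neg (hf : HasPD i f d q) : HasPD i (fun q => -f q) (-d) q := HasDerivAt.neg hf

theorem HasPD.mul (hf : HasPD i f d q) (hg : HasPD i g d' q) :
    HasPD i (fun q => f q * g q) (d * g q + f q * d') q := by
  have h := HasDerivAt.mul hf hg
  simp only [zero_smul, add_zero] at h
  exact h

theorem HasPD.const (c : ℝ) : HasPD i (fun _ => c) 0 q := hasDerivAt_const _ _

theorem HasPD.const_mul (c : ℝ) (hf : HasPD i f d q) : HasPD i (fun q => c * f q) (c * d) q :=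
  HasDerivAt.const_mul c hf

theorem HasPD.coord (i j : Fin 3) (q : Fin 3 → ℝ) :
    HasPD i (fun q => q j) (if i = j then 1 else 0) q := by
  unfold HasPD HasLineDerivAt
  by_cases h : i = j
  · subst h
    simpa using (hasDerivAt_id (0 : ℝ)).const_add (q i)
  · simpa [h, Pi.single_apply, Ne.symm h] using hasDerivAt_const (0 : ℝ) (q j)

theorem HasPD.comp_coord {k : ℝ → ℝ} {k' : ℝ} (i j : Fin 3) {q : Fin 3 → ℝ}
    (hk : HasDerivAt k k' (q j)) : HasPD i (fun q => k (q j)) (if i = j then k' else 0) q := by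
  have h := HasPD.coord i j q
  unfold HasPD HasLineDerivAt at *
  have h2 := HasDerivAt.comp (h₂ := k) (h₂' := k') (0 : ℝ) (by simpa using hk) h
  rw [mul_ite, mul_one, mul_zero] at h2
  exact h2

theorem HasPD.congr (hf : HasPD i f d q) (h : d = d') : HasPD i f d' q := h ▸ hf

theorem eventually_line_mem (hB : IsOpen B) (hq : q ∈ B) (v : Fin 3 → ℝ) :
    ∀ᶠ s : ℝ in nhds 0, q + s • v ∈ B := by
  have hc : Continuous (fun s : ℝ => q + s • v) := by fun_prop
  exact hc.continuousAt.eventually_mem (by simpa using hB.mem_nhds hq)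

/-- The determining equations are identities on the open set `B` only; this is what allows them to
be differentiated again. -/
theorem HasPD.congr_on (hB : IsOpen B) (hq : q ∈ B) (hf : HasPD i f d q)
    (h : ∀ q ∈ B, g q = f q) : HasPD i g d q := by
  refine HasDerivAt.congr_of_eventuallyEq hf ?_
  filter_upwards [eventually_line_mem hB hq (Pi.single i 1)] with s hs using h _ hs

theorem pd_congr (hB : IsOpen B) (hq : q ∈ B) (h : ∀ q ∈ B, g q = f q) : pd i g q = pd i f q := by
  refine Filter.EventuallyEq.deriv_eq ?_
  filter_upwards [eventually_line_mem hB hq (Pi.single i 1)] with s hs using h _ hs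

theorem ContDiffOn.differentiableAt_of_open (hf : ContDiffOn ℝ ∞ f B) (hB : IsOpen B)
    (hq : q ∈ B) : DifferentiableAt ℝ f q :=
  (hf.contDiffAt (hB.mem_nhds hq)).differentiableAt (by simp)

theorem pd_eq_fderiv (hf : ContDiffOn ℝ ∞ f B) (hB : IsOpen B) (hq : q ∈ B) :
    pd i f q = fderiv ℝ f q (Pi.single i 1) :=
  (hf.differentiableAt_of_open hB hq).lineDeriv_eq_fderiv

theorem fderiv_eq_pd (hf : ContDiffOn ℝ ∞ f B) (hB : IsOpen B) (hq : q ∈ B) (v : Fin 3 → ℝ) :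
    fderiv ℝ f q v = v 0 * pd 0 f q + v 1 * pd 1 f q + v 2 * pd 2 f q := by
  have hv : v = v 0 • Pi.single 0 1 + v 1 • Pi.single 1 1 + v 2 • Pi.single 2 1 := by
    ext k; fin_cases k <;> simp
  conv_lhs => rw [hv]
  simp only [map_add, map_smul, smul_eq_mul, pd_eq_fderiv hf hB hq]

theorem ContDiffOn.hasPD (hf : ContDiffOn ℝ ∞ f B) (hB : IsOpen B) (hq : q ∈ B) (i : Fin 3) :
    HasPD i f (pd i f q) q :=
  (hf.differentiableAt_of_open hB hq).lineDifferentiableAt.hasLineDerivAt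

theorem ContDiffOn.pd (hf : ContDiffOn ℝ ∞ f B) (hB : IsOpen B) (i : Fin 3) :
    ContDiffOn ℝ ∞ (pd i f) B := by
  have h : ContDiffOn ℝ ∞ (fun q => fderiv ℝ f q (Pi.single i 1)) B :=
    (hf.fderiv_of_isOpen hB (by simp)).clm_apply contDiffOn_const
  exact h.congr fun q hq => pd_eq_fderiv hf hB hq

theorem pd_comm (hf : ContDiffOn ℝ ∞ f B) (hB : IsOpen B) (hq : q ∈ B) (i j : Fin 3) :
    pd i (pd j f) q = pd j (pd i f) q := by
  have key : ∀ i j : Fin 3, pd i (pd j f) q =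
      fderiv ℝ (fderiv ℝ f) q (Pi.single i 1) (Pi.single j 1) := by
    intro i j
    rw [pd_congr hB hq (fun q hq => pd_eq_fderiv hf hB hq)]
    have hd : DifferentiableAt ℝ (fderiv ℝ f) q :=
      ((hf.fderiv_of_isOpen (m := ∞) hB (by simp)).contDiffAt (hB.mem_nhds hq)).differentiableAt
        (by simp)
    have h2 := hd.hasFDerivAt.clm_apply (hasFDerivAt_const (Pi.single j (1 : ℝ) : Fin 3 → ℝ) q)
    rw [pd, h2.differentiableAt.lineDeriv_eq_fderiv, h2.fderiv]
    simp
  rw [key, key]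
  exact ((hf.contDiffAt (hB.mem_nhds hq)).isSymmSndFDerivAt
    (by simpa using WithTop.coe_le_coe.2 (le_top : (2 : ℕ∞) ≤ ⊤))).eq _ _

theorem ContDiffOn.hasDerivAt_curve (hf : ContDiffOn ℝ ∞ f B) (hB : IsOpen B) {γ : ℝ → Fin 3 → ℝ}
    {v : Fin 3 → ℝ} {s : ℝ} (hq : γ s ∈ B) (hγ : HasDerivAt γ v s) :
    HasDerivAt (fun s => f (γ s))
      (v 0 * _root_.pd 0 f (γ s) + v 1 * _root_.pd 1 f (γ s) + v 2 * _root_.pd 2 f (γ s)) s := by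
  rw [← fderiv_eq_pd hf hB hq]
  exact (hf.differentiableAt_of_open hB hq).hasFDerivAt.comp_hasDerivAt s hγ

theorem ContDiffOn.lineDeriv_eq (hf : ContDiffOn ℝ ∞ f B) (hB : IsOpen B) (hq : q ∈ B)
    (v : Fin 3 → ℝ) :
    lineDeriv ℝ f q v = v 0 * _root_.pd 0 f q + v 1 * _root_.pd 1 f q + v 2 * _root_.pd 2 f q := by
  rw [(hf.differentiableAt_of_open hB hq).lineDeriv_eq_fderiv, fderiv_eq_pd hf hB hq]

/-- Two functions with the same partial derivatives on a connected open set differ by a constant. -/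
theorem exists_eq_add_const (hB : IsOpen B) (hc : IsPreconnected B) (hf : ContDiffOn ℝ ∞ f B)
    (hg : ContDiffOn ℝ ∞ g B) (h : ∀ i, ∀ q ∈ B, pd i f q = pd i g q) :
    ∃ c, ∀ q ∈ B, f q = g q + c := by
  refine hB.exists_eq_add_of_fderiv_eq hc (𝕜 := ℝ)
    (fun q hq => (hf.differentiableAt_of_open hB hq).differentiableWithinAt)
    (fun q hq => (hg.differentiableAt_of_open hB hq).differentiableWithinAt) ?_
  intro q hq
  ext1 v
  rw [fderiv_eq_pd hf hB hq, fderiv_eq_pd hg hB hq, h 0 q hq, h 1 q hq, h 2 q hq]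

theorem exists_eq_const (hB : IsOpen B) (hc : IsPreconnected B) (hf : ContDiffOn ℝ ∞ f B)
    (h0 : ∀ q ∈ B, pd 0 f q = 0) (h1 : ∀ q ∈ B, pd 1 f q = 0) (h2 : ∀ q ∈ B, pd 2 f q = 0) :
    ∃ c, ∀ q ∈ B, f q = c := by
  obtain ⟨c, hc⟩ := exists_eq_add_const hB hc hf (contDiffOn_const (c := (0 : ℝ))) (by
    intro i q hq
    rw [(HasPD.const (i := i) (q := q) 0).pd_eq]
    fin_cases i
    · exact h0 q hq
    · exact h1 q hq
    · exact h2 q hq)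
  exact ⟨c, fun q hq => by simpa using hc q hq⟩

theorem pd_eq_zero_of_eq_const (hB : IsOpen B) {c : ℝ} (h : ∀ q ∈ B, f q = c) (i : Fin 3)
    (hq : q ∈ B) : pd i f q = 0 :=
  ((HasPD.const c).congr_on hB hq h).pd_eq

end PartialDerivatives

/-! ### Second prolongations and the determining equations of quasilinear equations. -/

section Prolongation

variable {B : Set (Fin 3 → ℝ)} {X : VField} {f : (Fin 3 → ℝ) → ℝ}

theorem ContDiffOn.comp_apply (hX : ContDiffOn ℝ ∞ X B) (k : Fin 3) :
    ContDiffOn ℝ ∞ (fun q => X q k) B := (contDiffOn_pi.1 hX) k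

theorem hasDerivAt_vec3 {a b c : ℝ → ℝ} {a' b' c' s : ℝ} (ha : HasDerivAt a a' s)
    (hb : HasDerivAt b b' s) (hc : HasDerivAt c c' s) :
    HasDerivAt (fun s => ![a s, b s, c s]) ![a', b', c'] s := by
  rw [hasDerivAt_pi]
  intro k
  fin_cases k
  · exact ha
  · exact hb
  · exact hc

theorem hasDerivAt_affine (a b : ℝ) : HasDerivAt (fun s : ℝ => a + s * b) b 0 := by
  simpa using ((hasDerivAt_id (0 : ℝ)).mul_const b).const_add a

/-- The base coordinates are selected by indices in a jet of arbitrary length, so that the same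
chain rule serves 1-jets and 2-jets. -/
theorem hasDerivAt_jet {n : ℕ} (hf : ContDiffOn ℝ ∞ f B) (hB : IsOpen B) (j w : Fin n → ℝ)
    (a b c : Fin n) (hq : ![j a, j b, j c] ∈ B) :
    HasDerivAt (fun s : ℝ => f ![(j + s • w) a, (j + s • w) b, (j + s • w) c])
      (w a * pd 0 f ![j a, j b, j c] + w b * pd 1 f ![j a, j b, j c]
        + w c * pd 2 f ![j a, j b, j c]) 0 := by
  have h := hf.hasDerivAt_curve hB (s := (0 : ℝ)) (v := ![w a, w b, w c])
    (γ := fun s => ![j a + s * w a, j b + s * w b, j c + s * w c]) (by simpa using hq)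
    (hasDerivAt_vec3 (hasDerivAt_affine _ _) (hasDerivAt_affine _ _) (hasDerivAt_affine _ _))
  simpa using h

theorem hasDerivAt_jet_apply {n : ℕ} (j w : Fin n → ℝ) (k : Fin n) :
    HasDerivAt (fun s : ℝ => (j + s • w) k) (w k) 0 := by
  simpa using hasDerivAt_affine (j k) (w k)

theorem eventually_jet_mem {n : ℕ} (hB : IsOpen B) (j w : Fin n → ℝ) (a b c : Fin n)
    (hq : ![j a, j b, j c] ∈ B) :
    ∀ᶠ s : ℝ in nhds 0, ![(j + s • w) a, (j + s • w) b, (j + s • w) c] ∈ B := by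
  have hc : Continuous (fun s : ℝ => ![(j + s • w) a, (j + s • w) b, (j + s • w) c]) := by
    refine continuous_pi fun k => ?_
    fin_cases k <;> simp <;> fun_prop
  exact hc.continuousAt.eventually_mem (by simpa using hB.mem_nhds hq)

theorem totalX0_eq (hf : ContDiffOn ℝ ∞ f B) (hB : IsOpen B) {i : Fin 5 → ℝ}
    (hq : ![i 0, i 1, i 2] ∈ B) :
    totalX0 f i = pd 1 f ![i 0, i 1, i 2] + i 4 * pd 2 f ![i 0, i 1, i 2] := by
  rw [totalX0, hf.lineDeriv_eq hB hq]; simp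

theorem totalT0_eq (hf : ContDiffOn ℝ ∞ f B) (hB : IsOpen B) {i : Fin 5 → ℝ}
    (hq : ![i 0, i 1, i 2] ∈ B) :
    totalT0 f i = pd 0 f ![i 0, i 1, i 2] + i 3 * pd 2 f ![i 0, i 1, i 2] := by
  rw [totalT0, hf.lineDeriv_eq hB hq]; simp

theorem coefT_eq (hX : ContDiffOn ℝ ∞ X B) (hB : IsOpen B) {i : Fin 5 → ℝ}
    (hq : ![i 0, i 1, i 2] ∈ B) :
    coefT X i = (pd 0 (fun q => X q 2) ![i 0, i 1, i 2] + i 3 * pd 2 (fun q => X q 2) ![i 0, i 1, i 2])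
      - i 3 * (pd 0 (fun q => X q 0) ![i 0, i 1, i 2] + i 3 * pd 2 (fun q => X q 0) ![i 0, i 1, i 2])
      - i 4 * (pd 0 (fun q => X q 1) ![i 0, i 1, i 2] + i 3 * pd 2 (fun q => X q 1) ![i 0, i 1, i 2]) := by
  rw [coefT, totalT0_eq (hX.comp_apply 2) hB hq, totalT0_eq (hX.comp_apply 1) hB hq,
    totalT0_eq (hX.comp_apply 0) hB hq]

theorem coefX_eq (hX : ContDiffOn ℝ ∞ X B) (hB : IsOpen B) {i : Fin 5 → ℝ}
    (hq : ![i 0, i 1, i 2] ∈ B) :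
    coefX X i = (pd 1 (fun q => X q 2) ![i 0, i 1, i 2] + i 4 * pd 2 (fun q => X q 2) ![i 0, i 1, i 2])
      - i 3 * (pd 1 (fun q => X q 0) ![i 0, i 1, i 2] + i 4 * pd 2 (fun q => X q 0) ![i 0, i 1, i 2])
      - i 4 * (pd 1 (fun q => X q 1) ![i 0, i 1, i 2] + i 4 * pd 2 (fun q => X q 1) ![i 0, i 1, i 2]) := by
  rw [coefX, totalX0_eq (hX.comp_apply 2) hB hq, totalX0_eq (hX.comp_apply 1) hB hq,
    totalX0_eq (hX.comp_apply 0) hB hq]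

/-- The base point and the three components enter as variables with defining equations, so that the
prolongation becomes a polynomial in the jet coordinates and in derivatives at a single point `q`.
-/
theorem coefXX_eq (hX : ContDiffOn ℝ ∞ X B) (hB : IsOpen B) {j : Fin 8 → ℝ} {q : Fin 3 → ℝ}
    (hj : q = ![j 0, j 1, j 2]) (hq : q ∈ B) {τ ξ η : (Fin 3 → ℝ) → ℝ} (hτ : τ = fun q => X q 0)
    (hξ : ξ = fun q => X q 1) (hη : η = fun q => X q 2) :
    coefXX X j =
      (pd 1 (pd 1 η) q + j 4 * pd 2 (pd 1 η) q + (j 7 * pd 2 η q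
          + j 4 * (pd 1 (pd 2 η) q + j 4 * pd 2 (pd 2 η) q)))
      - (j 6 * (pd 1 τ q + j 4 * pd 2 τ q) + j 3 * (pd 1 (pd 1 τ) q + j 4 * pd 2 (pd 1 τ) q
          + (j 7 * pd 2 τ q + j 4 * (pd 1 (pd 2 τ) q + j 4 * pd 2 (pd 2 τ) q))))
      - (j 7 * (pd 1 ξ q + j 4 * pd 2 ξ q) + j 4 * (pd 1 (pd 1 ξ) q + j 4 * pd 2 (pd 1 ξ) q
          + (j 7 * pd 2 ξ q + j 4 * (pd 1 (pd 2 ξ) q + j 4 * pd 2 (pd 2 ξ) q))))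
      - j 6 * (pd 1 τ q + j 4 * pd 2 τ q) - j 7 * (pd 1 ξ q + j 4 * pd 2 ξ q) := by
  have sτ : ContDiffOn ℝ ∞ τ B := hτ ▸ hX.comp_apply 0
  have sξ : ContDiffOn ℝ ∞ ξ B := hξ ▸ hX.comp_apply 1
  have sη : ContDiffOn ℝ ∞ η B := hη ▸ hX.comp_apply 2
  have hq1 : ![(jet1 j) 0, (jet1 j) 1, (jet1 j) 2] ∈ B := by simpa [jet1, ← hj] using hq
  have hq2 : ![(jet1 j) 0, (jet1 j) 1, (jet1 j) 2] = q := by simp [jet1, ← hj]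
  have main : totalX1 (coefX X) j =
      (pd 1 (pd 1 η) q + j 4 * pd 2 (pd 1 η) q + (j 7 * pd 2 η q
          + j 4 * (pd 1 (pd 2 η) q + j 4 * pd 2 (pd 2 η) q)))
      - (j 6 * (pd 1 τ q + j 4 * pd 2 τ q) + j 3 * (pd 1 (pd 1 τ) q + j 4 * pd 2 (pd 1 τ) q
          + (j 7 * pd 2 τ q + j 4 * (pd 1 (pd 2 τ) q + j 4 * pd 2 (pd 2 τ) q))))
      - (j 7 * (pd 1 ξ q + j 4 * pd 2 ξ q) + j 4 * (pd 1 (pd 1 ξ) q + j 4 * pd 2 (pd 1 ξ) q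
          + (j 7 * pd 2 ξ q + j 4 * (pd 1 (pd 2 ξ) q + j 4 * pd 2 (pd 2 ξ) q)))) := by
    set w : Fin 5 → ℝ := ![0, 1, j 4, j 6, j 7] with hw
    have hd : ∀ {g : (Fin 3 → ℝ) → ℝ}, ContDiffOn ℝ ∞ g B →
        HasDerivAt (fun s : ℝ => g ![(jet1 j + s • w) 0, (jet1 j + s • w) 1, (jet1 j + s • w) 2])
          (pd 1 g q + j 4 * pd 2 g q) 0 := by
      intro g hg
      have h := hasDerivAt_jet hg hB (jet1 j) w 0 1 2 hq1
      rw [hq2] at h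
      convert h using 1
      simp [hw]
    have h3 := hasDerivAt_jet_apply (jet1 j) w 3
    have h4 := hasDerivAt_jet_apply (jet1 j) w 4
    have h := (((hd (sη.pd hB 1)).add (h4.mul (hd (sη.pd hB 2)))).sub
      (h3.mul ((hd (sτ.pd hB 1)).add (h4.mul (hd (sτ.pd hB 2)))))).sub
      (h4.mul ((hd (sξ.pd hB 1)).add (h4.mul (hd (sξ.pd hB 2)))))
    have h' := h.congr_of_eventuallyEq (f₁ := fun s : ℝ => coefX X (jet1 j + s • w)) (by
      filter_upwards [eventually_jet_mem hB (jet1 j) w 0 1 2 hq1] with s hs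
      rw [coefX_eq hX hB hs]
      subst hτ hξ hη
      simp only [Pi.add_apply, Pi.sub_apply, Pi.mul_apply])
    rw [totalX1, ← hw, lineDeriv, h'.deriv]
    simp only [zero_smul, Pi.add_apply, Pi.mul_apply]
    simp [hw, jet1, ← hj]
  rw [coefXX, main, totalX0_eq (hX.comp_apply 0) hB hq1, totalX0_eq (hX.comp_apply 1) hB hq1, hq2,
    hτ, hξ]
  simp [jet1]

/-- Over `B`, the equation `F = 0` reads `z_t = A z_xx + E z_x ^ 2 + C z_x + D`. -/
def IsQuasilinear (F : (Fin 8 → ℝ) → ℝ) (B : Set (Fin 3 → ℝ)) (A E C D : (Fin 3 → ℝ) → ℝ) : Prop :=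
  ∀ j : Fin 8 → ℝ, ![j 0, j 1, j 2] ∈ B → F j = j 3 - (A ![j 0, j 1, j 2] * j 7
    + E ![j 0, j 1, j 2] * (j 4 * j 4) + C ![j 0, j 1, j 2] * j 4 + D ![j 0, j 1, j 2])

theorem lineDeriv_quasilinear {F : (Fin 8 → ℝ) → ℝ} {A E C D : (Fin 3 → ℝ) → ℝ}
    (hF : IsQuasilinear F B A E C D) (hB : IsOpen B) (hA : ContDiffOn ℝ ∞ A B)
    (hE : ContDiffOn ℝ ∞ E B) (hC : ContDiffOn ℝ ∞ C B) (hD : ContDiffOn ℝ ∞ D B)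
    {j w : Fin 8 → ℝ} {q : Fin 3 → ℝ} (hj : q = ![j 0, j 1, j 2]) (hq : q ∈ B) :
    lineDeriv ℝ F j w = w 3 - (((w 0 * pd 0 A q + w 1 * pd 1 A q + w 2 * pd 2 A q) * j 7 + A q * w 7)
      + ((w 0 * pd 0 E q + w 1 * pd 1 E q + w 2 * pd 2 E q) * (j 4 * j 4)
        + E q * (w 4 * j 4 + j 4 * w 4))
      + ((w 0 * pd 0 C q + w 1 * pd 1 C q + w 2 * pd 2 C q) * j 4 + C q * w 4)
      + (w 0 * pd 0 D q + w 1 * pd 1 D q + w 2 * pd 2 D q)) := by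
  subst hj
  have hd := fun {g : (Fin 3 → ℝ) → ℝ} (hg : ContDiffOn ℝ ∞ g B) =>
    hasDerivAt_jet hg hB j w 0 1 2 hq
  have hc := hasDerivAt_jet_apply j w
  have h := (hc 3).sub (((((hd hA).mul (hc 7)).add ((hd hE).mul ((hc 4).mul (hc 4)))).add
    ((hd hC).mul (hc 4))).add (hd hD))
  have h' := h.congr_of_eventuallyEq (f₁ := fun s : ℝ => F (j + s • w)) (by
    filter_upwards [eventually_jet_mem hB j w 0 1 2 hq] with s hs
    rw [hF _ hs]
    simp only [Pi.add_apply, Pi.sub_apply, Pi.mul_apply])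
  rw [lineDeriv, h'.deriv]
  simp only [zero_smul, add_zero, Pi.mul_apply]

/-- The determining equations at `q` for the point symmetries
of `z_t = A z_xx + E z_x ^ 2 + C z_x + D`. -/
def DetEqs (A E C D τ ξ η : (Fin 3 → ℝ) → ℝ) (q : Fin 3 → ℝ) : Prop :=
  (pd 1 τ q = 0 ∧ pd 2 τ q = 0 ∧ pd 2 ξ q = 0) ∧
  A q * (2 * pd 1 ξ q - pd 0 τ q) = τ q * pd 0 A q + ξ q * pd 1 A q + η q * pd 2 A q ∧
  A q * pd 2 (pd 2 η) q + E q * pd 2 η q + E q * (pd 0 τ q - 2 * pd 1 ξ q)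
    + (τ q * pd 0 E q + ξ q * pd 1 E q + η q * pd 2 E q) = 0 ∧
  C q * (pd 1 ξ q - pd 0 τ q) - pd 0 ξ q = A q * (2 * pd 1 (pd 2 η) q - pd 1 (pd 1 ξ) q)
    + 2 * E q * pd 1 η q + (τ q * pd 0 C q + ξ q * pd 1 C q + η q * pd 2 C q) ∧
  pd 0 η q + D q * (pd 2 η q - pd 0 τ q) = A q * pd 1 (pd 1 η) q + C q * pd 1 η q
    + (τ q * pd 0 D q + ξ q * pd 1 D q + η q * pd 2 D q)

/-- On the equation, z_t is a function of the remaining coordinates, so invariance is a polynomial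
identity in the free coordinates z_x, z_tx, z_xx (z_tt does not enter). It holds exactly when its
coefficients vanish. Since A ≠ 0, the coefficients of z_tx and of z_x z_xx yield τ_x = τ_z = ξ_z =
0. -/
theorem isPointSymmetry_iff_detEqs {F : (Fin 8 → ℝ) → ℝ} {A E C D : (Fin 3 → ℝ) → ℝ}
    (hF : IsQuasilinear F B A E C D) (hB : IsOpen B) (hA : ContDiffOn ℝ ∞ A B)
    (hE : ContDiffOn ℝ ∞ E B) (hC : ContDiffOn ℝ ∞ C B) (hD : ContDiffOn ℝ ∞ D B)
    (hA0 : ∀ q ∈ B, A q ≠ 0) :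
    IsPointSymmetry F B X ↔ ContDiffOn ℝ ∞ X B ∧
      ∀ q ∈ B, DetEqs A E C D (fun q => X q 0) (fun q => X q 1) (fun q => X q 2) q := by
  refine and_congr_right fun hX => ?_
  set τ : (Fin 3 → ℝ) → ℝ := fun q => X q 0 with hτ
  set ξ : (Fin 3 → ℝ) → ℝ := fun q => X q 1 with hξ
  set η : (Fin 3 → ℝ) → ℝ := fun q => X q 2 with hη
  have sτ : ContDiffOn ℝ ∞ τ B := hX.comp_apply 0
  have sξ : ContDiffOn ℝ ∞ ξ B := hX.comp_apply 1
  have sη : ContDiffOn ℝ ∞ η B := hX.comp_apply 2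
  have key : ∀ j : Fin 8 → ℝ, ∀ q, q = ![j 0, j 1, j 2] → q ∈ B →
      lineDeriv ℝ F j (prolong X j) = _ := fun j q hj hq =>
    lineDeriv_quasilinear hF hB hA hE hC hD hj hq
  have hX3 : ∀ j : Fin 8 → ℝ, prolong X j 3 = coefT X (jet1 j) := fun j => rfl
  have hX4 : ∀ j : Fin 8 → ℝ, prolong X j 4 = coefX X (jet1 j) := fun j => rfl
  have hX7 : ∀ j : Fin 8 → ℝ, prolong X j 7 = coefXX X j := fun j => rfl
  have hX0 : ∀ j : Fin 8 → ℝ, prolong X j 0 = τ ![j 0, j 1, j 2] := fun j => rfl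
  have hX1 : ∀ j : Fin 8 → ℝ, prolong X j 1 = ξ ![j 0, j 1, j 2] := fun j => rfl
  have hX2 : ∀ j : Fin 8 → ℝ, prolong X j 2 = η ![j 0, j 1, j 2] := fun j => rfl
  have hq3 : ∀ q : Fin 3 → ℝ, q = ![q 0, q 1, q 2] := by
    intro q; ext k; fin_cases k <;> rfl
  constructor
  · intro h
    -- The test jet over q has z_x = p, z_tx = r, z_xx = s, z_tt = 0, and z_t chosen so that the
    -- equation holds.
    have val : ∀ q ∈ B, ∀ p r s : ℝ, _ := fun q hq p r s => by
      have hqj : q = ![(![q 0, q 1, q 2, A q * s + E q * (p * p) + C q * p + D q, p, 0, r, s] :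
        Fin 8 → ℝ) 0, (![q 0, q 1, q 2, A q * s + E q * (p * p) + C q * p + D q, p, 0, r, s] :
        Fin 8 → ℝ) 1, (![q 0, q 1, q 2, A q * s + E q * (p * p) + C q * p + D q, p, 0, r, s] :
        Fin 8 → ℝ) 2] := hq3 q
      have h1 := h ![q 0, q 1, q 2, A q * s + E q * (p * p) + C q * p + D q, p, 0, r, s]
        (by rw [← hqj]; exact hq) (by
          rw [hF _ (by rw [← hqj]; exact hq), ← hqj]
          simp)
      rw [key _ q hqj hq, hX0, hX1, hX2, hX3, hX4, hX7, coefXX_eq hX hB hqj hq hτ hξ hη,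
        coefX_eq hX hB (by simpa [jet1, ← hq3] using hq),
        coefT_eq hX hB (by simpa [jet1, ← hq3] using hq), ← hqj] at h1
      simp only [jet1, Fin.isValue, Matrix.cons_val, ← hτ, ← hξ, ← hη, ← hq3 q] at h1
      exact h1
    -- The coefficient of z_tx is 2A (τ_x + z_x τ_z); it is read off at z_x = 0 here and at z_x = 1
    -- for τ_z.
    have e1 : ∀ q ∈ B, pd 1 τ q = 0 := fun q hq => by
      have := hA0 q hq
      have h0 := val q hq 0 0 0
      have h1 := val q hq 0 1 0
      have : A q * pd 1 τ q = 0 := by linear_combination (1 / 2) * h1 - (1 / 2) * h0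
      simpa [hA0 q hq] using this
    have e2 : ∀ q ∈ B, pd 2 τ q = 0 := fun q hq => by
      have := hA0 q hq
      have h0 := val q hq 1 0 0
      have h1 := val q hq 1 1 0
      have h2 := e1 q hq
      have : A q * pd 2 τ q = 0 := by linear_combination (1 / 2) * h1 - (1 / 2) * h0 - A q * h2
      simpa [hA0 q hq] using this
    have e11 : ∀ q ∈ B, pd 1 (pd 1 τ) q = 0 := fun q hq => pd_eq_zero_of_eq_const hB e1 1 hq
    have e21 : ∀ q ∈ B, pd 2 (pd 1 τ) q = 0 := fun q hq => pd_eq_zero_of_eq_const hB e1 2 hq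
    have e12 : ∀ q ∈ B, pd 1 (pd 2 τ) q = 0 := fun q hq => pd_eq_zero_of_eq_const hB e2 1 hq
    have e22 : ∀ q ∈ B, pd 2 (pd 2 τ) q = 0 := fun q hq => pd_eq_zero_of_eq_const hB e2 2 hq
    -- A mixed second difference in z_x and z_xx isolates the coefficient 2A ξ_z of z_x z_xx.
    have e3 : ∀ q ∈ B, pd 2 ξ q = 0 := fun q hq => by
      have h0 := val q hq 0 0 0
      have h1 := val q hq 0 0 1
      have h2 := val q hq 1 0 0
      have h3 := val q hq 1 0 1
      simp only [e1 q hq, e2 q hq, e11 q hq, e12 q hq, e21 q hq, e22 q hq] at h0 h1 h2 h3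
      have : A q * pd 2 ξ q = 0 := by linear_combination (1 / 2) * (h3 - h2 - h1 + h0)
      simpa [hA0 q hq] using this
    intro q hq
    have x12 := pd_eq_zero_of_eq_const hB e3 1 hq
    have x22 := pd_eq_zero_of_eq_const hB e3 2 hq
    have x21 := (pd_comm sξ hB hq 2 1).trans x12
    have n21 := pd_comm sη hB hq 2 1
    -- What remains is linear in z_xx, and its part without z_xx is quadratic in z_x because ξ_z = 0
    -- removes the cubic term. The values at z_x = 1 and −1 therefore separate the coefficients of
    -- z_x² and z_x.
    have h0 := val q hq 0 0 0
    have h1 := val q hq 0 0 1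
    have h2 := val q hq 1 0 0
    have h3 := val q hq (-1) 0 0
    simp only [e1 q hq, e2 q hq, e11 q hq, e12 q hq, e21 q hq, e22 q hq, e3 q hq, x12, x21, x22,
      n21] at h0 h1 h2 h3
    refine ⟨⟨e1 q hq, e2 q hq, e3 q hq⟩, ?_, ?_, ?_, ?_⟩
    · linear_combination h1 - h0
    · linear_combination (-1 / 2) * (h2 + h3 - 2 * h0)
    · linear_combination (1 / 2) * (h2 - h3)
    · linear_combination h0
  · intro h j hj hFj
    have hq : ∀ q, q = ![j 0, j 1, j 2] → lineDeriv ℝ F j (prolong X j) = 0 := fun q hqj => by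
      have hq : q ∈ B := hqj ▸ hj
      have hj3 : j 3 = A q * j 7 + E q * (j 4 * j 4) + C q * j 4 + D q := by
        rw [hF j hj, ← hqj] at hFj
        linarith
      have e1 : ∀ q ∈ B, pd 1 τ q = 0 := fun q hq => (h q hq).1.1
      have e2 : ∀ q ∈ B, pd 2 τ q = 0 := fun q hq => (h q hq).1.2.1
      have e3 : ∀ q ∈ B, pd 2 ξ q = 0 := fun q hq => (h q hq).1.2.2
      have e11 := pd_eq_zero_of_eq_const hB e1 1 hq
      have e21 := pd_eq_zero_of_eq_const hB e1 2 hq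
      have e12 := pd_eq_zero_of_eq_const hB e2 1 hq
      have e22 := pd_eq_zero_of_eq_const hB e2 2 hq
      have x12 := pd_eq_zero_of_eq_const hB e3 1 hq
      have x22 := pd_eq_zero_of_eq_const hB e3 2 hq
      have x21 := (pd_comm sξ hB hq 2 1).trans x12
      have n21 := pd_comm sη hB hq 2 1
      have hq' : ![(jet1 j) 0, (jet1 j) 1, (jet1 j) 2] = q := by simp [jet1, ← hqj]
      rw [key _ q hqj hq, hX0, hX1, hX2, hX3, hX4, hX7, coefXX_eq hX hB hqj hq hτ hξ hη,
        coefX_eq hX hB (by rw [hq']; exact hq), coefT_eq hX hB (by rw [hq']; exact hq), hq', ← hqj]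
      simp only [jet1, Fin.isValue, Matrix.cons_val,
        ← hτ, ← hξ, ← hη]
      obtain ⟨-, d1, d2, d3, d4⟩ := h q hq
      simp only [e1 q hq, e2 q hq, e11, e12, e21, e22, e3 q hq, x12, x21, x22, n21, hj3]
      linear_combination j 7 * d1 - j 4 * j 4 * d2 + j 4 * d3 + d4
    exact hq _ rfl

end Prolongation

/-! ### Determining equations of the class w_t = (f(w) w_v)_v. -/

/-- The diffusivity `f(w) = K(1/w) / w^2`, for which the equation of the first class reads
`w_t = (f(w) w_v)_v`. -/
noncomputable def diffW (K : ℝ → ℝ) (w : ℝ) : ℝ := K (1 / w) / w ^ 2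

/-- The determining equations at `q` for the point symmetries of `w_t = (f(w) w_v)_v`. -/
def DetW (f : ℝ → ℝ) (τ ξ η : (Fin 3 → ℝ) → ℝ) (q : Fin 3 → ℝ) : Prop :=
  (pd 1 τ q = 0 ∧ pd 2 τ q = 0 ∧ pd 2 ξ q = 0) ∧
  deriv f (q 2) * η q = f (q 2) * (2 * pd 1 ξ q - pd 0 τ q) ∧
  pd 2 (pd 2 η) q = 0 ∧
  -pd 0 ξ q = f (q 2) * (2 * pd 1 (pd 2 η) q - pd 1 (pd 1 ξ) q)
    + 2 * deriv f (q 2) * pd 1 η q ∧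
  pd 0 η q = f (q 2) * pd 1 (pd 1 η) q

section ClassW

variable {B : Set (Fin 3 → ℝ)} {X : VField} {W : Set ℝ} {f K : ℝ → ℝ}

theorem ContDiffOn.comp_coord (hf : ContDiffOn ℝ ∞ f W) (k : Fin 3) (hBW : ∀ q ∈ B, q k ∈ W) :
    ContDiffOn ℝ ∞ (fun q : Fin 3 → ℝ => f (q k)) B :=
  hf.comp (t := W) (g := f) (f := fun q : Fin 3 → ℝ => q k)
    (contDiff_apply ℝ ℝ k).contDiffOn hBW

theorem ContDiffOn.hasDerivAt_of_open (hf : ContDiffOn ℝ ∞ f W) (hW : IsOpen W) {w : ℝ}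
    (hw : w ∈ W) : HasDerivAt f (deriv f w) w :=
  ((hf.contDiffAt (hW.mem_nhds hw)).differentiableAt (by simp)).hasDerivAt

theorem ContDiffOn.deriv_infty (hf : ContDiffOn ℝ ∞ f W) (hW : IsOpen W) :
    ContDiffOn ℝ ∞ (deriv f) W := hf.deriv_of_isOpen hW (by simp)

theorem isQuasilinear_pdeW (hW : IsOpen W) (hf : ContDiffOn ℝ ∞ (diffW K) W)
    (hBW : ∀ q ∈ B, q 2 ∈ W) :
    IsQuasilinear (pdeW K) B (fun q => diffW K (q 2)) (fun q => deriv (diffW K) (q 2))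
      (fun _ => 0) (fun _ => 0) := by
  intro j hj
  have hw : j 2 ∈ W := hBW _ hj
  have h1 : HasDerivAt (fun s : ℝ => diffW K (j 2 + s * j 4)) (deriv (diffW K) (j 2) * j 4) 0 :=
    HasDerivAt.comp (h₂ := diffW K) 0 (by simpa using hf.hasDerivAt_of_open hW hw)
      (hasDerivAt_affine _ _)
  have h2 := h1.mul (hasDerivAt_affine (j 4) (j 7))
  have h3 : totalX1 (fun i => K (1 / i 2) * i 4 / (i 2) ^ 2) j =
      deriv (diffW K) (j 2) * j 4 * j 4 + diffW K (j 2) * j 7 := by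
    refine (HasDerivAt.congr_of_eventuallyEq h2 (.of_forall fun s => ?_)).deriv.trans (by simp)
    simp only [diffW, jet1, Pi.mul_apply]
    simp
    ring
  rw [pdeW, h3]
  simp only [Matrix.cons_val]
  ring

/-- Here A = f and E = f'. Differentiating f' η = f (2ξ_v − τ_t) in w gives f'' η + f' η_w = f'
(2ξ_v − τ_t), which cancels all of the z_x² equation except f η_ww. This is why η must be affine in
w. -/
theorem isPointSymmetry_pdeW_iff (hW : IsOpen W) (hf : ContDiffOn ℝ ∞ (diffW K) W)
    (hf0 : ∀ w ∈ W, diffW K w ≠ 0) (hB : IsOpen B) (hBW : ∀ q ∈ B, q 2 ∈ W) :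
    IsPointSymmetry (pdeW K) B X ↔ ContDiffOn ℝ ∞ X B ∧
      ∀ q ∈ B, DetW (diffW K) (fun q => X q 0) (fun q => X q 1) (fun q => X q 2) q := by
  rw [isPointSymmetry_iff_detEqs (isQuasilinear_pdeW hW hf hBW) hB (hf.comp_coord 2 hBW)
    ((hf.deriv_infty hW).comp_coord 2 hBW) contDiffOn_const contDiffOn_const
    (fun q hq => hf0 _ (hBW q hq))]
  refine and_congr_right fun hX => ?_
  have sτ := hX.comp_apply 0
  have sξ := hX.comp_apply 1
  have sη := hX.comp_apply 2
  set τ : (Fin 3 → ℝ) → ℝ := fun q => X q 0 with hτ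
  set ξ : (Fin 3 → ℝ) → ℝ := fun q => X q 1 with hξ
  set η : (Fin 3 → ℝ) → ℝ := fun q => X q 2 with hη
  set k := diffW K with hk
  have hA : ∀ q ∈ B, ∀ i, HasPD i (fun q => k (q 2)) (if i = 2 then deriv k (q 2) else 0) q :=
    fun q hq i => HasPD.comp_coord i 2 (hf.hasDerivAt_of_open hW (hBW q hq))
  have hE : ∀ q ∈ B, ∀ i, HasPD i (fun q => deriv k (q 2))
      (if i = 2 then deriv (deriv k) (q 2) else 0) q :=
    fun q hq i => HasPD.comp_coord i 2 ((hf.deriv_infty hW).hasDerivAt_of_open hW (hBW q hq))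
  have diff1 : (∀ q ∈ B, pd 2 τ q = 0) → (∀ q ∈ B, pd 2 ξ q = 0) →
      (∀ q ∈ B, deriv k (q 2) * η q = k (q 2) * (2 * pd 1 ξ q - pd 0 τ q)) → ∀ q ∈ B,
      deriv (deriv k) (q 2) * η q + deriv k (q 2) * pd 2 η q
        = deriv k (q 2) * (2 * pd 1 ξ q - pd 0 τ q) := by
    intro h2 h3 h q hq
    have e1 : pd 2 (pd 1 ξ) q = 0 :=
      (pd_comm sξ hB hq 2 1).trans (pd_eq_zero_of_eq_const hB h3 1 hq)
    have e2 : pd 2 (pd 0 τ) q = 0 :=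
      (pd_comm sτ hB hq 2 0).trans (pd_eq_zero_of_eq_const hB h2 0 hq)
    have l := (hE q hq 2).mul (sη.hasPD hB hq 2)
    have r := (hA q hq 2).mul ((((sξ.pd hB 1).hasPD hB hq 2).const_mul 2).sub
      ((sτ.pd hB 0).hasPD hB hq 2))
    have := (l.congr_on hB hq fun q hq => (h q hq).symm).unique r
    simp only [if_true, e1, e2] at this
    linear_combination this
  constructor
  · intro h q hq
    obtain ⟨h1, h2, h3, h4, h5⟩ := h q hq
    have d := diff1 (fun q hq => (h q hq).1.2.1) (fun q hq => (h q hq).1.2.2) (fun q hq => by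
      have := (h q hq).2.1
      simp only [(hA q hq _).pd_eq] at this
      simp at this
      linear_combination -this) q hq
    simp only [(hA q hq _).pd_eq, (hE q hq _).pd_eq, (HasPD.const (q := q) 0).pd_eq] at h2 h3 h4 h5
    simp at h2 h3 h4 h5
    refine ⟨h1, by linear_combination -h2, ?_, by linear_combination h4, by linear_combination h5⟩
    have : k (q 2) * pd 2 (pd 2 η) q = 0 := by linear_combination h3 - d
    exact (mul_eq_zero.1 this).resolve_left (hf0 _ (hBW q hq))
  · intro h q hq
    obtain ⟨h1, h2, h3, h4, h5⟩ := h q hq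
    have d := diff1 (fun q hq => (h q hq).1.2.1) (fun q hq => (h q hq).1.2.2)
      (fun q hq => (h q hq).2.1) q hq
    refine ⟨h1, ?_, ?_, ?_, ?_⟩ <;>
    simp only [(hA q hq _).pd_eq, (hE q hq _).pd_eq, (HasPD.const (q := q) 0).pd_eq] <;> simp
    · linear_combination -h2
    · linear_combination d + k (q 2) * h3
    · linear_combination h4
    · linear_combination h5

end ClassW

/-! ### Integration of polynomial gradients, vanishing of polynomials, and dimension counts. -/

section Tools

variable {B : Set (Fin 3 → ℝ)} {X : VField} {f : (Fin 3 → ℝ) → ℝ}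

/-- A function whose partial derivatives are affine is a quadratic polynomial. -/
theorem exists_quadratic_of_pd (hB : IsOpen B) (hc : IsPreconnected B) (hf : ContDiffOn ℝ ∞ f B)
    (b : Fin 3 → ℝ) (M : Fin 3 → Fin 3 → ℝ) (hM : ∀ i j, M i j = M j i)
    (h : ∀ i, ∀ q ∈ B, pd i f q = b i + ∑ j, M i j * q j) :
    ∃ c, ∀ q ∈ B, f q = (b 0 * q 0 + b 1 * q 1 + b 2 * q 2 + (M 0 0 * (q 0 * q 0)
      + M 1 1 * (q 1 * q 1) + M 2 2 * (q 2 * q 2)) / 2 + M 0 1 * (q 0 * q 1)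
      + M 0 2 * (q 0 * q 2) + M 1 2 * (q 1 * q 2)) + c := by
  refine exists_eq_add_const hB hc hf (g := fun q => b 0 * q 0 + b 1 * q 1 + b 2 * q 2
    + (M 0 0 * (q 0 * q 0) + M 1 1 * (q 1 * q 1) + M 2 2 * (q 2 * q 2)) / 2 + M 0 1 * (q 0 * q 1)
      + M 0 2 * (q 0 * q 2) + M 1 2 * (q 1 * q 2)) (by fun_prop) ?_
  intro i q hq
  rw [h i q hq]
  have l := fun k => HasPD.coord i k q
  have hp := ((((((l 0).const_mul (b 0)).add ((l 1).const_mul (b 1))).add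
    ((l 2).const_mul (b 2))).add ((((((l 0).mul (l 0)).const_mul (M 0 0)).add
    (((l 1).mul (l 1)).const_mul (M 1 1))).add (((l 2).mul (l 2)).const_mul (M 2 2))).const_mul
      (1 / 2))).add (((l 0).mul (l 1)).const_mul (M 0 1))).add
    (((l 0).mul (l 2)).const_mul (M 0 2)) |>.add (((l 1).mul (l 2)).const_mul (M 1 2))
  have hp' := hp.congr_on (g := fun q => b 0 * q 0 + b 1 * q 1 + b 2 * q 2
    + (M 0 0 * (q 0 * q 0) + M 1 1 * (q 1 * q 1) + M 2 2 * (q 2 * q 2)) / 2 + M 0 1 * (q 0 * q 1)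
      + M 0 2 * (q 0 * q 2) + M 1 2 * (q 1 * q 2)) hB hq (fun q _ => by ring)
  rw [hp'.pd_eq, Fin.sum_univ_three]
  fin_cases i <;> simp
  · ring
  · rw [hM 1 0]; ring
  · rw [hM 2 0, hM 2 1]; ring

theorem exists_affine_of_pd (hB : IsOpen B) (hc : IsPreconnected B) (hf : ContDiffOn ℝ ∞ f B)
    (b0 b1 b2 : ℝ) (h0 : ∀ q ∈ B, pd 0 f q = b0) (h1 : ∀ q ∈ B, pd 1 f q = b1)
    (h2 : ∀ q ∈ B, pd 2 f q = b2) :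
    ∃ c, ∀ q ∈ B, f q = b0 * q 0 + b1 * q 1 + b2 * q 2 + c := by
  obtain ⟨c, hc⟩ := exists_quadratic_of_pd hB hc hf ![b0, b1, b2] 0 (fun _ _ => rfl) (by
    intro i q hq
    fin_cases i
    · simpa using h0 q hq
    · simpa using h1 q hq
    · simpa using h2 q hq)
  exact ⟨c, fun q hq => by simpa using hc q hq⟩

/-- A cubic polynomial that vanishes on a nonempty open set has zero coefficients. -/
theorem cubic_coeff_eq_zero {V : Set ℝ} (hV : IsOpen V) (hne : V.Nonempty) {c0 c1 c2 c3 : ℝ}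
    (h : ∀ u ∈ V, c0 + c1 * u + c2 * u ^ 2 + c3 * u ^ 3 = 0) :
    c0 = 0 ∧ c1 = 0 ∧ c2 = 0 ∧ c3 = 0 := by
  obtain ⟨x, hx⟩ := hne
  obtain ⟨ε, hε, hb⟩ := Metric.isOpen_iff.1 hV x hx
  -- The polynomial is sampled at four equally spaced points; third, second and first differences
  -- then isolate c₃, c₂ and c₁ in turn.
  have hm : ∀ k : ℝ, 0 ≤ k → k ≤ 3 → x + k * (ε / 4) ∈ V := fun k hk hk' => hb (by
    rw [Metric.mem_ball, Real.dist_eq, add_sub_cancel_left, abs_of_nonneg (by positivity)]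
    nlinarith)
  have e0 := h _ hx
  have e1 := h _ (hm 1 (by norm_num) (by norm_num))
  have e2 := h _ (hm 2 (by norm_num) (by norm_num))
  have e3 := h _ (hm 3 (by norm_num) (by norm_num))
  have hd : ε / 4 ≠ 0 := by positivity
  generalize ε / 4 = d at *
  have h3 : c3 = 0 := by
    have : d ^ 3 * c3 = 0 := by linear_combination (e3 - 3 * e2 + 3 * e1 - e0) / 6
    simpa [hd] using this
  subst h3
  have h2 : c2 = 0 := by
    have : d ^ 2 * c2 = 0 := by linear_combination (e2 - 2 * e1 + e0) / 2
    simpa [hd] using this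
  subst h2
  have h1 : c1 = 0 := by
    have : d * c1 = 0 := by linear_combination e1 - e0
    simpa [hd] using this
  subst h1
  exact ⟨by linear_combination e0, rfl, rfl, rfl⟩

theorem affine_coeff_eq_zero {V : Set ℝ} (hV : IsOpen V) (hne : V.Nonempty) {c0 c1 : ℝ}
    (h : ∀ u ∈ V, c0 + c1 * u = 0) : c0 = 0 ∧ c1 = 0 := by
  obtain ⟨h0, h1, -⟩ := cubic_coeff_eq_zero hV hne (c0 := c0) (c1 := c1) (c2 := 0) (c3 := 0)
    (fun u hu => by simpa using h u hu)
  exact ⟨h0, h1⟩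

/-- A quadratic polynomial along a coordinate line that vanishes near `0`. -/
theorem line_coeff_eq_zero (hB : IsOpen B) {q : Fin 3 → ℝ} (hq : q ∈ B) (i : Fin 3) {c0 c1 c2 : ℝ}
    (h : ∀ s : ℝ, q + s • Pi.single i 1 ∈ B → c0 + c1 * s + c2 * s ^ 2 = 0) :
    c0 = 0 ∧ c1 = 0 ∧ c2 = 0 := by
  have hc : Continuous (fun s : ℝ => q + s • (Pi.single i 1 : Fin 3 → ℝ)) := by fun_prop
  obtain ⟨h0, h1, h2, -⟩ := cubic_coeff_eq_zero (hB.preimage hc) ⟨0, by simpa using hq⟩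
    (c0 := c0) (c1 := c1) (c2 := c2) (c3 := 0) (fun s hs => by simpa using h s hs)
  exact ⟨h0, h1, h2⟩

/-- The first hypothesis identifies `symSpace F B` with the span of the restricted fields, so the
dimension is n as soon as these are linearly independent on `B`. -/
theorem symmetryAlgebraIs_of_iff {F : (Fin 8 → ℝ) → ℝ} {n : ℕ} {V : Fin n → VField}
    (h : ∀ X : VField, IsPointSymmetry F B X ↔ ∃ c : Fin n → ℝ, ∀ q ∈ B, X q = ∑ i, c i • V i q)
    (hV : ∀ c : Fin n → ℝ, (∀ q ∈ B, ∑ i, c i • V i q = 0) → ∀ i, c i = 0) :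
    SymmetryAlgebraIs F B V := by
  refine ⟨h, ?_⟩
  have hspan : symSpace F B = Submodule.span ℝ (Set.range fun i => B.domRestrict (V i)) := by
    refine le_antisymm (Submodule.span_le.2 ?_) (Submodule.span_le.2 ?_)
    · rintro _ ⟨X, hX, rfl⟩
      obtain ⟨c, hc⟩ := (h X).1 hX
      have : B.domRestrict X = ∑ i, c i • B.domRestrict (V i) := by
        ext q k
        simp only [Set.domRestrict_apply, hc q q.2, Finset.sum_apply, Pi.smul_apply]
      rw [this]
      exact Submodule.sum_mem _ fun i _ =>
        Submodule.smul_mem _ _ (Submodule.subset_span ⟨i, rfl⟩)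
    · rintro _ ⟨i, rfl⟩
      refine Submodule.subset_span ⟨V i, (h _).2 ⟨Pi.single i 1, fun q _ => ?_⟩, rfl⟩
      rw [Finset.sum_eq_single i]
      · simp
      · intro j _ hj
        simp [hj]
      · simp
  rw [hspan, finrank_span_eq_card, Fintype.card_fin]
  rw [Fintype.linearIndependent_iff]
  intro c hc
  refine hV c fun q hq => ?_
  have := congrFun hc ⟨q, hq⟩
  simp only [Finset.sum_apply, Pi.smul_apply] at this
  exact this

end Tools

/-! ### The values of w = 1/u, and the diffusivities f of the special rows. -/

section WRange

variable {U : Set ℝ} {S : Set (ℝ × ℝ)}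

theorem wRange_eq_image (h0 : 0 ∉ U) : wRange U = (fun u : ℝ => u⁻¹) '' U := by
  ext w
  constructor
  · rintro ⟨_, h⟩
    exact ⟨1 / w, h, by simp⟩
  · rintro ⟨u, hu, rfl⟩
    have : u ≠ 0 := fun h => h0 (h ▸ hu)
    exact ⟨inv_ne_zero this, by simpa using hu⟩

theorem isOpen_wRange (hU : IsOpen U) : IsOpen (wRange U) := by
  have hc : ContinuousOn (fun w : ℝ => 1 / w) {0}ᶜ :=
    continuousOn_const.div continuousOn_id fun w hw => hw
  exact hc.isOpen_inter_preimage isOpen_compl_singleton hU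

theorem nonempty_wRange (h0 : 0 ∉ U) (hU : U.Nonempty) : (wRange U).Nonempty := by
  rw [wRange_eq_image h0]; exact hU.image _

theorem isPreconnected_wRange (h0 : 0 ∉ U) (hU : U.OrdConnected) : IsPreconnected (wRange U) := by
  rw [wRange_eq_image h0]
  refine hU.isPreconnected.image _ (continuousOn_id.inv₀ fun u hu => ?_)
  exact fun h : u = 0 => h0 (h ▸ hu)

theorem isOpen_domW (hS : IsOpen S) (hU : IsOpen U) : IsOpen (domW S U) := by
  have h1 : Continuous fun q : Fin 3 → ℝ => (q 0, q 1) := by fun_prop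
  have h2 : Continuous fun q : Fin 3 → ℝ => q 2 := by fun_prop
  exact (hS.preimage h1).inter ((isOpen_wRange hU).preimage h2)

theorem domW_eq_image : domW S U =
    (fun p : (ℝ × ℝ) × ℝ => ![p.1.1, p.1.2, p.2]) '' (S ×ˢ wRange U) := by
  ext q
  constructor
  · rintro ⟨h1, h2⟩
    refine ⟨((q 0, q 1), q 2), ⟨h1, h2⟩, ?_⟩
    ext k; fin_cases k <;> rfl
  · rintro ⟨p, ⟨h1, h2⟩, rfl⟩
    exact ⟨h1, h2⟩

theorem isPreconnected_domW (hS : IsPreconnected S) (hU : IsPreconnected (wRange U)) :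
    IsPreconnected (domW S U) := by
  rw [domW_eq_image]
  refine (hS.prod hU).image _ (Continuous.continuousOn ?_)
  refine continuous_pi fun k => ?_
  fin_cases k <;> simp <;> fun_prop

theorem nonempty_domW (hS : S.Nonempty) (hU : (wRange U).Nonempty) : (domW S U).Nonempty := by
  rw [domW_eq_image]
  exact (hS.prod hU).image _

theorem contDiffOn_diffW {K : ℝ → ℝ} (hK : ContDiffOn ℝ ∞ K U) :
    ContDiffOn ℝ ∞ (diffW K) (wRange U) := by
  have h1 : ContDiffOn ℝ ∞ (fun w : ℝ => 1 / w) (wRange U) :=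
    contDiffOn_const.div contDiffOn_id fun w hw => hw.1
  exact (hK.comp h1 fun w hw => hw.2).div (contDiffOn_id.pow 2) fun w hw => pow_ne_zero 2 hw.1

theorem diffW_ne_zero {K : ℝ → ℝ} (hK : ∀ u ∈ U, K u ≠ 0) : ∀ w ∈ wRange U, diffW K w ≠ 0 :=
  fun _ hw => div_ne_zero (hK _ hw.2) (pow_ne_zero 2 hw.1)

theorem IsPower.diffW_eq {μ : ℝ} {K : ℝ → ℝ} (h : IsPower μ U K) {w : ℝ} (hw : w ∈ wRange U) :
    0 < w ∧ diffW K w = w ^ (-(μ + 2)) := by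
  have h0 : 0 < w := one_div_pos.1 (h.1 hw.2)
  refine ⟨h0, ?_⟩
  rw [diffW, h.2 _ hw.2, Real.rpow_neg h0.le, Real.rpow_add h0, one_div, Real.inv_rpow h0.le]
  norm_num
  ring

theorem IsExpInv.diffW_eq {K : ℝ → ℝ} (h : IsExpInv U K) {w : ℝ} (hw : w ∈ wRange U) :
    diffW K w = Real.exp w := by
  have h0 := hw.1
  rw [diffW, h _ hw.2]
  field_simp

end WRange

theorem fderiv_apply_eq {E F : Type*} [NormedAddCommGroup E] [NormedSpace ℝ E]
    [NormedAddCommGroup F] [NormedSpace ℝ F] {φ : E → F} {q v : E} {d : F}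
    (hφ : DifferentiableAt ℝ φ q) (h : HasDerivAt (fun s : ℝ => φ (q + s • v)) d 0) :
    fderiv ℝ φ q v = d := by
  rw [← hφ.lineDeriv_eq_fderiv]; exact h.deriv

/-! ### Equivalence transformations of the first class. -/

section EquivalenceW

variable {B : Set (Fin 3 → ℝ)} {X X' : VField} {W : Set ℝ} {K K' : ℝ → ℝ}
  {a₁ a₂ a₃ a₄ a₅ a₆ : ℝ}

theorem fderiv_equivMapW (q v : Fin 3 → ℝ) :
    fderiv ℝ (equivMapW a₁ a₂ a₃ a₄ a₅ a₆) q v = ![a₅ * v 0, a₃ * v 1, a₄ * v 2] := by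
  refine fderiv_apply_eq ?_ ?_
  · rw [differentiableAt_pi]
    intro k
    fin_cases k <;> simp [equivMapW] <;> fun_prop
  · exact hasDerivAt_vec3 ((((hasDerivAt_jet_apply q v 0)).const_mul a₅).add_const a₆)
      ((((hasDerivAt_jet_apply q v 1)).const_mul a₃).add_const a₁)
      ((((hasDerivAt_jet_apply q v 2)).const_mul a₄).add_const a₂)

theorem equivMapW_leftInverse (h3 : a₃ ≠ 0) (h4 : a₄ ≠ 0) (h5 : a₅ ≠ 0) (q : Fin 3 → ℝ) :
    equivMapW (-a₁ / a₃) (-a₂ / a₄) a₃⁻¹ a₄⁻¹ a₅⁻¹ (-a₆ / a₅) (equivMapW a₁ a₂ a₃ a₄ a₅ a₆ q) = q := by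
  ext k
  fin_cases k <;> simp [equivMapW] <;> field_simp <;> ring

theorem equivMapW_rightInverse (h3 : a₃ ≠ 0) (h4 : a₄ ≠ 0) (h5 : a₅ ≠ 0) (q : Fin 3 → ℝ) :
    equivMapW a₁ a₂ a₃ a₄ a₅ a₆ (equivMapW (-a₁ / a₃) (-a₂ / a₄) a₃⁻¹ a₄⁻¹ a₅⁻¹ (-a₆ / a₅) q) = q := by
  ext k
  fin_cases k <;> simp [equivMapW] <;> field_simp <;> ring

theorem continuous_equivMapW : Continuous (equivMapW a₁ a₂ a₃ a₄ a₅ a₆) := by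
  refine continuous_pi fun k => ?_
  fin_cases k <;> simp [equivMapW] <;> fun_prop

theorem contDiff_equivMapW : ContDiff ℝ ∞ (equivMapW a₁ a₂ a₃ a₄ a₅ a₆) := by
  refine contDiff_pi.2 fun k => ?_
  fin_cases k <;> simp [equivMapW] <;> fun_prop

theorem isOpen_equivMapW_image (h3 : a₃ ≠ 0) (h4 : a₄ ≠ 0) (h5 : a₅ ≠ 0) (hB : IsOpen B) :
    IsOpen (equivMapW a₁ a₂ a₃ a₄ a₅ a₆ '' B) := by
  rw [Set.image_eq_preimage_of_inverse (equivMapW_leftInverse h3 h4 h5)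
    (equivMapW_rightInverse h3 h4 h5)]
  exact hB.preimage continuous_equivMapW

/-- Partial derivatives under a diagonal affine change of coordinates. -/
theorem hasPD_equivMapW {g g' : (Fin 3 → ℝ) → ℝ} {c d : ℝ} {q : Fin 3 → ℝ} {i : Fin 3}
    (h : (![a₅, a₃, a₄] : Fin 3 → ℝ) i ≠ 0) (hB : IsOpen B) (hq : q ∈ B)
    (hg : ∀ q ∈ B, g' (equivMapW a₁ a₂ a₃ a₄ a₅ a₆ q) = c * g q) (hd : HasPD i g d q) :
    HasPD i g' (c / (![a₅, a₃, a₄] : Fin 3 → ℝ) i * d) (equivMapW a₁ a₂ a₃ a₄ a₅ a₆ q) := by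
  set a : ℝ := (![a₅, a₃, a₄] : Fin 3 → ℝ) i with ha
  have h1 : HasDerivAt (fun s : ℝ => s / a) (1 / a) 0 := (hasDerivAt_id (0 : ℝ)).div_const a
  have h2 : HasDerivAt (fun s : ℝ => g (q + (s / a) • Pi.single i 1)) (d * (1 / a)) 0 := by
    have hd' : HasDerivAt (fun s : ℝ => g (q + s • Pi.single i 1)) d ((0 : ℝ) / a) := by
      rw [zero_div]; exact hd
    exact hd'.comp (0 : ℝ) h1
  have h3 : c / a * d = c * (d * (1 / a)) := by ring
  rw [h3]
  refine HasDerivAt.congr_of_eventuallyEq (h2.const_mul c) ?_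
  have hc : Continuous (fun s : ℝ => q + (s / a) • (Pi.single i 1 : Fin 3 → ℝ)) := by fun_prop
  filter_upwards [hc.continuousAt.eventually_mem (x := 0) (by simpa using hB.mem_nhds hq)]
    with s hs
  rw [← hg _ hs]
  congr 1
  ext k
  fin_cases i <;> simp [a] at h <;> fin_cases k <;> simp [equivMapW, a] <;> field_simp <;> ring

/-- K enters the determining equations only through f, which is rescaled by the constant a₃²/a₅.
Each partial derivative picks up a constant factor under the diagonal affine map, and these factors
combine so that every determining equation is merely multiplied by a constant. -/
theorem IsPointSymmetry.map_equivMapW (h3 : a₃ ≠ 0) (h4 : a₄ ≠ 0) (h5 : a₅ ≠ 0) (hW : IsOpen W)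
    (hf : ContDiffOn ℝ ∞ (diffW K) W) (hf0 : ∀ w ∈ W, diffW K w ≠ 0) (hB : IsOpen B)
    (hBW : ∀ q ∈ B, q 2 ∈ W)
    (hK : ∀ w ∈ W, diffW K' (a₄ * w + a₂) = a₃ ^ 2 / a₅ * diffW K w)
    (hX : ∀ q ∈ B, X' (equivMapW a₁ a₂ a₃ a₄ a₅ a₆ q) = ![a₅ * X q 0, a₃ * X q 1, a₄ * X q 2])
    (h : IsPointSymmetry (pdeW K) B X) :
    IsPointSymmetry (pdeW K') (equivMapW a₁ a₂ a₃ a₄ a₅ a₆ '' B) X' := by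
  obtain ⟨sX, hdet⟩ := (isPointSymmetry_pdeW_iff hW hf hf0 hB hBW).1 h
  set φ := equivMapW a₁ a₂ a₃ a₄ a₅ a₆ with hφ
  set ψ := equivMapW (-a₁ / a₃) (-a₂ / a₄) a₃⁻¹ a₄⁻¹ a₅⁻¹ (-a₆ / a₅) with hψ
  have hinv : ∀ q, ψ (φ q) = q := equivMapW_leftInverse h3 h4 h5
  have hB' : IsOpen (φ '' B) := isOpen_equivMapW_image h3 h4 h5 hB
  have hW' : (fun w => a₄ * w + a₂) '' W = (fun w => (w - a₂) / a₄) ⁻¹' W := by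
    rw [Set.image_eq_preimage_of_inverse]
    · intro w; simp [h4]
    · intro w; simp; field_simp; ring
  have oW' : IsOpen ((fun w => a₄ * w + a₂) '' W) := by
    rw [hW']; exact hW.preimage (by fun_prop)
  have hf' : ContDiffOn ℝ ∞ (diffW K') ((fun w => a₄ * w + a₂) '' W) := by
    have h1 : ContDiffOn ℝ ∞ (fun w => a₃ ^ 2 / a₅ * diffW K ((w - a₂) / a₄))
        ((fun w => a₄ * w + a₂) '' W) := by
      refine contDiffOn_const.mul (hf.comp (t := W) (f := fun w => (w - a₂) / a₄) ?_ ?_)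
      · exact ((contDiff_id.sub contDiff_const).div_const _).contDiffOn
      · rw [hW']; exact fun w hw => hw
    refine h1.congr ?_
    rintro _ ⟨w, hw, rfl⟩
    simp only [hK w hw]
    congr 2
    field_simp
    ring
  have hf0' : ∀ w ∈ (fun w => a₄ * w + a₂) '' W, diffW K' w ≠ 0 := by
    rintro _ ⟨w, hw, rfl⟩
    simp only [hK w hw]
    exact mul_ne_zero (div_ne_zero (pow_ne_zero 2 h3) h5) (hf0 w hw)
  refine (isPointSymmetry_pdeW_iff oW' hf' hf0' hB' ?_).2 ⟨?_, ?_⟩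
  · rintro _ ⟨q, hq, rfl⟩
    exact ⟨q 2, hBW q hq, rfl⟩
  · have hs : ContDiffOn ℝ ∞ (fun y => X (ψ y)) (φ '' B) := by
      refine sX.comp contDiff_equivMapW.contDiffOn ?_
      rintro _ ⟨q, hq, rfl⟩
      rw [hinv]; exact hq
    have h1 : ContDiffOn ℝ ∞ (fun y => ![a₅ * X (ψ y) 0, a₃ * X (ψ y) 1, a₄ * X (ψ y) 2])
        (φ '' B) := by
      rw [contDiffOn_pi]
      intro k
      fin_cases k
      · exact contDiffOn_const.mul (hs.comp_apply 0)
      · exact contDiffOn_const.mul (hs.comp_apply 1)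
      · exact contDiffOn_const.mul (hs.comp_apply 2)
    refine h1.congr ?_
    rintro _ ⟨q, hq, rfl⟩
    rw [hX q hq, hinv]
  · rintro _ ⟨q, hq, rfl⟩
    obtain ⟨⟨d1, d2, d3⟩, d4, d5, d6, d7⟩ := hdet q hq
    have sτ := sX.comp_apply 0
    have sξ := sX.comp_apply 1
    have sη := sX.comp_apply 2
    have hne : ∀ i, (![a₅, a₃, a₄] : Fin 3 → ℝ) i ≠ 0 := by
      intro i; fin_cases i <;> assumption
    have hτ : ∀ q ∈ B, (fun q => X' q 0) (φ q) = a₅ * (fun q => X q 0) q := fun q hq => by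
      simp [hX q hq]
    have hξ : ∀ q ∈ B, (fun q => X' q 1) (φ q) = a₃ * (fun q => X q 1) q := fun q hq => by
      simp [hX q hq]
    have hη : ∀ q ∈ B, (fun q => X' q 2) (φ q) = a₄ * (fun q => X q 2) q := fun q hq => by
      simp [hX q hq]
    -- The hypothesis and the conclusion have the same shape, so this transfer rule can be applied
    -- again to the first derivatives to obtain the second ones.
    have tr : ∀ {g g' : (Fin 3 → ℝ) → ℝ} {c : ℝ}, ContDiffOn ℝ ∞ g B →
        (∀ q ∈ B, g' (φ q) = c * g q) → ∀ i, ∀ q ∈ B,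
        pd i g' (φ q) = c / (![a₅, a₃, a₄] : Fin 3 → ℝ) i * pd i g q := fun hg hgg i q hq =>
      (hasPD_equivMapW (hne i) hB hq hgg (hg.hasPD hB hq i)).pd_eq
    have hk : deriv (diffW K') (φ q 2) = a₃ ^ 2 / a₅ / a₄ * deriv (diffW K) (q 2) := by
      have e1 := (hf'.hasDerivAt_of_open oW' ⟨q 2, hBW q hq, rfl⟩)
      have e2 := HasDerivAt.comp (q 2) e1 (((hasDerivAt_id (q 2)).const_mul a₄).add_const a₂)
      have e3 := (hf.hasDerivAt_of_open hW (hBW q hq)).const_mul (a₃ ^ 2 / a₅)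
      have e4 := e2.unique (e3.congr_of_eventuallyEq (by
        filter_upwards [hW.mem_nhds (hBW q hq)] with w hw using hK w hw))
      have : φ q 2 = a₄ * q 2 + a₂ := rfl
      rw [this, div_mul_eq_mul_div, eq_div_iff h4, ← e4]
      simp
    have hkf : diffW K' (φ q 2) = a₃ ^ 2 / a₅ * diffW K (q 2) := hK _ (hBW q hq)
    have r1 := tr (g := fun q => X q 0) (g' := fun q => X' q 0) sτ hτ
    have r2 := tr (g := fun q => X q 1) (g' := fun q => X' q 1) sξ hξ
    have r3 := tr (g := fun q => X q 2) (g' := fun q => X' q 2) sη hη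
    have r4 := tr (sξ.pd hB 1) (r2 1) 1 q hq
    have r5 := tr (sη.pd hB 2) (r3 2)
    have r6 := tr (sη.pd hB 1) (r3 1) 1 q hq
    simp only [Matrix.cons_val] at r1 r2 r3 r4 r5 r6
    refine ⟨⟨?_, ?_, ?_⟩, ?_, ?_, ?_, ?_⟩
    · rw [r1 1 q hq, d1, mul_zero]
    · rw [r1 2 q hq, d2, mul_zero]
    · rw [r2 2 q hq, d3, mul_zero]
    · rw [hη q hq, hk, hkf, r2 1 q hq, r1 0 q hq]
      simp only [Matrix.cons_val]
      field_simp
      linear_combination d4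
    · rw [r5 2 q hq, d5, mul_zero]
    · rw [hk, hkf, r2 0 q hq, r5 1 q hq, r4, r3 1 q hq]
      simp only [Matrix.cons_val]
      field_simp
      linear_combination d6
    · rw [hkf, r3 0 q hq, r6]
      simp only [Matrix.cons_val]
      field_simp
      linear_combination d7

/-- The factor (a₄w + a₂)²/w² in the rule for K is absorbed by the 1/w² in f. In terms of f,
equivalence is an affine substitution and a constant factor. -/
theorem EquivW.diffW_eq {U U' : Set ℝ} (h : EquivW a₁ a₂ a₃ a₄ a₅ a₆ U K U' K') {w : ℝ}
    (hw : w ∈ wRange U) :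
    a₄ * w + a₂ ∈ wRange U' ∧ diffW K' (a₄ * w + a₂) = a₃ ^ 2 / a₅ * diffW K w := by
  obtain ⟨-, -, himg, hK⟩ := h
  have hm : a₄ * w + a₂ ∈ wRange U' := himg ▸ ⟨w, hw, rfl⟩
  refine ⟨hm, ?_⟩
  have h1 := hm.1
  have h2 := hw.1
  rw [diffW, diffW, hK w hw]
  field_simp

theorem isPointSymmetry_equivMapW_iff {U U' : Set ℝ} {S : Set (ℝ × ℝ)} (hK : IsConstitutive U K)
    (h : EquivW a₁ a₂ a₃ a₄ a₅ a₆ U K U' K') (hS : IsOpen S)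
    (hX : PushesTo (equivMapW a₁ a₂ a₃ a₄ a₅ a₆) (domW S U) X X') :
    IsPointSymmetry (pdeW K) (domW S U) X ↔
      IsPointSymmetry (pdeW K') (equivMapW a₁ a₂ a₃ a₄ a₅ a₆ '' domW S U) X' := by
  have hne := h.1
  have h3 : a₃ ≠ 0 := fun h => hne (by simp [h])
  have h4 : a₄ ≠ 0 := fun h => hne (by simp [h])
  have h5 : a₅ ≠ 0 := fun h => hne (by simp [h])
  have hW := isOpen_wRange hK.1.1
  have hB := isOpen_domW hS hK.1.1
  have hf := contDiffOn_diffW hK.2.1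
  have hf0 := diffW_ne_zero hK.2.2
  have hX' : ∀ q ∈ domW S U, X' (equivMapW a₁ a₂ a₃ a₄ a₅ a₆ q)
      = ![a₅ * X q 0, a₃ * X q 1, a₄ * X q 2] := fun q hq => by
    rw [hX q hq, fderiv_equivMapW]
  refine ⟨fun hs => hs.map_equivMapW h3 h4 h5 hW hf hf0 hB (fun q hq => hq.2)
    (fun w hw => (h.diffW_eq hw).2) hX', fun hs => ?_⟩
  have hB' := isOpen_equivMapW_image (a₁ := a₁) (a₂ := a₂) (a₆ := a₆) h3 h4 h5 hB
  have hW' : wRange U' = (fun w => (w - a₂) / a₄) ⁻¹' wRange U := by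
    rw [h.2.2.1, Set.image_eq_preimage_of_inverse]
    · intro w; simp [h4]
    · intro w; simp; field_simp; ring
  have oW' : IsOpen (wRange U') := by
    rw [hW']; exact hW.preimage (by fun_prop)
  have hval : ∀ w ∈ wRange U', diffW K' w = a₃ ^ 2 / a₅ * diffW K ((w - a₂) / a₄) := by
    intro w hw
    rw [h.2.2.1] at hw
    obtain ⟨v, hv, rfl⟩ := hw
    simp only [(h.diffW_eq hv).2, add_sub_cancel_right, mul_div_cancel_left₀ v h4]
  have hf' : ContDiffOn ℝ ∞ (diffW K') (wRange U') := by
    have h1 : ContDiffOn ℝ ∞ (fun w => a₃ ^ 2 / a₅ * diffW K ((w - a₂) / a₄)) (wRange U') := by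
      refine contDiffOn_const.mul (hf.comp (t := wRange U) (f := fun w => (w - a₂) / a₄) ?_ ?_)
      · exact ((contDiff_id.sub contDiff_const).div_const _).contDiffOn
      · rw [hW']; exact fun w hw => hw
    exact h1.congr hval
  have hmem : ∀ w ∈ wRange U', (w - a₂) / a₄ ∈ wRange U := by rw [hW']; exact fun w hw => hw
  have hf0' : ∀ w ∈ wRange U', diffW K' w ≠ 0 := fun w hw => by
    rw [hval w hw]
    exact mul_ne_zero (div_ne_zero (pow_ne_zero 2 h3) h5) (hf0 _ (hmem w hw))
  -- The converse is the forward statement for the inverse transformation, which maps the image of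
  -- the domain back onto the domain.
  have key := IsPointSymmetry.map_equivMapW (a₁ := -a₁ / a₃) (a₂ := -a₂ / a₄) (a₆ := -a₆ / a₅)
    (K' := K) (X' := X) (inv_ne_zero h3) (inv_ne_zero h4) (inv_ne_zero h5) oW' hf' hf0' hB'
    (by rintro _ ⟨q, hq, rfl⟩; exact (h.diffW_eq hq.2).1)
    (fun w hw => by
      have : a₄⁻¹ * w + -a₂ / a₄ = (w - a₂) / a₄ := by field_simp; ring
      rw [hval w hw, this]
      field_simp)
    (by
      rintro _ ⟨q, hq, rfl⟩
      rw [equivMapW_leftInverse h3 h4 h5, hX' q hq]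
      ext k
      fin_cases k <;> simp [h3, h4, h5]) hs
  rw [← Set.image_comp] at key
  have hid : (equivMapW (-a₁ / a₃) (-a₂ / a₄) a₃⁻¹ a₄⁻¹ a₅⁻¹ (-a₆ / a₅) ∘
      equivMapW a₁ a₂ a₃ a₄ a₅ a₆) = id := funext (equivMapW_leftInverse h3 h4 h5)
  rwa [hid, Set.image_id] at key

/-- Proportionality of the logarithmic derivatives of equivalent diffusivities. -/
theorem EquivW.deriv_eq {U U' : Set ℝ} (hU : IsOpen U) (h : EquivW a₁ a₂ a₃ a₄ a₅ a₆ U K U' K')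
    {w d d' : ℝ} (hw : w ∈ wRange U) (hd : HasDerivAt (diffW K) d w)
    (hd' : HasDerivAt (diffW K') d' (a₄ * w + a₂)) : d' * a₄ = a₃ ^ 2 / a₅ * d := by
  have e2 := HasDerivAt.comp w hd' (((hasDerivAt_id w).const_mul a₄).add_const a₂)
  have e4 := e2.unique ((hd.const_mul (a₃ ^ 2 / a₅)).congr_of_eventuallyEq (by
    filter_upwards [(isOpen_wRange hU).mem_nhds hw] with w hw using (h.diffW_eq hw).2))
  simpa using e4

theorem IsPower.hasDerivAt_diffW {μ : ℝ} {U : Set ℝ} (hW : IsOpen (wRange U)) (h : IsPower μ U K)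
    {w : ℝ} (hw : w ∈ wRange U) : HasDerivAt (diffW K) (-(μ + 2) * w ^ (-(μ + 2) - 1)) w := by
  refine (Real.hasDerivAt_rpow_const (Or.inl (h.diffW_eq hw).1.ne')).congr_of_eventuallyEq ?_
  filter_upwards [hW.mem_nhds hw] with v hv using (h.diffW_eq hv).2

theorem IsExpInv.hasDerivAt_diffW {U : Set ℝ} (hW : IsOpen (wRange U)) (h : IsExpInv U K)
    {w : ℝ} (hw : w ∈ wRange U) : HasDerivAt (diffW K) (Real.exp w) w := by
  refine (Real.hasDerivAt_exp w).congr_of_eventuallyEq ?_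
  filter_upwards [hW.mem_nhds hw] with v hv using h.diffW_eq hv

theorem EquivW.isOpen_wRange {U U' : Set ℝ} (hU : IsOpen U)
    (h : EquivW a₁ a₂ a₃ a₄ a₅ a₆ U K U' K') : IsOpen (wRange U') := by
  have h4 : a₄ ≠ 0 := fun h' => h.1 (by simp [h'])
  have hW' : wRange U' = (fun w => (w - a₂) / a₄) ⁻¹' wRange U := by
    rw [h.2.2.1, Set.image_eq_preimage_of_inverse]
    · intro w; simp [h4]
    · intro w; simp; field_simp; ring
  rw [hW']; exact (_root_.isOpen_wRange hU).preimage (by fun_prop)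

/-- The logarithmic derivatives −(μ+2)/w and −(μ'+2)a₄/(a₄w + a₂) must agree. Clearing denominators
gives an affine identity on an open set of w, and its linear coefficient (μ − μ')a₄ vanishes. -/
theorem EquivW.power_unique {U U' : Set ℝ} (hU : IsOpenInterval U)
    (h : EquivW a₁ a₂ a₃ a₄ a₅ a₆ U K U' K') {μ μ' : ℝ} (hP : IsPower μ U K)
    (hP' : IsPower μ' U' K') : μ = μ' := by
  have h0 : 0 ∉ U := fun h0 => lt_irrefl (0 : ℝ) (hP.1 h0)
  have h4 : a₄ ≠ 0 := fun h' => h.1 (by simp [h'])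
  have hW := _root_.isOpen_wRange hU.1
  have key : ∀ w ∈ wRange U, (μ + 2) * a₂ + (μ - μ') * a₄ * w = 0 := by
    intro w hw
    have hm := h.diffW_eq hw
    obtain ⟨hw0, e1⟩ := hP.diffW_eq hw
    obtain ⟨hy0, e2⟩ := hP'.diffW_eq hm.1
    have e3 := h.deriv_eq hU.1 hw (hP.hasDerivAt_diffW hW hw)
      (hP'.hasDerivAt_diffW (h.isOpen_wRange hU.1) hm.1)
    have e4 := hm.2
    rw [e1, e2] at e4
    rw [Real.rpow_sub_one hw0.ne', Real.rpow_sub_one hy0.ne', e4] at e3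
    have hp := (Real.rpow_pos_of_pos hw0 (-(μ + 2))).ne'
    have h5 : a₃ ^ 2 / a₅ ≠ 0 :=
      div_ne_zero (pow_ne_zero 2 fun h' => h.1 (by simp [h'])) fun h' => h.1 (by simp [h'])
    generalize a₃ ^ 2 / a₅ = c at *
    have hy := hy0.ne'
    have hw0 := hw0.ne'
    field_simp at e3
    linear_combination e3
  obtain ⟨-, h2⟩ := affine_coeff_eq_zero hW (nonempty_wRange h0 hU.2.1) key
  linarith [(mul_eq_zero.1 h2).resolve_right h4]

/-- The logarithmic derivative of exp(a₄w + a₂) is the nonzero constant a₄, which cannot equal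
−(μ+2)/w on an open set. -/
theorem EquivW.not_power_expInv {U U' : Set ℝ} (hU : IsOpenInterval U)
    (h : EquivW a₁ a₂ a₃ a₄ a₅ a₆ U K U' K') {μ : ℝ} (hP : IsPower μ U K) :
    ¬ IsExpInv U' K' := by
  intro hP'
  have h0 : 0 ∉ U := fun h0 => lt_irrefl (0 : ℝ) (hP.1 h0)
  have h4 : a₄ ≠ 0 := fun h' => h.1 (by simp [h'])
  have hW := _root_.isOpen_wRange hU.1
  have key : ∀ w ∈ wRange U, (μ + 2) + a₄ * w = 0 := by
    intro w hw
    have hm := h.diffW_eq hw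
    obtain ⟨hw0, e1⟩ := hP.diffW_eq hw
    have e2 := hP'.diffW_eq hm.1
    have e3 := h.deriv_eq hU.1 hw (hP.hasDerivAt_diffW hW hw)
      (hP'.hasDerivAt_diffW (h.isOpen_wRange hU.1) hm.1)
    have e4 := hm.2
    rw [e1, e2] at e4
    rw [Real.rpow_sub_one hw0.ne', e4] at e3
    have hp := (Real.rpow_pos_of_pos hw0 (-(μ + 2))).ne'
    have h5 : a₃ ^ 2 / a₅ ≠ 0 :=
      div_ne_zero (pow_ne_zero 2 fun h' => h.1 (by simp [h'])) fun h' => h.1 (by simp [h'])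
    generalize a₃ ^ 2 / a₅ = c at *
    have hw0 := hw0.ne'
    field_simp at e3
    linear_combination e3
  exact h4 (affine_coeff_eq_zero hW (nonempty_wRange h0 hU.2.1) key).2

end EquivalenceW

/-! ### Diffusivities that satisfy f' (a w + b) = r f. -/

section ClassificationW

variable {B : Set (Fin 3 → ℝ)} {X : VField} {W U : Set ℝ} {K f : ℝ → ℝ} {S : Set (ℝ × ℝ)}
  {τ ξ η : (Fin 3 → ℝ) → ℝ}

theorem exists_eq_const_of_hasDerivAt_zero {g : ℝ → ℝ} (hW : IsOpen W) (hc : IsPreconnected W)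
    (h : ∀ w ∈ W, HasDerivAt g 0 w) : ∃ C, ∀ w ∈ W, g w = C :=
  hW.exists_is_const_of_deriv_eq_zero hc
    (fun w hw => (h w hw).differentiableAt.differentiableWithinAt) fun w hw => (h w hw).deriv

/-- This freezes coefficients along a single w-fibre, so that the first determining equation becomes
an ordinary differential equation in w. -/
theorem eq_of_pd_two_eq_zero {g : (Fin 3 → ℝ) → ℝ} (hB : IsOpen B) (hg : ContDiffOn ℝ ∞ g B)
    (h : ∀ q ∈ B, pd 2 g q = 0) (hW : IsOpen W) (hc : IsPreconnected W) {t v : ℝ}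
    (hm : ∀ w ∈ W, ![t, v, w] ∈ B) {w w' : ℝ} (hw : w ∈ W) (hw' : w' ∈ W) :
    g ![t, v, w] = g ![t, v, w'] := by
  obtain ⟨C, hC⟩ := exists_eq_const_of_hasDerivAt_zero (g := fun w => g ![t, v, w]) hW hc
    (fun w hw => by
      have h1 := hg.hasDerivAt_curve hB (γ := fun w => ![t, v, w]) (s := w) (hm w hw)
        (hasDerivAt_vec3 (hasDerivAt_const w t) (hasDerivAt_const w v) (hasDerivAt_id w))
      simpa [h _ (hm w hw)] using h1)
  exact (hC w hw).trans (hC w' hw').symm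

/-- `f0` is the diffusivity of the target: e and s change w, a₅ = C absorbs the constant, and the
other parameters are trivial. The new interval can be written with `wRange` because inversion is an
involution. -/
theorem exists_equivW {e s C : ℝ} (he : e ≠ 0) (hC : C ≠ 0) {f0 K' : ℝ → ℝ}
    (h : ∀ w ∈ wRange U, e * w + s ≠ 0 ∧ diffW K w = C * f0 (e * w + s))
    (hK' : ∀ w ∈ wRange U, K' (1 / (e * w + s)) = (e * w + s) ^ 2 * f0 (e * w + s)) :
    EquivW 0 s 1 e C 0 U K (wRange ((fun w => e * w + s) '' wRange U)) K' := by
  refine ⟨by simp [he, hC], fun h => h.1 rfl, ?_, ?_⟩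
  · ext y
    constructor
    · rintro ⟨_, hy⟩
      simpa using hy.2
    · rintro ⟨w, hw, rfl⟩
      have := (h w hw).1
      exact ⟨this, one_div_ne_zero this, w, hw, by simp⟩
  · intro w hw
    rw [hK' w hw]
    have h1 := (h w hw).2
    have hw0 := hw.1
    rw [diffW] at h1
    field_simp at h1 ⊢
    rw [h1]
    ring

theorem exists_equivW_power {e s C σ : ℝ} (he : e ≠ 0) (hC : C ≠ 0)
    (h : ∀ w ∈ wRange U, 0 < e * w + s ∧ diffW K w = C * (e * w + s) ^ σ) :
    ∃ (a₁ a₂ a₃ a₄ a₅ a₆ : ℝ) (U' : Set ℝ) (K' : ℝ → ℝ),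
      EquivW a₁ a₂ a₃ a₄ a₅ a₆ U K U' K' ∧ ((∃ μ : ℝ, IsPower μ U' K') ∨ IsExpInv U' K') := by
  -- The power u^μ has the diffusivity w^(−(μ+2)), so the exponent σ calls for μ = −σ − 2.
  refine ⟨_, _, _, _, _, _, _, fun u => u ^ (-σ - 2), exists_equivW he hC
    (f0 := fun y => y ^ σ) (fun w hw => ⟨(h w hw).1.ne', (h w hw).2⟩) (fun w hw => ?_),
    Or.inl ⟨-σ - 2, ?_, fun u _ => rfl⟩⟩
  · have hy := (h w hw).1
    simp only [one_div]
    rw [Real.inv_rpow hy.le, ← Real.rpow_neg hy.le, neg_sub, sub_neg_eq_add, Real.rpow_add hy]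
    norm_num
  · rintro u ⟨_, w, hw, hu⟩
    have := (h w hw).1
    simp only at hu
    rw [hu] at this
    exact one_div_pos.1 this

theorem exists_equivW_exp {e C : ℝ} (he : e ≠ 0) (hC : C ≠ 0)
    (h : ∀ w ∈ wRange U, diffW K w = C * Real.exp (e * w)) :
    ∃ (a₁ a₂ a₃ a₄ a₅ a₆ : ℝ) (U' : Set ℝ) (K' : ℝ → ℝ),
      EquivW a₁ a₂ a₃ a₄ a₅ a₆ U K U' K' ∧ ((∃ μ : ℝ, IsPower μ U' K') ∨ IsExpInv U' K') := by
  refine ⟨_, _, _, _, _, _, _, fun u => Real.exp (1 / u) * (u ^ 2)⁻¹, exists_equivW he hC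
    (s := 0) (f0 := fun y => Real.exp y) (fun w hw => ⟨?_, ?_⟩) (fun w hw => ?_),
    Or.inr fun u _ => rfl⟩
  · simpa using ⟨he, hw.1⟩
  · simpa using h w hw
  · simp only [add_zero]
    rw [one_div_one_div, one_div, inv_pow, inv_inv, mul_comm]

theorem pos_or_neg_of_ne_zero {g : ℝ → ℝ} (hc : IsPreconnected W) (hg : ContinuousOn g W)
    (h : ∀ w ∈ W, g w ≠ 0) : (∀ w ∈ W, 0 < g w) ∨ ∀ w ∈ W, g w < 0 := by
  by_contra hcon
  push Not at hcon
  obtain ⟨⟨x, hx, hx'⟩, y, hy, hy'⟩ := hcon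
  obtain ⟨z, hz, hz'⟩ := hc.intermediate_value hx hy hg ⟨hx', hy'⟩
  exact h z hz hz'

theorem eq_zero_of_eq_zero_of_ne {g : ℝ → ℝ} {r : ℝ} (hW : IsOpen W) (hr : r ∈ W)
    (hg : ContinuousAt g r) (h : ∀ w ∈ W, w ≠ r → g w = 0) : g r = 0 := by
  have h1 : Filter.Tendsto g (nhdsWithin r {r}ᶜ) (nhds (g r)) :=
    hg.tendsto.mono_left nhdsWithin_le_nhds
  have h2 : Filter.Tendsto g (nhdsWithin r {r}ᶜ) (nhds 0) := by
    refine tendsto_const_nhds.congr' ?_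
    filter_upwards [self_mem_nhdsWithin, nhdsWithin_le_nhds (hW.mem_nhds hr)] with x hx hx'
    exact (h x hx' hx).symm
  exact tendsto_nhds_unique h1 h2

/-- The nonvanishing solutions of a first order linear equation with affine coefficients. -/
theorem const_or_exp_or_power_of_ode (hW : IsOpen W) (hc : IsPreconnected W) {w₀ : ℝ}
    (hw₀ : w₀ ∈ W) (hf : ContDiffOn ℝ ∞ f W) (hf0 : ∀ w ∈ W, f w ≠ 0) {a b r : ℝ}
    (h : ∀ w ∈ W, deriv f w * (a * w + b) = f w * r) (hne : ¬ (a = 0 ∧ b = 0 ∧ r = 0)) :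
    (∃ C, C ≠ 0 ∧ ∀ w ∈ W, f w = C) ∨
    (∃ e C, e ≠ 0 ∧ C ≠ 0 ∧ ∀ w ∈ W, f w = C * Real.exp (e * w)) ∨
    ∃ e s C σ, e ≠ 0 ∧ C ≠ 0 ∧ ∀ w ∈ W, 0 < e * w + s ∧ f w = C * (e * w + s) ^ (σ : ℝ) := by
  have hd : ∀ w ∈ W, HasDerivAt f (deriv f w) w := fun w hw => hf.hasDerivAt_of_open hW hw
  by_cases hz : ∀ w ∈ W, deriv f w = 0
  · obtain ⟨C, hC⟩ := exists_eq_const_of_hasDerivAt_zero hW hc (fun w hw => hz w hw ▸ hd w hw)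
    exact Or.inl ⟨C, hC w₀ hw₀ ▸ hf0 w₀ hw₀, hC⟩
  right
  by_cases ha : a = 0
  · left
    subst ha
    by_cases hb : b = 0
    · subst hb
      have := h w₀ hw₀
      simp [hf0 w₀ hw₀] at this
      exact absurd ⟨rfl, rfl, this⟩ hne
    have hr : r / b ≠ 0 := by
      intro hr
      have hr : r = 0 := by simpa [hb] using hr
      refine hz fun w hw => ?_
      have := h w hw
      simpa [hr, hb] using this
    -- With a = 0 the equation is f' = (r/b) f, and exp(−(r/b) w) is an integrating factor.
    obtain ⟨C, hC⟩ := exists_eq_const_of_hasDerivAt_zero hW hc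
      (g := fun w => f w * Real.exp (-(r / b * w))) (fun w hw => by
        have h1 := (hd w hw).mul (((hasDerivAt_id w).const_mul (r / b)).neg.exp)
        refine h1.congr_deriv ?_
        have h2 : deriv f w = f w * r / b := by
          rw [eq_div_iff hb]; linear_combination h w hw
        rw [h2]
        simp
        ring)
    refine ⟨r / b, C, hr, ?_, fun w hw => ?_⟩
    · rw [← hC w₀ hw₀]
      exact mul_ne_zero (hf0 w₀ hw₀) (Real.exp_ne_zero _)
    · rw [← hC w hw, mul_assoc, ← Real.exp_add]
      simp
  · right
    -- A zero of a w + b in W would force r = 0, since f does not vanish there. Then f' = 0 away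
    -- from the zero and, by continuity, at it: the constant case already set aside.
    have hroot : ∀ w ∈ W, a * w + b ≠ 0 := by
      intro w hw hw0
      have hr : r = 0 := by
        have := h w hw
        rw [hw0, mul_zero] at this
        exact (mul_eq_zero.1 this.symm).resolve_left (hf0 w hw)
      have hne : ∀ v ∈ W, v ≠ w → deriv f v = 0 := by
        intro v hv hvw
        have := h v hv
        rw [hr, mul_zero] at this
        refine (mul_eq_zero.1 this).resolve_right fun hv0 => hvw ?_
        have : a * (v - w) = 0 := by linear_combination hv0 - hw0
        linarith [(mul_eq_zero.1 this).resolve_left ha]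
      refine hz fun v hv => ?_
      by_cases hvw : v = w
      · subst hvw
        exact eq_zero_of_eq_zero_of_ne hW hv
          ((hf.deriv_infty hW).contDiffAt (hW.mem_nhds hv)).continuousAt hne
      · exact hne v hv hvw
    -- The sign e = ±1 will be chosen to make the base of the real power positive; f times that base
    -- to the power −r/a then has derivative zero.
    have main : ∀ e : ℝ, e ≠ 0 → (∀ w ∈ W, 0 < e * w + e * (b / a)) →
        ∃ C, C ≠ 0 ∧ ∀ w ∈ W, f w = C * (e * w + e * (b / a)) ^ (r / a) := by
      intro e he hpos
      obtain ⟨C, hC⟩ := exists_eq_const_of_hasDerivAt_zero hW hc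
        (g := fun w => f w * (e * w + e * (b / a)) ^ (-(r / a))) (fun w hw => by
          have h1 := (hd w hw).mul ((((hasDerivAt_id w).const_mul e).add_const
            (e * (b / a))).rpow_const (p := -(r / a)) (Or.inl (hpos w hw).ne'))
          refine h1.congr_deriv ?_
          have h3 : e * (a * w + b) ≠ 0 := mul_ne_zero he (hroot w hw)
          have h2 : deriv f w = f w * r / (a * w + b) := by
            rw [eq_div_iff (hroot w hw)]; exact h w hw
          have h4 := hroot w hw
          have h5 : e * w + e * (b / a) = e * (a * w + b) / a := by field_simp
          simp only [id]
          rw [h2, Real.rpow_sub_one (hpos w hw).ne', h5]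
          field_simp
          ring)
      refine ⟨C, ?_, fun w hw => ?_⟩
      · rw [← hC w₀ hw₀]
        exact mul_ne_zero (hf0 w₀ hw₀) (Real.rpow_pos_of_pos (hpos w₀ hw₀) _).ne'
      · rw [← hC w hw, mul_assoc, ← Real.rpow_add (hpos w hw)]
        simp
    have hs : ∀ w ∈ W, w + b / a ≠ 0 := fun w hw h' => hroot w hw (by
      field_simp at h'; linear_combination h')
    rcases pos_or_neg_of_ne_zero hc (g := fun w => w + b / a) (by fun_prop) hs with hp | hn
    · have hp' : ∀ w ∈ W, 0 < 1 * w + 1 * (b / a) := fun w hw => by simpa using hp w hw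
      obtain ⟨C, hC0, hC⟩ := main 1 one_ne_zero hp'
      exact ⟨1, _, C, _, one_ne_zero, hC0, fun w hw => ⟨hp' w hw, hC w hw⟩⟩
    · have hn' : ∀ w ∈ W, 0 < -1 * w + -1 * (b / a) := fun w hw => by
        have := hn w hw
        linarith
      obtain ⟨C, hC0, hC⟩ := main (-1) (by norm_num) hn'
      exact ⟨-1, _, C, _, by norm_num, hC0, fun w hw => ⟨hn' w hw, hC w hw⟩⟩

/-- A diffusivity that satisfies a first order linear equation with affine coefficients is
equivalent to a power or to an exponential. -/
theorem exists_equivW_of_ode (hU : IsOpenInterval U) (h0 : 0 ∉ U)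
    (hf : ContDiffOn ℝ ∞ (diffW K) (wRange U)) (hf0 : ∀ w ∈ wRange U, diffW K w ≠ 0) {a b r : ℝ}
    (h : ∀ w ∈ wRange U, deriv (diffW K) w * (a * w + b) = diffW K w * r)
    (hne : ¬ (a = 0 ∧ b = 0 ∧ r = 0)) :
    ∃ (a₁ a₂ a₃ a₄ a₅ a₆ : ℝ) (U' : Set ℝ) (K' : ℝ → ℝ),
      EquivW a₁ a₂ a₃ a₄ a₅ a₆ U K U' K' ∧ ((∃ μ : ℝ, IsPower μ U' K') ∨ IsExpInv U' K') := by
  have hc := isPreconnected_wRange h0 hU.2.2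
  obtain ⟨w₀, hw₀⟩ := nonempty_wRange h0 hU.2.1
  rcases const_or_exp_or_power_of_ode (isOpen_wRange hU.1) hc hw₀ hf hf0 h hne with
    ⟨C, hC0, hC⟩ | ⟨e, C, he, hC0, hC⟩ | ⟨e, s, C, σ, he, hC0, hC⟩
  -- A constant diffusivity is the power w⁰, which belongs to u^(−2). If w is negative on the
  -- domain, a reflection makes it positive.
  · rcases pos_or_neg_of_ne_zero hc continuousOn_id (fun w hw => hw.1) with hp | hn
    · exact exists_equivW_power (s := 0) (σ := 0) one_ne_zero hC0
        (fun w hw => ⟨by simpa using hp w hw, by simpa using hC w hw⟩)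
    · exact exists_equivW_power (s := 0) (σ := 0) (e := -1) (by norm_num) hC0
        (fun w hw => ⟨by simpa using hn w hw, by simpa using hC w hw⟩)
  · exact exists_equivW_exp he hC0 hC
  · exact exists_equivW_power he hC0 hC

end ClassificationW

/-! ### Solving the determining equations of the first class. -/

section DeterminingW

variable {B : Set (Fin 3 → ℝ)} {X : VField} {W U : Set ℝ} {K f : ℝ → ℝ} {S : Set (ℝ × ℝ)}
  {τ ξ η b : (Fin 3 → ℝ) → ℝ}

/-- Sufficient conditions for a field with polynomial `τ`, `ξ` and affine `η` to satisfy the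
determining equations of `w_t = (f(w) w_v)_v`. -/
theorem detW_of_polynomial (hB : IsOpen B) (hb : ContDiffOn ℝ ∞ b B)
    (hb2 : ∀ q ∈ B, pd 2 b q = 0) (c x a : Fin 5 → ℝ)
    (hτ : ∀ q ∈ B, τ q = c 0 + c 1 * q 0 + c 2 * (q 0 * q 0))
    (hξ : ∀ q ∈ B, ξ q = x 0 + x 1 * q 1 + x 2 * q 0 + x 3 * (q 0 * q 1) + x 4 * (q 1 * q 1))
    (hη : ∀ q ∈ B, η q = (a 0 + a 1 * q 0 + a 2 * q 1 + a 3 * (q 1 * q 1)) * q 2 + b q)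
    (h1 : ∀ q ∈ B, deriv f (q 2) * ((a 0 + a 1 * q 0 + a 2 * q 1 + a 3 * q 1 ^ 2) * q 2 + b q)
      = f (q 2) * (2 * (x 1 + x 3 * q 0 + 2 * x 4 * q 1) - (c 1 + 2 * c 2 * q 0)))
    (h2 : ∀ q ∈ B, -(x 2 + x 3 * q 1) = f (q 2) * (2 * (a 2 + 2 * a 3 * q 1) - 2 * x 4)
      + 2 * deriv f (q 2) * ((a 2 + 2 * a 3 * q 1) * q 2 + pd 1 b q))
    (h3 : ∀ q ∈ B, a 1 * q 2 + pd 0 b q = f (q 2) * (2 * a 3 * q 2 + pd 1 (pd 1 b) q)) :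
    ∀ q ∈ B, DetW f τ ξ η q := by
  have co := fun (i k : Fin 3) (q : Fin 3 → ℝ) => HasPD.coord i k q
  have k := fun (i : Fin 3) (r : ℝ) (q : Fin 3 → ℝ) => HasPD.const (i := i) (q := q) r
  have pτ : ∀ i, ∀ q ∈ B, pd i τ q = if i = 0 then c 1 + 2 * c 2 * q 0 else 0 := by
    intro i q hq
    have := ((((k i (c 0) q).add ((co i 0 q).const_mul (c 1))).add
      (((co i 0 q).mul (co i 0 q)).const_mul (c 2))).congr_on hB hq hτ).pd_eq
    rw [this]
    split_ifs <;> ring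
  have pξ : ∀ i, ∀ q ∈ B, pd i ξ q = if i = 0 then x 2 + x 3 * q 1 else
      if i = 1 then x 1 + x 3 * q 0 + 2 * x 4 * q 1 else 0 := by
    intro i q hq
    have := ((((((k i (x 0) q).add ((co i 1 q).const_mul (x 1))).add
      ((co i 0 q).const_mul (x 2))).add (((co i 0 q).mul (co i 1 q)).const_mul (x 3))).add
      (((co i 1 q).mul (co i 1 q)).const_mul (x 4))).congr_on hB hq hξ).pd_eq
    rw [this]
    fin_cases i <;> simp; ring
  have pξ1 : ∀ q ∈ B, pd 1 (pd 1 ξ) q = 2 * x 4 := by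
    intro q hq
    have := ((((k 1 (x 1) q).add ((co 1 0 q).const_mul (x 3))).add
      ((co 1 1 q).const_mul (2 * x 4))).congr_on (g := pd 1 ξ) hB hq (fun q hq => by
        rw [pξ 1 q hq]; simp)).pd_eq
    rw [this]; simp
  have pη : ∀ i, ∀ q ∈ B, pd i η q = if i = 0 then a 1 * q 2 + pd 0 b q else
      if i = 1 then (a 2 + 2 * a 3 * q 1) * q 2 + pd 1 b q else
        a 0 + a 1 * q 0 + a 2 * q 1 + a 3 * (q 1 * q 1) := by
    intro i q hq
    have := (((((((k i (a 0) q).add ((co i 0 q).const_mul (a 1))).add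
      ((co i 1 q).const_mul (a 2))).add (((co i 1 q).mul (co i 1 q)).const_mul (a 3))).mul
        (co i 2 q)).add (hb.hasPD hB hq i)).congr_on hB hq hη).pd_eq
    rw [this]
    fin_cases i <;> simp [hb2 q hq, -mul_eq_mul_right_iff]; ring
  have pη2 : ∀ i, ∀ q ∈ B, pd i (pd 2 η) q = if i = 0 then a 1 else
      if i = 1 then a 2 + 2 * a 3 * q 1 else 0 := by
    intro i q hq
    have := (((((k i (a 0) q).add ((co i 0 q).const_mul (a 1))).add
      ((co i 1 q).const_mul (a 2))).add (((co i 1 q).mul (co i 1 q)).const_mul (a 3))).congr_on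
        (g := pd 2 η) hB hq (fun q hq => by rw [pη 2 q hq]; simp)).pd_eq
    rw [this]
    fin_cases i <;> simp
    ring
  have pη1 : ∀ q ∈ B, pd 1 (pd 1 η) q = 2 * a 3 * q 2 + pd 1 (pd 1 b) q := by
    intro q hq
    have := (((((k 1 (a 2) q).add ((co 1 1 q).const_mul (2 * a 3))).mul (co 1 2 q)).add
      ((hb.pd hB 1).hasPD hB hq 1)).congr_on (g := pd 1 η) hB hq (fun q hq => by rw [pη 1 q hq]; simp)).pd_eq
    rw [this]; simp
  intro q hq
  refine ⟨⟨?_, ?_, ?_⟩, ?_, ?_, ?_, ?_⟩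
  · simp [pτ _ q hq]
  · simp [pτ _ q hq]
  · simp [pξ _ q hq]
  · rw [hη q hq, pξ 1 q hq, pτ 0 q hq]
    simp
    linear_combination h1 q hq
  · simp [pη2 _ q hq]
  · rw [pξ 0 q hq, pη2 1 q hq, pξ1 q hq, pη 1 q hq]
    simp
    linear_combination h2 q hq
  · rw [pη 0 q hq, pη1 q hq]
    simpa using h3 q hq

theorem exists_affine_time (hB : IsOpen B) (hc : IsPreconnected B) (sτ : ContDiffOn ℝ ∞ τ B)
    (h1 : ∀ q ∈ B, pd 1 τ q = 0) (h2 : ∀ q ∈ B, pd 2 τ q = 0)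
    (h3 : ∀ q ∈ B, pd 0 (pd 0 τ) q = 0) :
    ∃ c d, ∀ q ∈ B, pd 0 τ q = c ∧ τ q = c * q 0 + d := by
  obtain ⟨c, hc0⟩ := exists_eq_const hB hc (sτ.pd hB 0) h3
    (fun q hq => (pd_comm sτ hB hq 1 0).trans (pd_eq_zero_of_eq_const hB h1 0 hq))
    (fun q hq => (pd_comm sτ hB hq 2 0).trans (pd_eq_zero_of_eq_const hB h2 0 hq))
  obtain ⟨d, hd⟩ := exists_affine_of_pd hB hc sτ c 0 0 hc0 h1 h2
  exact ⟨c, d, fun q hq => ⟨hc0 q hq, by simpa using hd q hq⟩⟩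

theorem exists_quadratic_space (hB : IsOpen B) (hc : IsPreconnected B) (sξ : ContDiffOn ℝ ∞ ξ B)
    (h0 : ∀ q ∈ B, pd 0 ξ q = 0) (h2 : ∀ q ∈ B, pd 2 ξ q = 0)
    (h3 : ∀ q ∈ B, pd 1 (pd 1 (pd 1 ξ)) q = 0) :
    ∃ k m n, ∀ q ∈ B, pd 1 (pd 1 ξ) q = k ∧ pd 1 ξ q = k * q 1 + m ∧
      ξ q = k / 2 * q 1 ^ 2 + m * q 1 + n := by
  have h01 : ∀ q ∈ B, pd 0 (pd 1 ξ) q = 0 := fun q hq =>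
    (pd_comm sξ hB hq 0 1).trans (pd_eq_zero_of_eq_const hB h0 1 hq)
  have h21 : ∀ q ∈ B, pd 2 (pd 1 ξ) q = 0 := fun q hq =>
    (pd_comm sξ hB hq 2 1).trans (pd_eq_zero_of_eq_const hB h2 1 hq)
  obtain ⟨k, hk⟩ := exists_eq_const hB hc ((sξ.pd hB 1).pd hB 1)
    (fun q hq => (pd_comm (sξ.pd hB 1) hB hq 0 1).trans (pd_eq_zero_of_eq_const hB h01 1 hq)) h3
    (fun q hq => (pd_comm (sξ.pd hB 1) hB hq 2 1).trans (pd_eq_zero_of_eq_const hB h21 1 hq))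
  obtain ⟨m, hm⟩ := exists_affine_of_pd hB hc (sξ.pd hB 1) 0 k 0 h01 hk h21
  obtain ⟨n, hn⟩ := exists_quadratic_of_pd hB hc sξ ![0, m, 0]
    (fun i j => if i = 1 then if j = 1 then k else 0 else 0) (by
      intro i j; fin_cases i <;> fin_cases j <;> rfl) (by
      intro i q hq
      rw [Fin.sum_univ_three]
      fin_cases i
      · simpa using h0 q hq
      · have := hm q hq
        simp
        linear_combination this
      · simpa using h2 q hq)
  refine ⟨k, m, n, fun q hq => ⟨hk q hq, by simpa using hm q hq, ?_⟩⟩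
  have := hn q hq
  simp at this
  linear_combination this

/-- A relation `P = f(w) E` with `P` and `E` independent of `w`. -/
theorem eq_zero_of_eq_mul (hB : IsOpen B) (hW : IsOpen W) (hf : ContDiffOn ℝ ∞ f W)
    (hBW : ∀ q ∈ B, q 2 ∈ W) (hf' : ∀ w ∈ W, deriv f w ≠ 0) {P E : (Fin 3 → ℝ) → ℝ}
    (sE : ContDiffOn ℝ ∞ E B) (hP : ∀ q ∈ B, HasPD 2 P 0 q) (hE : ∀ q ∈ B, pd 2 E q = 0)
    (h : ∀ q ∈ B, P q = f (q 2) * E q) : ∀ q ∈ B, P q = 0 ∧ E q = 0 := by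
  intro q hq
  -- Differentiating the relation in w leaves f'(w) E = 0.
  have hA := HasPD.comp_coord 2 2 (hf.hasDerivAt_of_open hW (hBW q hq))
  have h1 := ((hA.mul (sE.hasPD hB hq 2)).congr_on hB hq h).unique (hP q hq)
  have h2 : E q = 0 := by simpa [hE q hq, hf' _ (hBW q hq)] using h1
  exact ⟨by rw [h q hq, h2, mul_zero], h2⟩

/-- Consequences of the determining equations common to all diffusivities. -/
theorem detW_mixed (hB : IsOpen B) (sτ : ContDiffOn ℝ ∞ τ B) (sξ : ContDiffOn ℝ ∞ ξ B)
    (h : ∀ q ∈ B, DetW f τ ξ η q) : ∀ q ∈ B, pd 1 (pd 0 τ) q = 0 ∧ pd 2 (pd 0 τ) q = 0 ∧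
      pd 2 (pd 0 ξ) q = 0 ∧ pd 2 (pd 1 ξ) q = 0 ∧ pd 2 (pd 1 (pd 1 ξ)) q = 0 := by
  have h21 : ∀ q ∈ B, pd 2 (pd 1 ξ) q = 0 := fun q hq => (pd_comm sξ hB hq 2 1).trans
    (pd_eq_zero_of_eq_const hB (fun q hq => (h q hq).1.2.2) 1 hq)
  intro q hq
  refine ⟨?_, ?_, ?_, h21 q hq, ?_⟩
  · exact (pd_comm sτ hB hq 1 0).trans (pd_eq_zero_of_eq_const hB (fun q hq => (h q hq).1.1) 0 hq)
  · exact (pd_comm sτ hB hq 2 0).trans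
      (pd_eq_zero_of_eq_const hB (fun q hq => (h q hq).1.2.1) 0 hq)
  · exact (pd_comm sξ hB hq 2 0).trans
      (pd_eq_zero_of_eq_const hB (fun q hq => (h q hq).1.2.2) 0 hq)
  · exact (pd_comm (sξ.pd hB 1) hB hq 2 1).trans (pd_eq_zero_of_eq_const hB h21 1 hq)

/-- Solution of the determining equations when `f` is a power with nonzero exponent. -/
theorem detW_power (hB : IsOpen B) (hc : IsPreconnected B) (hW : IsOpen W)
    (hf : ContDiffOn ℝ ∞ f W) (hf0 : ∀ w ∈ W, f w ≠ 0) (hBW : ∀ q ∈ B, q 2 ∈ W)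
    (sτ : ContDiffOn ℝ ∞ τ B) (sξ : ContDiffOn ℝ ∞ ξ B) {σ : ℝ} (hσ : σ ≠ 0)
    (hode : ∀ w ∈ W, deriv f w * w = σ * f w) (hne : B.Nonempty) (h : ∀ q ∈ B, DetW f τ ξ η q) :
    ∃ c d k m n, (3 * σ + 4) * k = 0 ∧ ∀ q ∈ B, τ q = c * q 0 + d ∧
      ξ q = k / 2 * q 1 ^ 2 + m * q 1 + n ∧ η q = (2 * (k * q 1 + m) - c) / σ * q 2 := by
  have hmix := detW_mixed hB sτ sξ h
  have hf' : ∀ w ∈ W, deriv f w ≠ 0 := fun w hw h0 => by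
    have := hode w hw
    rw [h0, zero_mul] at this
    exact mul_ne_zero hσ (hf0 w hw) this.symm
  -- With f' w = σ f, the first determining equation solves for η after division by f'.
  have hη : ∀ q ∈ B, η q = 1 / σ * ((2 * pd 1 ξ q - pd 0 τ q) * q 2) := fun q hq => by
    have h1 := (h q hq).2.1
    have h2 := hode _ (hBW q hq)
    have h3 : deriv f (q 2) * (σ * η q - (2 * pd 1 ξ q - pd 0 τ q) * q 2) = 0 := by
      linear_combination σ * h1 - (2 * pd 1 ξ q - pd 0 τ q) * h2
    have h4 := (mul_eq_zero.1 h3).resolve_left (hf' _ (hBW q hq))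
    field_simp
    linear_combination h4
  have s1 := sξ.pd hB 1
  have s11 := s1.pd hB 1
  have s0 := sτ.pd hB 0
  have dη : ∀ i, ∀ q ∈ B, pd i η q = 1 / σ * ((2 * pd i (pd 1 ξ) q - pd i (pd 0 τ) q) * q 2
      + (2 * pd 1 ξ q - pd 0 τ q) * (if i = 2 then 1 else 0)) := fun i q hq =>
    ((((((s1.hasPD hB hq i).const_mul 2).sub (s0.hasPD hB hq i)).mul
      (HasPD.coord i 2 q)).const_mul (1 / σ)).congr_on hB hq hη).pd_eq
  have dη2 : ∀ q ∈ B, pd 2 η q = 1 / σ * (2 * pd 1 ξ q - pd 0 τ q) := fun q hq => by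
    rw [dη 2 q hq, (hmix q hq).2.1, (hmix q hq).2.2.2.1]; simp
  have dη21 : ∀ q ∈ B, pd 1 (pd 2 η) q = 1 / σ * (2 * pd 1 (pd 1 ξ) q) := fun q hq => by
    rw [((((((s1.hasPD hB hq 1).const_mul 2).sub (s0.hasPD hB hq 1))).const_mul (1 / σ)).congr_on
      hB hq dη2).pd_eq, (hmix q hq).1, sub_zero]
  have dη1 : ∀ q ∈ B, pd 1 η q = 1 / σ * (2 * pd 1 (pd 1 ξ) q * q 2) := fun q hq => by
    rw [dη 1 q hq, (hmix q hq).1]; simp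
  -- Substituting η turns the fourth equation into −ξ_t = (4/σ + 3) f ξ_vv, where only f depends on
  -- w.
  have e1 := eq_zero_of_eq_mul hB hW hf hBW hf' (P := fun q => -pd 0 ξ q)
    (E := fun q => (4 / σ + 3) * pd 1 (pd 1 ξ) q) (contDiffOn_const.mul s11)
    (fun q hq => by
      have := ((sξ.pd hB 0).hasPD hB hq 2).neg
      rwa [(hmix q hq).2.2.1, neg_zero] at this)
    (fun q hq => by
      rw [((s11.hasPD hB hq 2).const_mul _).pd_eq, (hmix q hq).2.2.2.2, mul_zero])
    (fun q hq => by
      have h1 := (h q hq).2.2.2.1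
      have h2 := hode _ (hBW q hq)
      rw [dη21 q hq, dη1 q hq] at h1
      rw [h1]
      field_simp
      linear_combination 4 * pd 1 (pd 1 ξ) q * h2)
  have hξ0 : ∀ q ∈ B, pd 0 ξ q = 0 := fun q hq => neg_eq_zero.1 (e1 q hq).1
  have hξ10 : ∀ q ∈ B, pd 0 (pd 1 ξ) q = 0 := fun q hq =>
    (pd_comm sξ hB hq 0 1).trans (pd_eq_zero_of_eq_const hB hξ0 1 hq)
  have dη11 : ∀ q ∈ B, pd 1 (pd 1 η) q = 1 / σ * (2 * pd 1 (pd 1 (pd 1 ξ)) q * q 2) := fun q hq => by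
    rw [(((((s11.hasPD hB hq 1).const_mul 2).mul (HasPD.coord 1 2 q)).const_mul (1 / σ)).congr_on
      hB hq dη1).pd_eq]
    simp
  have s111 := s11.pd hB 1
  -- Once w/σ is cancelled, the last equation reads −τ_tt = 2 f ξ_vvv. Here w ≠ 0, because f' w = σ
  -- f ≠ 0.
  have e2 := eq_zero_of_eq_mul hB hW hf hBW hf' (P := fun q => -pd 0 (pd 0 τ) q)
    (E := fun q => 2 * pd 1 (pd 1 (pd 1 ξ)) q) (contDiffOn_const.mul s111)
    (fun q hq => by
      have := ((s0.pd hB 0).hasPD hB hq 2).neg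
      rwa [pd_comm s0 hB hq 2 0, pd_eq_zero_of_eq_const hB (fun q hq => (hmix q hq).2.1) 0 hq,
        neg_zero] at this)
    (fun q hq => by
      rw [((s111.hasPD hB hq 2).const_mul _).pd_eq, pd_comm s11 hB hq 2 1,
        pd_eq_zero_of_eq_const hB (fun q hq => (hmix q hq).2.2.2.2) 1 hq, mul_zero])
    (fun q hq => by
      have h1 := (h q hq).2.2.2.2
      rw [dη11 q hq, dη 0 q hq, hξ10 q hq] at h1
      have hw : q 2 ≠ 0 := fun hw => by
        have := hode _ (hBW q hq)
        rw [hw, mul_zero] at this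
        exact mul_ne_zero hσ (hf0 0 (hw ▸ hBW q hq)) this.symm
      simp at h1
      field_simp at h1
      linear_combination h1)
  obtain ⟨c, d, hcd⟩ := exists_affine_time hB hc sτ (fun q hq => (h q hq).1.1)
    (fun q hq => (h q hq).1.2.1) (fun q hq => neg_eq_zero.1 (e2 q hq).1)
  obtain ⟨k, m, n, hkmn⟩ := exists_quadratic_space hB hc sξ hξ0 (fun q hq => (h q hq).1.2.2)
    (fun q hq => by simpa using (e2 q hq).2)
  refine ⟨c, d, k, m, n, ?_, fun q hq => ⟨(hcd q hq).2, (hkmn q hq).2.2, ?_⟩⟩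
  -- The constraint left from `e1` is (4/σ + 3) k = 0 with k = ξ_vv. Since σ = −(μ+2), a nonzero k
  -- requires μ = −2/3, the row of `V₅`.
  · obtain ⟨q, hq⟩ := hne
    have := (e1 q hq).2
    rw [(hkmn q hq).1] at this
    field_simp at this
    linear_combination this
  · rw [hη q hq, (hcd q hq).1, (hkmn q hq).2.1]
    ring

/-- Solution of the determining equations when `f` is an exponential. -/
theorem detW_exp (hB : IsOpen B) (hc : IsPreconnected B) (hW : IsOpen W)
    (hf : ContDiffOn ℝ ∞ f W) (hf0 : ∀ w ∈ W, f w ≠ 0) (hBW : ∀ q ∈ B, q 2 ∈ W)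
    (sτ : ContDiffOn ℝ ∞ τ B) (sξ : ContDiffOn ℝ ∞ ξ B)
    (hode : ∀ w ∈ W, deriv f w = f w) (hne : B.Nonempty) (h : ∀ q ∈ B, DetW f τ ξ η q) :
    ∃ c d m n, ∀ q ∈ B, τ q = c * q 0 + d ∧ ξ q = m * q 1 + n ∧ η q = 2 * m - c := by
  have hmix := detW_mixed hB sτ sξ h
  have hf' : ∀ w ∈ W, deriv f w ≠ 0 := fun w hw => hode w hw ▸ hf0 w hw
  have hη : ∀ q ∈ B, η q = 2 * pd 1 ξ q - pd 0 τ q := fun q hq => by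
    have h1 := (h q hq).2.1
    rw [hode _ (hBW q hq)] at h1
    exact mul_left_cancel₀ (hf0 _ (hBW q hq)) h1
  have s1 := sξ.pd hB 1
  have s11 := s1.pd hB 1
  have s0 := sτ.pd hB 0
  have dη : ∀ i, ∀ q ∈ B, pd i η q = 2 * pd i (pd 1 ξ) q - pd i (pd 0 τ) q := fun i q hq =>
    ((((s1.hasPD hB hq i).const_mul 2).sub (s0.hasPD hB hq i)).congr_on hB hq hη).pd_eq
  have dη2 : ∀ q ∈ B, pd 2 η q = 0 := fun q hq => by
    rw [dη 2 q hq, (hmix q hq).2.1, (hmix q hq).2.2.2.1]; simp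
  -- For f' = f the fourth equation reads −ξ_t = 3 f ξ_vv, so no quadratic term in v can occur.
  have e1 := eq_zero_of_eq_mul hB hW hf hBW hf' (P := fun q => -pd 0 ξ q)
    (E := fun q => 3 * pd 1 (pd 1 ξ) q) (contDiffOn_const.mul s11)
    (fun q hq => by
      have := ((sξ.pd hB 0).hasPD hB hq 2).neg
      rwa [(hmix q hq).2.2.1, neg_zero] at this)
    (fun q hq => by
      rw [((s11.hasPD hB hq 2).const_mul _).pd_eq, (hmix q hq).2.2.2.2, mul_zero])
    (fun q hq => by
      have h1 := (h q hq).2.2.2.1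
      rw [pd_eq_zero_of_eq_const hB dη2 1 hq, dη 1 q hq, (hmix q hq).1, hode _ (hBW q hq)] at h1
      rw [h1]
      ring)
  have hξ0 : ∀ q ∈ B, pd 0 ξ q = 0 := fun q hq => neg_eq_zero.1 (e1 q hq).1
  have hξ11 : ∀ q ∈ B, pd 1 (pd 1 ξ) q = 0 := fun q hq => by simpa using (e1 q hq).2
  have hξ10 : ∀ q ∈ B, pd 0 (pd 1 ξ) q = 0 := fun q hq =>
    (pd_comm sξ hB hq 0 1).trans (pd_eq_zero_of_eq_const hB hξ0 1 hq)
  have dη1 : ∀ q ∈ B, pd 1 η q = 0 := fun q hq => by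
    rw [dη 1 q hq, (hmix q hq).1, hξ11 q hq]; simp
  have hτ00 : ∀ q ∈ B, pd 0 (pd 0 τ) q = 0 := fun q hq => by
    have h1 := (h q hq).2.2.2.2
    rw [pd_eq_zero_of_eq_const hB dη1 1 hq, dη 0 q hq, hξ10 q hq] at h1
    linear_combination -h1
  obtain ⟨c, d, hcd⟩ := exists_affine_time hB hc sτ (fun q hq => (h q hq).1.1)
    (fun q hq => (h q hq).1.2.1) hτ00
  obtain ⟨k, m, n, hkmn⟩ := exists_quadratic_space hB hc sξ hξ0 (fun q hq => (h q hq).1.2.2)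
    (fun q hq => pd_eq_zero_of_eq_const hB hξ11 1 hq)
  obtain ⟨q₀, hq₀⟩ := hne
  have hk : k = 0 := (hkmn q₀ hq₀).1.symm.trans (hξ11 q₀ hq₀)
  subst hk
  refine ⟨c, d, m, n, fun q hq => ⟨(hcd q hq).2, by simpa using (hkmn q hq).2.2, ?_⟩⟩
  rw [hη q hq, (hcd q hq).1, (hkmn q hq).2.1]
  ring

/-- Solution of the determining equations when `η` vanishes. -/
theorem detW_generic (hB : IsOpen B) (hc : IsPreconnected B) (hf0 : ∀ q ∈ B, f (q 2) ≠ 0)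
    (sτ : ContDiffOn ℝ ∞ τ B) (sξ : ContDiffOn ℝ ∞ ξ B) (hη : ∀ q ∈ B, η q = 0)
    (hne : B.Nonempty) (h : ∀ q ∈ B, DetW f τ ξ η q) :
    ∃ c d n, ∀ q ∈ B, τ q = 2 * c * q 0 + d ∧ ξ q = c * q 1 + n ∧ η q = 0 := by
  have hmix := detW_mixed hB sτ sξ h
  have hρ : ∀ q ∈ B, pd 0 τ q = 2 * pd 1 ξ q := fun q hq => by
    have h1 := (h q hq).2.1
    rw [hη q hq, mul_zero] at h1
    linarith [(mul_eq_zero.1 h1.symm).resolve_left (hf0 q hq)]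
  have s1 := sξ.pd hB 1
  have hξ11 : ∀ q ∈ B, pd 1 (pd 1 ξ) q = 0 := fun q hq => by
    have := (((s1.hasPD hB hq 1).const_mul 2).congr_on hB hq hρ).pd_eq
    rw [(hmix q hq).1] at this
    linarith
  have d1 : ∀ q ∈ B, pd 1 η q = 0 := fun q hq => pd_eq_zero_of_eq_const hB hη 1 hq
  have d2 : ∀ q ∈ B, pd 2 η q = 0 := fun q hq => pd_eq_zero_of_eq_const hB hη 2 hq
  have hξ0 : ∀ q ∈ B, pd 0 ξ q = 0 := fun q hq => by
    have h1 := (h q hq).2.2.2.1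
    rw [hξ11 q hq, d1 q hq, pd_eq_zero_of_eq_const hB d2 1 hq] at h1
    linarith
  have hτ00 : ∀ q ∈ B, pd 0 (pd 0 τ) q = 0 := fun q hq => by
    rw [(((s1.hasPD hB hq 0).const_mul 2).congr_on hB hq hρ).pd_eq, pd_comm sξ hB hq 0 1,
      pd_eq_zero_of_eq_const hB hξ0 1 hq, mul_zero]
  obtain ⟨c, d, hcd⟩ := exists_affine_time hB hc sτ (fun q hq => (h q hq).1.1)
    (fun q hq => (h q hq).1.2.1) hτ00
  obtain ⟨k, m, n, hkmn⟩ := exists_quadratic_space hB hc sξ hξ0 (fun q hq => (h q hq).1.2.2)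
    (fun q hq => pd_eq_zero_of_eq_const hB hξ11 1 hq)
  obtain ⟨q₀, hq₀⟩ := hne
  have hk : k = 0 := (hkmn q₀ hq₀).1.symm.trans (hξ11 q₀ hq₀)
  subst hk
  have hm : c = 2 * m := by
    have := hρ q₀ hq₀
    rw [(hcd q₀ hq₀).1, (hkmn q₀ hq₀).2.1] at this
    linarith
  exact ⟨m, d, n, fun q hq => ⟨hm ▸ (hcd q hq).2, by simpa using (hkmn q hq).2.2, hη q hq⟩⟩

end DeterminingW

/-! ### The heat equation, and the first class for generic K. -/

section RowsW

variable {B : Set (Fin 3 → ℝ)} {X : VField} {W U : Set ℝ} {K f : ℝ → ℝ} {S : Set (ℝ × ℝ)}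
  {τ ξ η b : (Fin 3 → ℝ) → ℝ} {G : ℝ × ℝ → ℝ}

/-- For f = 1 the equations are ξ_v = τ_t/2, η_vw = −ξ_t/2, η_ww = 0 and η_t = η_vv. The function
η_w again solves the heat equation, so both of its first derivatives are known. Their compatibility
gives ξ_tt = 0, hence τ_ttt = 0, and τ, ξ, η_w are polynomials with finitely many free constants. -/
theorem detW_heat (hB : IsOpen B) (hc : IsPreconnected B) (hf1 : ∀ q ∈ B, f (q 2) = 1)
    (hf0 : ∀ q ∈ B, deriv f (q 2) = 0) (sτ : ContDiffOn ℝ ∞ τ B) (sξ : ContDiffOn ℝ ∞ ξ B)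
    (sη : ContDiffOn ℝ ∞ η B) (h : ∀ q ∈ B, DetW f τ ξ η q) :
    ∃ k₀ k₁ k₂ m n a₀, ∀ q ∈ B, τ q = k₂ / 2 * q 0 ^ 2 + k₁ * q 0 + k₀ ∧
      ξ q = m * q 0 + k₁ / 2 * q 1 + k₂ / 2 * (q 0 * q 1) + n ∧
      pd 2 η q = a₀ - k₂ / 4 * q 0 - m / 2 * q 1 - k₂ / 8 * q 1 ^ 2 ∧
      pd 0 (pd 2 η) q = pd 1 (pd 1 (pd 2 η)) q := by
  have hmix := detW_mixed hB sτ sξ h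
  have s0 := sτ.pd hB 0
  have s1 := sξ.pd hB 1
  have sx0 := sξ.pd hB 0
  have sa := sη.pd hB 2
  have hρ : ∀ q ∈ B, pd 1 ξ q = 1 / 2 * pd 0 τ q := fun q hq => by
    have h1 := (h q hq).2.1
    rw [hf1 q hq, hf0 q hq] at h1
    linarith
  have hρi : ∀ i, ∀ q ∈ B, pd i (pd 1 ξ) q = 1 / 2 * pd i (pd 0 τ) q := fun i q hq =>
    (((s0.hasPD hB hq i).const_mul (1 / 2)).congr_on hB hq hρ).pd_eq
  have a1 : ∀ q ∈ B, pd 1 (pd 2 η) q = -1 / 2 * pd 0 ξ q := fun q hq => by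
    have h1 := (h q hq).2.2.2.1
    rw [hf1 q hq, hf0 q hq, hρi 1 q hq, (hmix q hq).1] at h1
    linarith
  have a2 : ∀ q ∈ B, pd 2 (pd 2 η) q = 0 := fun q hq => (h q hq).2.2.1
  have x01 : ∀ q ∈ B, pd 1 (pd 0 ξ) q = 1 / 2 * pd 0 (pd 0 τ) q := fun q hq =>
    (pd_comm sξ hB hq 1 0).trans (hρi 0 q hq)
  have a11 : ∀ q ∈ B, pd 1 (pd 1 (pd 2 η)) q = -1 / 4 * pd 0 (pd 0 τ) q := fun q hq => by
    rw [(((sx0.hasPD hB hq 1).const_mul (-1 / 2)).congr_on hB hq a1).pd_eq, x01 q hq]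
    ring
  have a0' : ∀ q ∈ B, pd 0 (pd 2 η) q = pd 1 (pd 1 (pd 2 η)) q := fun q hq => by
    have h1 : ∀ q ∈ B, pd 0 η q = pd 1 (pd 1 η) q := fun q hq => by
      have := (h q hq).2.2.2.2
      rwa [hf1 q hq, one_mul] at this
    rw [pd_comm sη hB hq 0 2, pd_congr hB hq h1, pd_comm (sη.pd hB 1) hB hq 2 1]
    exact pd_congr hB hq fun q hq => pd_comm sη hB hq 2 1
  have a0 : ∀ q ∈ B, pd 0 (pd 2 η) q = -1 / 4 * pd 0 (pd 0 τ) q := fun q hq =>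
    (a0' q hq).trans (a11 q hq)
  have t001 : ∀ q ∈ B, pd 1 (pd 0 (pd 0 τ)) q = 0 := fun q hq =>
    (pd_comm s0 hB hq 1 0).trans (pd_eq_zero_of_eq_const hB (fun q hq => (hmix q hq).1) 0 hq)
  have t002 : ∀ q ∈ B, pd 2 (pd 0 (pd 0 τ)) q = 0 := fun q hq =>
    (pd_comm s0 hB hq 2 0).trans (pd_eq_zero_of_eq_const hB (fun q hq => (hmix q hq).2.1) 0 hq)
  -- The derivative of η_w in t and v is computed twice: from η_vw it is −ξ_tt/2, and from η_wt it
  -- is −τ_ttv/4 = 0.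
  have x00 : ∀ q ∈ B, pd 0 (pd 0 ξ) q = 0 := fun q hq => by
    have e1 := (((sx0.hasPD hB hq 0).const_mul (-1 / 2)).congr_on hB hq a1).pd_eq
    have e2 := ((((s0.pd hB 0).hasPD hB hq 1).const_mul (-1 / 4)).congr_on hB hq a0).pd_eq
    rw [t001 q hq] at e2
    rw [pd_comm sa hB hq 0 1] at e1
    linarith
  have t000 : ∀ q ∈ B, pd 0 (pd 0 (pd 0 τ)) q = 0 := fun q hq => by
    have e1 := ((((s0.pd hB 0).hasPD hB hq 0).const_mul (1 / 2)).congr_on hB hq x01).pd_eq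
    have e2 := (pd_comm sx0 hB hq 0 1).trans (pd_eq_zero_of_eq_const hB x00 1 hq)
    linarith
  obtain ⟨k₂, hk2⟩ := exists_eq_const hB hc (s0.pd hB 0) t000 t001 t002
  obtain ⟨k₁, hk1⟩ := exists_affine_of_pd hB hc s0 k₂ 0 0 hk2 (fun q hq => (hmix q hq).1)
    (fun q hq => (hmix q hq).2.1)
  obtain ⟨k₀, hk0⟩ := exists_quadratic_of_pd hB hc sτ ![k₁, 0, 0]
    (fun i j => if i = 0 then if j = 0 then k₂ else 0 else 0) (by
      intro i j; fin_cases i <;> fin_cases j <;> rfl) (by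
      intro i q hq
      rw [Fin.sum_univ_three]
      fin_cases i
      · have := hk1 q hq
        simp
        linear_combination this
      · simpa using (h q hq).1.1
      · simpa using (h q hq).1.2.1)
  obtain ⟨m, hm⟩ := exists_affine_of_pd hB hc sx0 0 (1 / 2 * k₂) 0 x00
    (fun q hq => by rw [x01 q hq, hk2 q hq]) (fun q hq => (hmix q hq).2.2.1)
  obtain ⟨n, hn⟩ := exists_quadratic_of_pd hB hc sξ ![m, k₁ / 2, 0]
    (fun i j => if i = 0 then if j = 1 then k₂ / 2 else 0 else
      if i = 1 then if j = 0 then k₂ / 2 else 0 else 0) (by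
      intro i j; fin_cases i <;> fin_cases j <;> rfl) (by
      intro i q hq
      rw [Fin.sum_univ_three]
      fin_cases i
      · have := hm q hq
        simp
        linear_combination this
      · have := hk1 q hq
        have e := hρ q hq
        simp
        linear_combination e + 1 / 2 * this
      · simpa using (h q hq).1.2.2)
  obtain ⟨a₀, ha⟩ := exists_quadratic_of_pd hB hc sa ![-k₂ / 4, -m / 2, 0]
    (fun i j => if i = 1 then if j = 1 then -k₂ / 4 else 0 else 0) (by
      intro i j; fin_cases i <;> fin_cases j <;> rfl) (by
      intro i q hq
      rw [Fin.sum_univ_three]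
      fin_cases i
      · have := hk2 q hq
        have e := a0 q hq
        simp
        linear_combination e - 1 / 4 * this
      · have := hm q hq
        have e := a1 q hq
        simp
        linear_combination e - 1 / 2 * this
      · simpa using (h q hq).2.2.1)
  refine ⟨k₀, k₁, k₂, m, n, a₀, fun q hq => ⟨?_, ?_, ?_, a0' q hq⟩⟩
  · have := hk0 q hq
    simp at this
    linear_combination this
  · have := hn q hq
    simp at this
    linear_combination this
  · have := ha q hq
    simp at this
    linear_combination this

theorem pd_slice (G : ℝ × ℝ → ℝ) :
    (pd 0 (fun q => G (q 0, q 1)) = fun q => lineDeriv ℝ G (q 0, q 1) (1, 0)) ∧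
    (pd 1 (fun q => G (q 0, q 1)) = fun q => lineDeriv ℝ G (q 0, q 1) (0, 1)) ∧
    pd 2 (fun q => G (q 0, q 1)) = fun _ => 0 := by
  refine ⟨?_, ?_, ?_⟩ <;> funext q <;> simp [pd, lineDeriv]

theorem contDiffOn_slice (hG : ContDiffOn ℝ ∞ G S) (hB : ∀ q ∈ B, (q 0, q 1) ∈ S) :
    ContDiffOn ℝ ∞ (fun q : Fin 3 → ℝ => G (q 0, q 1)) B := by
  refine hG.comp (f := fun q : Fin 3 → ℝ => (q 0, q 1)) (ContDiff.contDiffOn ?_) hB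
  fun_prop

theorem contDiffOn_of_components (h0 : ContDiffOn ℝ ∞ (fun q => X q 0) B)
    (h1 : ContDiffOn ℝ ∞ (fun q => X q 1) B) (h2 : ContDiffOn ℝ ∞ (fun q => X q 2) B) :
    ContDiffOn ℝ ∞ X B := by
  rw [contDiffOn_pi]
  intro k
  fin_cases k
  · exact h0
  · exact h1
  · exact h2

theorem isPointSymmetry_pdeW_of_polynomial (hU : IsOpen U) (hK : ContDiffOn ℝ ∞ K U)
    (hK0 : ∀ u ∈ U, K u ≠ 0) (hS : IsOpen S) (hb : ContDiffOn ℝ ∞ b (domW S U))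
    (hb2 : ∀ q ∈ domW S U, pd 2 b q = 0) (c x a : Fin 5 → ℝ)
    (hX : ∀ q ∈ domW S U, X q = ![c 0 + c 1 * q 0 + c 2 * (q 0 * q 0),
      x 0 + x 1 * q 1 + x 2 * q 0 + x 3 * (q 0 * q 1) + x 4 * (q 1 * q 1),
      (a 0 + a 1 * q 0 + a 2 * q 1 + a 3 * (q 1 * q 1)) * q 2 + b q])
    (h1 : ∀ q ∈ domW S U, deriv (diffW K) (q 2) *
        ((a 0 + a 1 * q 0 + a 2 * q 1 + a 3 * q 1 ^ 2) * q 2 + b q)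
      = diffW K (q 2) * (2 * (x 1 + x 3 * q 0 + 2 * x 4 * q 1) - (c 1 + 2 * c 2 * q 0)))
    (h2 : ∀ q ∈ domW S U, -(x 2 + x 3 * q 1)
      = diffW K (q 2) * (2 * (a 2 + 2 * a 3 * q 1) - 2 * x 4)
        + 2 * deriv (diffW K) (q 2) * ((a 2 + 2 * a 3 * q 1) * q 2 + pd 1 b q))
    (h3 : ∀ q ∈ domW S U, a 1 * q 2 + pd 0 b q
      = diffW K (q 2) * (2 * a 3 * q 2 + pd 1 (pd 1 b) q)) :
    IsPointSymmetry (pdeW K) (domW S U) X := by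
  have hB := isOpen_domW hS hU
  refine (isPointSymmetry_pdeW_iff (isOpen_wRange hU) (contDiffOn_diffW hK) (diffW_ne_zero hK0) hB
    (fun q hq => hq.2)).2 ⟨?_, ?_⟩
  · refine contDiffOn_of_components ?_ ?_ ?_
    · refine ContDiffOn.congr (f := fun q => c 0 + c 1 * q 0 + c 2 * (q 0 * q 0)) (by fun_prop)
        fun q hq => ?_
      rw [hX q hq]; rfl
    · refine ContDiffOn.congr (f := fun q => x 0 + x 1 * q 1 + x 2 * q 0 + x 3 * (q 0 * q 1)
        + x 4 * (q 1 * q 1)) (by fun_prop) fun q hq => ?_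
      rw [hX q hq]; rfl
    · refine ContDiffOn.congr (f := fun q => (a 0 + a 1 * q 0 + a 2 * q 1 + a 3 * (q 1 * q 1)) * q 2
        + b q) (by fun_prop) fun q hq => ?_
      rw [hX q hq]; rfl
  · exact detW_of_polynomial hB hb hb2 c x a (fun q hq => by rw [hX q hq]; rfl)
      (fun q hq => by rw [hX q hq]; rfl) (fun q hq => by rw [hX q hq]; rfl) h1 h2 h3

theorem pd_const (i : Fin 3) (r : ℝ) : pd i (fun _ => r) = fun _ => 0 :=
  funext fun _ => (HasPD.const r).pd_eq

theorem isPointSymmetry_pdeW_three (hU : IsOpen U) (hK : ContDiffOn ℝ ∞ K U)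
    (hK0 : ∀ u ∈ U, K u ≠ 0) (hS : IsOpen S) (c d n : ℝ)
    (hX : ∀ q ∈ domW S U, X q = ![2 * c * q 0 + d, c * q 1 + n, 0]) :
    IsPointSymmetry (pdeW K) (domW S U) X := by
  refine isPointSymmetry_pdeW_of_polynomial hU hK hK0 hS (b := fun _ => 0) contDiffOn_const
    (fun _ _ => by rw [pd_const]) ![d, 2 * c, 0, 0, 0] ![n, c, 0, 0, 0] ![0, 0, 0, 0, 0]
    (fun q hq => ?_) ?_ ?_ ?_
  · rw [hX q hq]
    ext i
    fin_cases i <;> simp <;> ring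
  all_goals intro q hq; simp [pd_const]

/-- Transport of the determining equations to `domW`. -/
theorem IsPointSymmetry.detW (hU : IsOpen U) (hK : ContDiffOn ℝ ∞ K U) (hK0 : ∀ u ∈ U, K u ≠ 0)
    (hS : IsOpen S) (h : IsPointSymmetry (pdeW K) (domW S U) X) : ∀ q ∈ domW S U,
      DetW (diffW K) (fun q => X q 0) (fun q => X q 1) (fun q => X q 2) q :=
  ((isPointSymmetry_pdeW_iff (isOpen_wRange hU) (contDiffOn_diffW hK) (diffW_ne_zero hK0)
    (isOpen_domW hS hU) (fun _ hq => hq.2)).1 h).2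

theorem isPointSymmetry_V_basic (hU : IsOpen U) (hK : ContDiffOn ℝ ∞ K U)
    (hK0 : ∀ u ∈ U, K u ≠ 0) (hS : IsOpen S) (i : Fin 3) :
    IsPointSymmetry (pdeW K) (domW S U) (![V₁, V₂, V₃] i) := by
  fin_cases i
  · exact isPointSymmetry_pdeW_three hU hK hK0 hS 0 1 0 (fun q _ => by simp [V₁])
  · exact isPointSymmetry_pdeW_three hU hK hK0 hS 0 0 1 (fun q _ => by simp [V₂])
  · exact isPointSymmetry_pdeW_three hU hK hK0 hS 1 0 0 (fun q _ => by simp [V₃])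

theorem symmetryAlgebraIs_generic (hK : IsConstitutive U K) (h0 : 0 ∉ U) (hS : IsOpen S)
    (hSc : IsConnected S)
    (hspec : ¬ ∃ (a₁ a₂ a₃ a₄ a₅ a₆ : ℝ) (U' : Set ℝ) (K' : ℝ → ℝ),
      EquivW a₁ a₂ a₃ a₄ a₅ a₆ U K U' K' ∧ ((∃ μ : ℝ, IsPower μ U' K') ∨ IsExpInv U' K')) :
    SymmetryAlgebraIs (pdeW K) (domW S U) ![V₁, V₂, V₃] := by
  obtain ⟨hU, hKs, hK0⟩ := hK
  have hW := isOpen_wRange hU.1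
  have hWc := isPreconnected_wRange h0 hU.2.2
  have hB := isOpen_domW hS hU.1
  have hc := isPreconnected_domW hSc.isPreconnected hWc
  have hne := nonempty_domW hSc.nonempty (nonempty_wRange h0 hU.2.1)
  have hf := contDiffOn_diffW hKs
  have hf0 := diffW_ne_zero hK0
  refine symmetryAlgebraIs_of_iff (fun X => ⟨fun h => ?_, fun ⟨c, hX⟩ => ?_⟩) fun c hX => ?_
  · have hdet := h.detW hU.1 hKs hK0 hS
    have sτ := h.1.comp_apply 0
    have sξ := h.1.comp_apply 1
    have sη := h.1.comp_apply 2
    have hmix := detW_mixed hB sτ sξ hdet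
    have hη : ∀ q ∈ domW S U, X q 2 = 0 := by
      intro q hq
      have hm : ∀ w ∈ wRange U, ![q 0, q 1, w] ∈ domW S U := fun w hw => ⟨hq.1, hw⟩
      have hq3 : q = ![q 0, q 1, q 2] := by ext k; fin_cases k <;> rfl
      by_contra hcon
      -- Along the w-fibre through q, η equals a w + b with a = η_w and b = η − w η_w, both free of
      -- w, and 2ξ_v − τ_t is free of w as well. The first determining equation is thus f' (a w + b)
      -- = r f. The coefficients a and b do not both vanish, since η(q) ≠ 0.
      refine hspec (exists_equivW_of_ode hU h0 hf hf0 (a := pd 2 (fun q => X q 2) q)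
        (b := X q 2 - pd 2 (fun q => X q 2) q * q 2)
        (r := 2 * pd 1 (fun q => X q 1) q - pd 0 (fun q => X q 0) q) ?_ ?_)
      · intro w hw
        have e1 := (hdet _ (hm w hw)).2.1
        have sa := sη.pd hB 2
        have f1 := eq_of_pd_two_eq_zero hB sa (fun q hq => (hdet q hq).2.2.1) hW hWc hm hw hq.2
        have f2 := eq_of_pd_two_eq_zero hB (g := fun q => X q 2 - pd 2 (fun q => X q 2) q * q 2)
          (by fun_prop) (fun q hq => by
            rw [((sη.hasPD hB hq 2).sub ((sa.hasPD hB hq 2).mul (HasPD.coord 2 2 q))).pd_eq,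
              (hdet q hq).2.2.1]
            simp) hW hWc hm hw hq.2
        have s1 := sξ.pd hB 1
        have s0 := sτ.pd hB 0
        have f3 := eq_of_pd_two_eq_zero hB (g := fun q => 2 * pd 1 (fun q => X q 1) q
          - pd 0 (fun q => X q 0) q) (by fun_prop) (fun q hq => by
            rw [(((s1.hasPD hB hq 2).const_mul 2).sub (s0.hasPD hB hq 2)).pd_eq,
              (hmix q hq).2.1, (hmix q hq).2.2.2.1]
            simp) hW hWc hm hw hq.2
        rw [← hq3] at f1 f2 f3
        simp only [Matrix.cons_val] at e1 f1 f2 f3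
        rw [← f3, ← f2, ← e1, ← f1]
        ring
      · rintro ⟨ha, hb, -⟩
        rw [ha] at hb
        exact hcon (by linarith)
    obtain ⟨c, d, n, hcdn⟩ := detW_generic hB hc (fun q hq => hf0 _ hq.2) sτ sξ hη hne hdet
    refine ⟨![d, n, c], fun q hq => ?_⟩
    obtain ⟨e1, e2, e3⟩ := hcdn q hq
    ext k
    fin_cases k <;> simp [Fin.sum_univ_succ, V₁, V₂, V₃, e1, e2, e3] <;> ring
  · refine isPointSymmetry_pdeW_three hU.1 hKs hK0 hS (c 2) (c 0) (c 1) fun q hq => ?_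
    rw [hX q hq]
    ext k
    fin_cases k <;> simp [Fin.sum_univ_succ, V₁, V₂, V₃] <;> ring
  · obtain ⟨q, hq⟩ := hne
    have key : ∀ q ∈ domW S U, c 0 + c 2 * (2 * q 0) = 0 ∧ c 1 + c 2 * q 1 = 0 := fun q hq => by
      have := hX q hq
      have h0 := congrFun this 0
      have h1 := congrFun this 1
      simp [Fin.sum_univ_succ, V₁, V₂, V₃] at h0 h1
      exact ⟨h0, h1⟩
    obtain ⟨l0, l1, -⟩ := line_coeff_eq_zero hB hq 1 (c0 := c 1 + c 2 * q 1) (c1 := c 2) (c2 := 0)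
      (fun s hs => by
        have := (key _ hs).2
        simp at this
        linear_combination this)
    have l2 := (key q hq).1
    rw [l1] at l0 l2
    intro i
    fin_cases i
    · simpa using l2
    · simpa using l0
    · exact l1

end RowsW

/-! ### The special rows of the first class. -/

section SpecialRowsW

variable {B : Set (Fin 3 → ℝ)} {X : VField} {W U : Set ℝ} {K f : ℝ → ℝ} {S : Set (ℝ × ℝ)}
  {G : ℝ × ℝ → ℝ} {μ : ℝ}

theorem IsPower.contDiffOn (h : IsPower μ U K) : ContDiffOn ℝ ∞ K U := by
  have h1 : ContDiffOn ℝ ∞ (fun u : ℝ => u ^ μ) U := fun u hu =>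
    (Real.contDiffAt_rpow_const_of_ne (h.1 hu).ne').contDiffWithinAt
  exact h1.congr h.2

theorem IsPower.ne_zero (h : IsPower μ U K) : ∀ u ∈ U, K u ≠ 0 := fun u hu => by
  rw [h.2 u hu]; exact (Real.rpow_pos_of_pos (h.1 hu) μ).ne'

theorem IsExpInv.contDiffOn (h0 : 0 ∉ U) (h : IsExpInv U K) : ContDiffOn ℝ ∞ K U := by
  have hu0 : ∀ u ∈ U, u ≠ 0 := fun u hu h' => h0 (h' ▸ hu)
  have h1 : ContDiffOn ℝ ∞ (fun u : ℝ => Real.exp (1 / u) * (u ^ 2)⁻¹) U :=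
    (Real.contDiff_exp.comp_contDiffOn (contDiffOn_const.div contDiffOn_id hu0)).mul
      ((contDiffOn_id.pow 2).inv fun u hu => pow_ne_zero 2 (hu0 u hu))
  exact h1.congr h

theorem IsExpInv.ne_zero (h0 : 0 ∉ U) (h : IsExpInv U K) : ∀ u ∈ U, K u ≠ 0 := fun u hu => by
  have hu0 : u ≠ 0 := fun h' => h0 (h' ▸ hu)
  rw [h u hu]; exact mul_ne_zero (Real.exp_ne_zero _) (inv_ne_zero (pow_ne_zero 2 hu0))

theorem IsPower.deriv_diffW_mul (hU : IsOpen U) (h : IsPower μ U K) {w : ℝ} (hw : w ∈ wRange U) :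
    deriv (diffW K) w * w = -(μ + 2) * diffW K w := by
  obtain ⟨hw0, e⟩ := h.diffW_eq hw
  rw [(h.hasDerivAt_diffW (isOpen_wRange hU) hw).deriv, e, Real.rpow_sub_one hw0.ne']
  field_simp

theorem IsExpInv.deriv_diffW (hU : IsOpen U) (h : IsExpInv U K) {w : ℝ} (hw : w ∈ wRange U) :
    deriv (diffW K) w = diffW K w := by
  rw [(h.hasDerivAt_diffW (isOpen_wRange hU) hw).deriv, h.diffW_eq hw]

theorem isPointSymmetry_pdeW_power (hU : IsOpen U) (hS : IsOpen S) (h : IsPower μ U K)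
    (c₁ c₂ c₃ c₄ : ℝ) (hX : ∀ q ∈ domW S U, X q =
      ![c₁ + 2 * c₃ * q 0, c₂ + (c₃ + (2 + μ) * c₄) * q 1, -2 * c₄ * q 2]) :
    IsPointSymmetry (pdeW K) (domW S U) X := by
  refine isPointSymmetry_pdeW_of_polynomial hU h.contDiffOn h.ne_zero hS (b := fun _ => 0)
    contDiffOn_const (fun _ _ => by rw [pd_const]) ![c₁, 2 * c₃, 0, 0, 0]
    ![c₂, c₃ + (2 + μ) * c₄, 0, 0, 0] ![-2 * c₄, 0, 0, 0, 0] (fun q hq => ?_) ?_ ?_ ?_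
  · rw [hX q hq]
    ext i
    fin_cases i <;> simp
  · intro q hq
    have := h.deriv_diffW_mul hU hq.2
    simp
    linear_combination -2 * c₄ * this
  all_goals intro q hq; simp [pd_const]

theorem isPointSymmetry_pdeW_power_special (hU : IsOpen U) (hS : IsOpen S)
    (h : IsPower (-2 / 3) U K) (c₁ c₂ c₃ c₄ c₅ : ℝ) (hX : ∀ q ∈ domW S U, X q =
      ![c₁ + 2 * c₃ * q 0, c₂ + (c₃ + 4 / 3 * c₄) * q 1 - c₅ * q 1 ^ 2,
        (-2 * c₄ + 3 * c₅ * q 1) * q 2]) :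
    IsPointSymmetry (pdeW K) (domW S U) X := by
  refine isPointSymmetry_pdeW_of_polynomial hU h.contDiffOn h.ne_zero hS (b := fun _ => 0)
    contDiffOn_const (fun _ _ => by rw [pd_const]) ![c₁, 2 * c₃, 0, 0, 0]
    ![c₂, c₃ + 4 / 3 * c₄, 0, 0, -c₅] ![-2 * c₄, 0, 3 * c₅, 0, 0] (fun q hq => ?_) ?_ ?_ ?_
  · rw [hX q hq]
    ext i
    fin_cases i <;> simp
    ring
  · intro q hq
    have := h.deriv_diffW_mul hU hq.2
    simp
    linear_combination (-2 * c₄ + 3 * c₅ * q 1) * this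
  · intro q hq
    have := h.deriv_diffW_mul hU hq.2
    simp [pd_const]
    linear_combination -6 * c₅ * this
  · intro q hq; simp [pd_const]

theorem isPointSymmetry_pdeW_expInv (hU : IsOpen U) (h0 : 0 ∉ U) (hS : IsOpen S)
    (h : IsExpInv U K) (c₁ c₂ c₃ c₈ : ℝ) (hX : ∀ q ∈ domW S U, X q =
      ![c₁ + 2 * c₃ * q 0, c₂ + (c₃ + c₈) * q 1, 2 * c₈]) :
    IsPointSymmetry (pdeW K) (domW S U) X := by
  refine isPointSymmetry_pdeW_of_polynomial hU (h.contDiffOn h0) (h.ne_zero h0) hS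
    (b := fun _ => 2 * c₈) contDiffOn_const (fun _ _ => by rw [pd_const]) ![c₁, 2 * c₃, 0, 0, 0]
    ![c₂, c₃ + c₈, 0, 0, 0] ![0, 0, 0, 0, 0] (fun q hq => ?_) ?_ ?_ ?_
  · rw [hX q hq]
    ext i
    fin_cases i <;> simp
  · intro q hq
    have := h.deriv_diffW hU hq.2
    simp
    linear_combination 2 * c₈ * this
  all_goals intro q hq; simp [pd_const]

theorem isPointSymmetry_pdeW_heat (hU : IsOpen U) (hS : IsOpen S) (h : IsPower (-2) U K)
    (hG : IsHeatSolution S G) (c₁ c₂ c₃ c₄ c₆ c₇ : ℝ) (hX : ∀ q ∈ domW S U, X q =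
      ![c₁ + 2 * c₃ * q 0 + 4 * c₇ * q 0 ^ 2, c₂ + c₃ * q 1 + 2 * c₆ * q 0 + 4 * c₇ * (q 0 * q 1),
        (-2 * c₄ - c₆ * q 1 - c₇ * (2 * q 0 + q 1 ^ 2)) * q 2 + G (q 0, q 1)]) :
    IsPointSymmetry (pdeW K) (domW S U) X := by
  have hf : ∀ w ∈ wRange U, diffW K w = 1 := fun w hw => by simpa using (h.diffW_eq hw).2
  have hf' : ∀ w ∈ wRange U, deriv (diffW K) w = 0 := fun w hw => by
    have := h.deriv_diffW_mul hU hw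
    simpa [hw.1] using this
  obtain ⟨p0, p1, p2⟩ := pd_slice G
  refine isPointSymmetry_pdeW_of_polynomial hU h.contDiffOn h.ne_zero hS
    (b := fun q => G (q 0, q 1)) (contDiffOn_slice hG.1 fun q hq => hq.1)
    (fun _ _ => by rw [p2]) ![c₁, 2 * c₃, 4 * c₇, 0, 0]
    ![c₂, c₃, 2 * c₆, 4 * c₇, 0] ![-2 * c₄, -2 * c₇, -c₆, -c₇, 0] (fun q hq => ?_) ?_ ?_ ?_
  · rw [hX q hq]
    ext i
    fin_cases i <;> simp [-mul_eq_mul_left_iff, -mul_eq_mul_right_iff] <;> ring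
  · intro q hq
    simp [hf _ hq.2, hf' _ hq.2]
    ring
  · intro q hq
    simp [hf _ hq.2, hf' _ hq.2]
    ring
  · intro q hq
    rw [p0, p1, (pd_slice fun r => lineDeriv ℝ G r (0, 1)).2.1]
    simp [hf _ hq.2, hG.2 _ hq.1]

theorem symmetryAlgebraIs_power (hU : IsOpenInterval U) (h0 : 0 ∉ U) (hS : IsOpen S)
    (hSc : IsConnected S) (h1 : μ ≠ -2 / 3) (h2 : μ ≠ -2) (h : IsPower μ U K) :
    SymmetryAlgebraIs (pdeW K) (domW S U) ![V₁, V₂, V₃, V₄ μ] := by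
  have hW := isOpen_wRange hU.1
  have hB := isOpen_domW hS hU.1
  have hc := isPreconnected_domW hSc.isPreconnected (isPreconnected_wRange h0 hU.2.2)
  have hne := nonempty_domW hSc.nonempty (nonempty_wRange h0 hU.2.1)
  have hσ : -(μ + 2) ≠ 0 := fun h' => h2 (by linarith)
  refine symmetryAlgebraIs_of_iff (fun X => ⟨fun hX => ?_, fun ⟨c, hX⟩ => ?_⟩) fun c hX => ?_
  · obtain ⟨c, d, k, m, n, hk, hcd⟩ := detW_power hB hc hW (contDiffOn_diffW h.contDiffOn)
      (diffW_ne_zero h.ne_zero) (fun q hq => hq.2) (hX.1.comp_apply 0) (hX.1.comp_apply 1) hσ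
      (fun w hw => h.deriv_diffW_mul hU.1 hw) hne (hX.detW hU.1 h.contDiffOn h.ne_zero hS)
    have hk : k = 0 := (mul_eq_zero.1 hk).resolve_left fun h' => h1 (by linarith)
    subst hk
    -- The t-component gives 2c₃ = c and the v-component gives c₃ + (2 + μ)c₄ = m, where cᵢ denotes
    -- the coefficient of Vᵢ.
    refine ⟨![d, n, c / 2, (m - c / 2) / (μ + 2)], fun q hq => ?_⟩
    obtain ⟨e1, e2, e3⟩ := hcd q hq
    have hμ : μ + 2 ≠ 0 := fun h' => hσ (by linarith)
    ext k
    fin_cases k <;> simp [Fin.sum_univ_succ, V₁, V₂, V₃, V₄, e1, e2, e3]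
    · ring
    · field_simp; ring
    · have : -2 + -μ = -(μ + 2) := by ring
      rw [this, div_neg]
      field_simp
  · refine isPointSymmetry_pdeW_power hU.1 hS h (c 0) (c 1) (c 2) (c 3) fun q hq => ?_
    rw [hX q hq]
    ext k
    fin_cases k <;> simp [Fin.sum_univ_succ, V₁, V₂, V₃, V₄] <;> ring
  · obtain ⟨q, hq⟩ := hne
    have key : ∀ q ∈ domW S U, c 0 + c 2 * (2 * q 0) = 0 ∧
        c 1 + (c 2 + c 3 * (2 + μ)) * q 1 = 0 ∧ c 3 = 0 := fun q hq => by
      have := hX q hq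
      have h0 := congrFun this 0
      have h1 := congrFun this 1
      have h2 := congrFun this 2
      simp [Fin.sum_univ_succ, V₁, V₂, V₃, V₄, hq.2.1] at h0 h1 h2
      exact ⟨h0, by linear_combination h1, h2⟩
    have l3 := (key q hq).2.2
    obtain ⟨l0, l1, -⟩ := line_coeff_eq_zero hB hq 1 (c0 := c 1 + c 2 * q 1) (c1 := c 2) (c2 := 0)
      (fun s hs => by
        have := (key _ hs).2.1
        simp [l3] at this
        linear_combination this)
    have l2 := (key q hq).1
    rw [l1] at l0 l2
    intro i
    fin_cases i
    · simpa using l2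
    · simpa using l0
    · exact l1
    · exact l3

theorem symmetryAlgebraIs_power_special (hU : IsOpenInterval U) (h0 : 0 ∉ U) (hS : IsOpen S)
    (hSc : IsConnected S) (h : IsPower (-2 / 3) U K) :
    SymmetryAlgebraIs (pdeW K) (domW S U) ![V₁, V₂, V₃, V₄ (-2 / 3), V₅] := by
  have hW := isOpen_wRange hU.1
  have hB := isOpen_domW hS hU.1
  have hc := isPreconnected_domW hSc.isPreconnected (isPreconnected_wRange h0 hU.2.2)
  have hne := nonempty_domW hSc.nonempty (nonempty_wRange h0 hU.2.1)
  refine symmetryAlgebraIs_of_iff (fun X => ⟨fun hX => ?_, fun ⟨c, hX⟩ => ?_⟩) fun c hX => ?_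
  · obtain ⟨c, d, k, m, n, -, hcd⟩ := detW_power hB hc hW (contDiffOn_diffW h.contDiffOn)
      (diffW_ne_zero h.ne_zero) (fun q hq => hq.2) (hX.1.comp_apply 0) (hX.1.comp_apply 1)
      (σ := -(-2 / 3 + 2)) (by norm_num)
      (fun w hw => h.deriv_diffW_mul hU.1 hw) hne (hX.detW hU.1 h.contDiffOn h.ne_zero hS)
    -- For μ = −2/3 one has 2 + μ = 4/3, and the quadratic term k v²/2 of ξ is matched with −v² in
    -- `V₅`.
    refine ⟨![d, n, c / 2, (m - c / 2) * (3 / 4), -k / 2], fun q hq => ?_⟩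
    obtain ⟨e1, e2, e3⟩ := hcd q hq
    ext k
    fin_cases k <;> simp [Fin.sum_univ_succ, V₁, V₂, V₃, V₄, V₅, e1, e2, e3] <;> ring
  · refine isPointSymmetry_pdeW_power_special hU.1 hS h (c 0) (c 1) (c 2) (c 3) (c 4) fun q hq => ?_
    rw [hX q hq]
    ext k
    fin_cases k <;> simp [Fin.sum_univ_succ, V₁, V₂, V₃, V₄, V₅] <;> ring
  · obtain ⟨q, hq⟩ := hne
    have key : ∀ q ∈ domW S U, c 0 + c 2 * (2 * q 0) = 0 ∧
        c 1 + (c 2 + c 3 * (4 / 3)) * q 1 - c 4 * q 1 ^ 2 = 0 ∧ -2 * c 3 + 3 * c 4 * q 1 = 0 :=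
      fun q hq => by
        have := hX q hq
        have h0 := congrFun this 0
        have h1 := congrFun this 1
        have h2 := congrFun this 2
        simp [Fin.sum_univ_succ, V₁, V₂, V₃, V₄, V₅] at h0 h1 h2
        refine ⟨h0, by linear_combination h1, ?_⟩
        have h3 : q 2 * (-2 * c 3 + 3 * c 4 * q 1) = 0 := by linear_combination h2
        exact (mul_eq_zero.1 h3).resolve_left hq.2.1
    obtain ⟨l3, l4, -⟩ := line_coeff_eq_zero hB hq 1 (c0 := -2 * c 3 + 3 * c 4 * q 1)
      (c1 := 3 * c 4) (c2 := 0) (fun s hs => by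
        have := (key _ hs).2.2
        simp at this
        linear_combination this)
    have l4 : c 4 = 0 := by linarith
    rw [l4] at l3
    have l3 : c 3 = 0 := by linarith
    obtain ⟨l0, l1, -⟩ := line_coeff_eq_zero hB hq 1 (c0 := c 1 + c 2 * q 1) (c1 := c 2) (c2 := 0)
      (fun s hs => by
        have := (key _ hs).2.1
        simp [l3, l4] at this
        linear_combination this)
    have l2 := (key q hq).1
    rw [l1] at l0 l2
    intro i
    fin_cases i
    · simpa using l2
    · simpa using l0
    · exact l1
    · exact l3
    · exact l4

theorem symmetryAlgebraIs_expInv (hU : IsOpenInterval U) (h0 : 0 ∉ U) (hS : IsOpen S)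
    (hSc : IsConnected S) (h : IsExpInv U K) :
    SymmetryAlgebraIs (pdeW K) (domW S U) ![V₁, V₂, V₃, V₈] := by
  have hW := isOpen_wRange hU.1
  have hB := isOpen_domW hS hU.1
  have hc := isPreconnected_domW hSc.isPreconnected (isPreconnected_wRange h0 hU.2.2)
  have hne := nonempty_domW hSc.nonempty (nonempty_wRange h0 hU.2.1)
  refine symmetryAlgebraIs_of_iff (fun X => ⟨fun hX => ?_, fun ⟨c, hX⟩ => ?_⟩) fun c hX => ?_
  · obtain ⟨c, d, m, n, hcd⟩ := detW_exp hB hc hW (contDiffOn_diffW (h.contDiffOn h0))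
      (diffW_ne_zero (h.ne_zero h0)) (fun q hq => hq.2) (hX.1.comp_apply 0) (hX.1.comp_apply 1)
      (fun w hw => h.deriv_diffW hU.1 hw) hne (hX.detW hU.1 (h.contDiffOn h0) (h.ne_zero h0) hS)
    refine ⟨![d, n, c / 2, m - c / 2], fun q hq => ?_⟩
    obtain ⟨e1, e2, e3⟩ := hcd q hq
    ext k
    fin_cases k <;> simp [Fin.sum_univ_succ, V₁, V₂, V₃, V₈, e1, e2, e3] <;> ring
  · refine isPointSymmetry_pdeW_expInv hU.1 h0 hS h (c 0) (c 1) (c 2) (c 3) fun q hq => ?_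
    rw [hX q hq]
    ext k
    fin_cases k <;> simp [Fin.sum_univ_succ, V₁, V₂, V₃, V₈] <;> ring
  · obtain ⟨q, hq⟩ := hne
    have key : ∀ q ∈ domW S U, c 0 + c 2 * (2 * q 0) = 0 ∧
        c 1 + (c 2 + c 3) * q 1 = 0 ∧ c 3 = 0 := fun q hq => by
      have := hX q hq
      have h0 := congrFun this 0
      have h1 := congrFun this 1
      have h2 := congrFun this 2
      simp [Fin.sum_univ_succ, V₁, V₂, V₃, V₈] at h0 h1 h2
      exact ⟨h0, by linear_combination h1, h2⟩
    have l3 := (key q hq).2.2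
    obtain ⟨l0, l1, -⟩ := line_coeff_eq_zero hB hq 1 (c0 := c 1 + c 2 * q 1) (c1 := c 2) (c2 := 0)
      (fun s hs => by
        have := (key _ hs).2.1
        simp [l3] at this
        linear_combination this)
    have l2 := (key q hq).1
    rw [l1] at l0 l2
    intro i
    fin_cases i
    · simpa using l2
    · simpa using l0
    · exact l1
    · exact l3

/-- Write η = η_w w + b. By `detW_heat` the slope η_w involves only finitely many constants, while b
is free of w. It solves the heat equation, because η and η_w both do; it supplies the field `VInf`.
-/
theorem isPointSymmetry_heat_iff (hU : IsOpenInterval U) (h0 : 0 ∉ U) (hS : IsOpen S)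
    (hSc : IsConnected S) (h : IsPower (-2) U K) (X : VField) :
    IsPointSymmetry (pdeW K) (domW S U) X ↔
      ∃ (c : Fin 6 → ℝ) (G : ℝ × ℝ → ℝ), IsHeatSolution S G ∧
        ∀ q ∈ domW S U,
          X q = ∑ i, c i • (![V₁, V₂, V₃, V₄ (-2), V₆, V₇] i : VField) q + VInf G q := by
  have hW := isOpen_wRange hU.1
  have hB := isOpen_domW hS hU.1
  have hWc := isPreconnected_wRange h0 hU.2.2
  have hc := isPreconnected_domW hSc.isPreconnected hWc
  obtain ⟨w₀, hw₀⟩ := nonempty_wRange h0 hU.2.1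
  refine ⟨fun hX => ?_, fun ⟨c, G, hG, hX⟩ => ?_⟩
  · have hf : ∀ w ∈ wRange U, diffW K w = 1 := fun w hw => by simpa using (h.diffW_eq hw).2
    have hf' : ∀ w ∈ wRange U, deriv (diffW K) w = 0 := fun w hw => by
      have := h.deriv_diffW_mul hU.1 hw
      simpa [hw.1] using this
    have hdet := hX.detW hU.1 h.contDiffOn h.ne_zero hS
    have sη := hX.1.comp_apply 2
    have sa := sη.pd hB 2
    obtain ⟨k₀, k₁, k₂, m, n, a₀, hk⟩ := detW_heat hB hc (fun q hq => hf _ hq.2)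
      (fun q hq => hf' _ hq.2) (hX.1.comp_apply 0) (hX.1.comp_apply 1) sη hdet
    set η : (Fin 3 → ℝ) → ℝ := fun q => X q 2 with hη
    set b : (Fin 3 → ℝ) → ℝ := fun q => η q - pd 2 η q * q 2 with hb
    have sb : ContDiffOn ℝ ∞ b (domW S U) := by fun_prop
    have db : ∀ i, ∀ q ∈ domW S U, pd i b q = pd i η q - (pd i (pd 2 η) q * q 2
        + pd 2 η q * (if i = 2 then 1 else 0)) := fun i q hq =>
      ((sη.hasPD hB hq i).sub ((sa.hasPD hB hq i).mul (HasPD.coord i 2 q))).pd_eq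
    have db2 : ∀ q ∈ domW S U, pd 2 b q = 0 := fun q hq => by
      rw [db 2 q hq, (hdet q hq).2.2.1]; simp
    have db11 : ∀ q ∈ domW S U, pd 1 (pd 1 b) q = pd 1 (pd 1 η) q - pd 1 (pd 1 (pd 2 η)) q * q 2 :=
      fun q hq => by
        rw [((((sη.pd hB 1).hasPD hB hq 1).sub (((sa.pd hB 1).hasPD hB hq 1).mul
          (HasPD.coord 1 2 q))).congr_on (g := pd 1 b) hB hq
            (fun q hq => by rw [db 1 q hq]; simp)).pd_eq]
        simp
    -- As b does not depend on w, its slice at a fixed value w₀ recovers it everywhere, the w-fibres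
    -- being connected.
    set G : ℝ × ℝ → ℝ := fun s => b ![s.1, s.2, w₀] with hGdef
    have hbG : ∀ q ∈ domW S U, b q = G (q 0, q 1) := fun q hq => by
      have hq3 : q = ![q 0, q 1, q 2] := by ext k; fin_cases k <;> rfl
      have := eq_of_pd_two_eq_zero hB sb db2 hW hWc (t := q 0) (v := q 1)
        (fun w hw => ⟨hq.1, hw⟩) hq.2 hw₀
      rwa [← hq3] at this
    have hm : ∀ s ∈ S, ![s.1, s.2, w₀] ∈ domW S U := fun s hs => ⟨hs, hw₀⟩
    obtain ⟨p0, p1, -⟩ := pd_slice G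
    have hG : IsHeatSolution S G := by
      refine ⟨sb.comp (f := fun s : ℝ × ℝ => ![s.1, s.2, w₀]) (ContDiff.contDiffOn ?_) hm,
        fun s hs => ?_⟩
      · refine contDiff_pi.2 fun k => ?_
        fin_cases k <;> simp <;> fun_prop
      · have e0 := (pd_congr (i := 0) hB (hm s hs) hbG).trans (congrFun p0 _)
        have e1 : ∀ q ∈ domW S U, pd 1 b q = lineDeriv ℝ G (q 0, q 1) (0, 1) := fun q hq =>
          (pd_congr (i := 1) hB hq hbG).trans (congrFun p1 _)
        have e2 := (pd_congr (i := 1) hB (hm s hs) e1).trans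
          (congrFun (pd_slice fun r => lineDeriv ℝ G r (0, 1)).2.1 _)
        simp only [Matrix.cons_val] at e0 e2
        rw [← e0, ← e2, db 0 _ (hm s hs), db11 _ (hm s hs), (hk _ (hm s hs)).2.2.2,
          (hdet _ (hm s hs)).2.2.2.2, hf _ (hm s hs).2]
        simp
    refine ⟨![k₀, n, k₁ / 2, -a₀ / 2, m / 2, k₂ / 8], G, hG, fun q hq => ?_⟩
    obtain ⟨e1, e2, e3, -⟩ := hk q hq
    have e4 : X q 2 = pd 2 η q * q 2 + G (q 0, q 1) := by
      rw [← hbG q hq]; simp [hb, hη]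
    rw [e3] at e4
    ext k
    fin_cases k <;> simp [Fin.sum_univ_succ, V₁, V₂, V₃, V₄, V₆, V₇, VInf, e1, e2, e4] <;> ring
  · refine isPointSymmetry_pdeW_heat hU.1 hS h hG (c 0) (c 1) (c 2) (c 3) (c 4) (c 5) fun q hq => ?_
    rw [hX q hq]
    ext k
    fin_cases k <;> simp [Fin.sum_univ_succ, V₁, V₂, V₃, V₄, V₆, V₇, VInf] <;> ring

theorem isHeatSolution_exp (S : Set (ℝ × ℝ)) (k : ℝ) :
    IsHeatSolution S fun s => Real.exp (k ^ 2 * s.1 + k * s.2) := by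
  refine ⟨by fun_prop, fun s _ => ?_⟩
  have hd : ∀ (m : ℝ) (s : ℝ × ℝ) (v : ℝ × ℝ),
      lineDeriv ℝ (fun s : ℝ × ℝ => m * Real.exp (k ^ 2 * s.1 + k * s.2)) s v
        = m * (Real.exp (k ^ 2 * s.1 + k * s.2) * (k ^ 2 * v.1 + k * v.2)) := by
    intro m s v
    have h1 : HasDerivAt (fun r : ℝ => k ^ 2 * (s.1 + r * v.1) + k * (s.2 + r * v.2))
        (k ^ 2 * v.1 + k * v.2) 0 :=
      ((hasDerivAt_affine s.1 v.1).const_mul _).add ((hasDerivAt_affine s.2 v.2).const_mul _)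
    have := (h1.exp.const_mul m).deriv
    simpa [lineDeriv] using this
  have h1 := fun s v => hd 1 s v
  simp only [one_mul] at h1
  have h2 : (fun r => lineDeriv ℝ (fun s : ℝ × ℝ => Real.exp (k ^ 2 * s.1 + k * s.2)) r (0, 1))
      = fun s : ℝ × ℝ => k * Real.exp (k ^ 2 * s.1 + k * s.2) := by
    funext r; rw [h1]; simp; ring
  rw [h2, h1, hd]
  simp
  ring

/-- The heat solutions exp(n² t + n v), n ∈ ℕ, give independent fields: at fixed t a vanishing
combination is a polynomial in e^v that vanishes at infinitely many points. -/
theorem not_finiteDimensional_heat (hU : IsOpenInterval U) (h0 : 0 ∉ U) (hS : IsOpen S)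
    (hSc : IsConnected S) (h : IsPower (-2) U K) :
    ¬ FiniteDimensional ℝ (symSpace (pdeW K) (domW S U)) := by
  intro hfin
  obtain ⟨⟨t₀, v₀⟩, hs₀⟩ := hSc.nonempty
  obtain ⟨w₀, hw₀⟩ := nonempty_wRange h0 hU.2.1
  set Y : ℕ → VField := fun n => VInf fun s => Real.exp ((n : ℝ) ^ 2 * s.1 + n * s.2) with hY
  have hsym : ∀ n, IsPointSymmetry (pdeW K) (domW S U) (Y n) := fun n =>
    isPointSymmetry_pdeW_heat hU.1 hS h (isHeatSolution_exp S n) 0 0 0 0 0 0 fun q _ => by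
      simp [hY, VInf]
  set Z : ℕ → symSpace (pdeW K) (domW S U) := fun n =>
    ⟨(domW S U).domRestrict (Y n), Submodule.subset_span ⟨Y n, hsym n, rfl⟩⟩ with hZ
  have hli : LinearIndependent ℝ Z := by
    rw [linearIndependent_iff']
    intro s c hc n hn
    have key : ∀ v, (t₀, v) ∈ S →
        ∑ i ∈ s, c i * (Real.exp ((i : ℝ) ^ 2 * t₀) * Real.exp v ^ i) = 0 := by
      intro v hv
      have h1 := congrArg Subtype.val hc
      have h2 := congrFun (congrFun h1 ⟨![t₀, v, w₀], hv, hw₀⟩) 2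
      simp only [hZ, hY, Submodule.coe_sum, Submodule.coe_smul, Finset.sum_apply, Pi.smul_apply,
        Set.domRestrict_apply, VInf, smul_eq_mul, Matrix.cons_val] at h2
      refine Eq.trans (Finset.sum_congr rfl fun i _ => ?_) h2
      rw [← Real.exp_nat_mul, ← Real.exp_add]
    set p : Polynomial ℝ := ∑ i ∈ s,
      Polynomial.monomial i (c i * Real.exp ((i : ℝ) ^ 2 * t₀)) with hp
    have hinf : {v : ℝ | (t₀, v) ∈ S}.Infinite := by
      have ho : IsOpen {v : ℝ | (t₀, v) ∈ S} := hS.preimage (by fun_prop)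
      exact infinite_of_mem_nhds v₀ (ho.mem_nhds hs₀)
    have hp0 : p = 0 := by
      refine Polynomial.eq_zero_of_infinite_isRoot p
        ((hinf.image (Real.exp_injective.injOn)).mono ?_)
      rintro _ ⟨v, hv, rfl⟩
      simp only [Set.mem_ofPred_eq, Polynomial.IsRoot, hp, Polynomial.eval_finsetSum,
        Polynomial.eval_monomial]
      rw [← key v hv]
      exact Finset.sum_congr rfl fun i _ => by ring
    have := congrArg (fun p => Polynomial.coeff p n) hp0
    simp [hp, Polynomial.coeff_monomial, hn] at this
    exact this
  exact not_finite_iff_infinite.2 inferInstance hli.finite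

end SpecialRowsW

/-! ### Determining equations of the class p_t = −(K(u)/p)_uu. -/

section ClassP

variable {B : Set (Fin 3 → ℝ)} {X : VField} {U : Set ℝ} {K : ℝ → ℝ} {τ ξ η : (Fin 3 → ℝ) → ℝ}

theorem hasDerivAt_inv_pow (n : ℕ) {p : ℝ} (hp : p ≠ 0) :
    HasDerivAt (fun p : ℝ => (p ^ n)⁻¹) (-(n : ℝ) * (p ^ (n + 1))⁻¹) p := by
  refine ((hasDerivAt_pow n p).inv (pow_ne_zero n hp)).congr_deriv ?_
  rcases n with _ | n
  · simp
  · field_simp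
    simp
    ring

theorem contDiffOn_inv_pow (n : ℕ) (hB0 : ∀ q ∈ B, q 2 ≠ 0) :
    ContDiffOn ℝ ∞ (fun q : Fin 3 → ℝ => (q 2 ^ n)⁻¹) B :=
  ContDiffOn.inv (by fun_prop) fun q hq => pow_ne_zero n (hB0 q hq)

/-- Every coefficient of the expanded equation is a constant multiple of a derivative of K times an
inverse power of p. Keeping this shape throughout, the exponent 1 included, lets one rule
differentiate them all. -/
theorem hasPD_coef (hU : IsOpen U) (hK : ContDiffOn ℝ ∞ K U) (n : ℕ) (i : Fin 3) {q : Fin 3 → ℝ}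
    (hq : q 1 ∈ U) (hq0 : q 2 ≠ 0) :
    HasPD i (fun q => K (q 1) * (q 2 ^ n)⁻¹)
      ((if i = 1 then deriv K (q 1) else 0) * (q 2 ^ n)⁻¹
        + K (q 1) * (if i = 2 then -(n : ℝ) * (q 2 ^ (n + 1))⁻¹ else 0)) q :=
  (HasPD.comp_coord i 1 (hK.hasDerivAt_of_open hU hq)).mul
    (HasPD.comp_coord (k := fun p => (p ^ n)⁻¹) i 2 (hasDerivAt_inv_pow n hq0))

theorem isQuasilinear_pdeP (hU : IsOpen U) (hK : ContDiffOn ℝ ∞ K U) (hB : IsOpen B)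
    (hBU : ∀ q ∈ B, q 1 ∈ U) (hB0 : ∀ q ∈ B, q 2 ≠ 0) :
    IsQuasilinear (pdeP K) B (fun q => K (q 1) * (q 2 ^ 2)⁻¹)
      (fun q => -2 * (K (q 1) * (q 2 ^ 3)⁻¹)) (fun q => 2 * (deriv K (q 1) * (q 2 ^ 2)⁻¹))
      (fun q => -1 * (deriv (deriv K) (q 1) * (q 2 ^ 1)⁻¹)) := by
  intro j hj
  have sK := hK.deriv_infty hU
  have hg : ContDiffOn ℝ ∞ (fun q : Fin 3 → ℝ => K (q 1) / q 2) B :=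
    (hK.comp_coord 1 hBU).div (by fun_prop) hB0
  have hu : j 1 ∈ U := hBU _ hj
  have hp : j 2 ≠ 0 := hB0 _ hj
  have h0 : ∀ i : Fin 5 → ℝ, ![i 0, i 1, i 2] ∈ B →
      totalX0 (fun q => K (q 1) / q 2) i
        = deriv K (i 1) * (i 2 ^ 1)⁻¹ + i 4 * (K (i 1) * (-1 * (i 2 ^ 2)⁻¹)) := by
    intro i hi
    have e := fun k => ((hasPD_coef hU hK 1 k (hBU _ hi) (hB0 _ hi)).congr_on hB hi
      (g := fun q : Fin 3 → ℝ => K (q 1) / q 2)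
      (fun q hq => by simp [div_eq_mul_inv])).pd_eq
    rw [totalX0_eq hg hB hi, e, e]
    simp
  have e1 : ∀ {k : ℝ → ℝ}, ContDiffOn ℝ ∞ k U →
      HasDerivAt (fun s : ℝ => k (j 1 + s * 1)) (deriv k (j 1) * 1) 0 := fun hk =>
    HasDerivAt.comp (0 : ℝ) (by simpa using hk.hasDerivAt_of_open hU hu) (hasDerivAt_affine _ _)
  have e2 : ∀ n : ℕ, HasDerivAt (fun s : ℝ => ((j 2 + s * j 4) ^ n)⁻¹)
      (-(n : ℝ) * (j 2 ^ (n + 1))⁻¹ * j 4) 0 := fun n =>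
    HasDerivAt.comp (h₂ := fun p : ℝ => (p ^ n)⁻¹) (0 : ℝ)
      (by simpa using hasDerivAt_inv_pow n hp) (hasDerivAt_affine _ _)
  have h1 := ((e1 sK).mul (e2 1)).add ((hasDerivAt_affine (j 4) (j 7)).mul
    ((e1 hK).mul ((e2 2).const_mul (-1))))
  have h2 := (h1.congr_of_eventuallyEq (f₁ := fun s : ℝ => totalX0 (fun q => K (q 1) / q 2)
      (jet1 j + s • ![0, 1, j 4, j 6, j 7])) (by
    have hm := eventually_jet_mem hB (jet1 j) ![0, 1, j 4, j 6, j 7] 0 1 2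
      (by simpa [jet1] using hj)
    filter_upwards [hm] with s hs
    rw [h0 _ hs]
    simp [jet1])).deriv
  rw [pdeP, totalX1, lineDeriv, h2]
  simp
  ring

theorem detEqs_pdeP_iff (hU : IsOpen U) (hK : ContDiffOn ℝ ∞ K U) {q : Fin 3 → ℝ}
    (hq : q 1 ∈ U) (hq0 : q 2 ≠ 0) :
    DetEqs (fun q => K (q 1) * (q 2 ^ 2)⁻¹) (fun q => -2 * (K (q 1) * (q 2 ^ 3)⁻¹))
      (fun q => 2 * (deriv K (q 1) * (q 2 ^ 2)⁻¹))
      (fun q => -1 * (deriv (deriv K) (q 1) * (q 2 ^ 1)⁻¹)) τ ξ η q ↔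
    (pd 1 τ q = 0 ∧ pd 2 τ q = 0 ∧ pd 2 ξ q = 0) ∧
    2 * K (q 1) * η q = q 2 * (deriv K (q 1) * ξ q - K (q 1) * (2 * pd 1 ξ q - pd 0 τ q)) ∧
    K (q 1) * pd 2 (pd 2 η) q * q 2 ^ 2 - 2 * K (q 1) * pd 2 η q * q 2
      - 2 * K (q 1) * (pd 0 τ q - 2 * pd 1 ξ q) * q 2
      - 2 * deriv K (q 1) * ξ q * q 2 + 6 * K (q 1) * η q = 0 ∧
    2 * deriv K (q 1) * (pd 1 ξ q - pd 0 τ q) * q 2 - pd 0 ξ q * q 2 ^ 3 =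
      K (q 1) * (2 * pd 1 (pd 2 η) q - pd 1 (pd 1 ξ) q) * q 2 - 4 * K (q 1) * pd 1 η q
      + 2 * deriv (deriv K) (q 1) * ξ q * q 2 - 4 * deriv K (q 1) * η q ∧
    pd 0 η q * q 2 ^ 2 - deriv (deriv K) (q 1) * (pd 2 η q - pd 0 τ q) * q 2 =
      K (q 1) * pd 1 (pd 1 η) q + 2 * deriv K (q 1) * pd 1 η q
      - deriv (deriv (deriv K)) (q 1) * ξ q * q 2 + deriv (deriv K) (q 1) * η q := by
  have sK := hK.deriv_infty hU
  have sK2 := sK.deriv_infty hU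
  have a2 := fun i => (hasPD_coef hU hK 2 i hq hq0).pd_eq
  have a3 := fun i => ((hasPD_coef hU hK 3 i hq hq0).const_mul (-2)).pd_eq
  have c2 := fun i => ((hasPD_coef hU sK 2 i hq hq0).const_mul 2).pd_eq
  have d1 := fun i => ((hasPD_coef hU sK2 1 i hq hq0).const_mul (-1)).pd_eq
  unfold DetEqs
  refine and_congr_right fun _ => and_congr ?_ (and_congr ?_ (and_congr ?_ ?_))
  · rw [a2, a2, a2]
    simp
    field_simp
    constructor <;> intro h <;> linear_combination h
  · rw [a3, a3, a3]
    simp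
    field_simp
    constructor <;> intro h <;> linear_combination h
  · rw [c2, c2, c2]
    simp
    field_simp
    constructor <;> intro h <;> linear_combination h
  · rw [d1, d1, d1]
    simp
    field_simp
    constructor <;> intro h <;> linear_combination h

end ClassP

/-! ### Reduction of the second class to an ordinary differential equation for K. -/

section SolutionP

variable {B : Set (Fin 3 → ℝ)} {X : VField} {U : Set ℝ} {K : ℝ → ℝ} {τ ξ η : (Fin 3 → ℝ) → ℝ}

/-- The determining equations of `p_t = -(K(u)/p)_uu`, cleared of denominators. -/
def DetP (K : ℝ → ℝ) (τ ξ η : (Fin 3 → ℝ) → ℝ) (q : Fin 3 → ℝ) : Prop :=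
  (pd 1 τ q = 0 ∧ pd 2 τ q = 0 ∧ pd 2 ξ q = 0) ∧
    2 * K (q 1) * η q = q 2 * (deriv K (q 1) * ξ q - K (q 1) * (2 * pd 1 ξ q - pd 0 τ q)) ∧
    K (q 1) * pd 2 (pd 2 η) q * q 2 ^ 2 - 2 * K (q 1) * pd 2 η q * q 2
      - 2 * K (q 1) * (pd 0 τ q - 2 * pd 1 ξ q) * q 2
      - 2 * deriv K (q 1) * ξ q * q 2 + 6 * K (q 1) * η q = 0 ∧
    2 * deriv K (q 1) * (pd 1 ξ q - pd 0 τ q) * q 2 - pd 0 ξ q * q 2 ^ 3 =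
      K (q 1) * (2 * pd 1 (pd 2 η) q - pd 1 (pd 1 ξ) q) * q 2 - 4 * K (q 1) * pd 1 η q
      + 2 * deriv (deriv K) (q 1) * ξ q * q 2 - 4 * deriv K (q 1) * η q ∧
    pd 0 η q * q 2 ^ 2 - deriv (deriv K) (q 1) * (pd 2 η q - pd 0 τ q) * q 2 =
      K (q 1) * pd 1 (pd 1 η) q + 2 * deriv K (q 1) * pd 1 η q
      - deriv (deriv (deriv K)) (q 1) * ξ q * q 2 + deriv (deriv K) (q 1) * η q

theorem isPointSymmetry_pdeP_iff_detP (hU : IsOpen U) (hK : ContDiffOn ℝ ∞ K U)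
    (hK0 : ∀ u ∈ U, K u ≠ 0) (hB : IsOpen B) (hBU : ∀ q ∈ B, q 1 ∈ U) (hB0 : ∀ q ∈ B, q 2 ≠ 0) :
    IsPointSymmetry (pdeP K) B X ↔ ContDiffOn ℝ ∞ X B ∧
      ∀ q ∈ B, DetP K (fun q => X q 0) (fun q => X q 1) (fun q => X q 2) q := by
  have sK := hK.deriv_infty hU
  have sK2 := sK.deriv_infty hU
  rw [isPointSymmetry_iff_detEqs (isQuasilinear_pdeP hU hK hB hBU hB0) hB
    ((hK.comp_coord 1 hBU).mul (contDiffOn_inv_pow 2 hB0))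
    (contDiffOn_const.mul ((hK.comp_coord 1 hBU).mul (contDiffOn_inv_pow 3 hB0)))
    (contDiffOn_const.mul ((sK.comp_coord 1 hBU).mul (contDiffOn_inv_pow 2 hB0)))
    (contDiffOn_const.mul ((sK2.comp_coord 1 hBU).mul (contDiffOn_inv_pow 1 hB0)))
    (fun q hq => mul_ne_zero (hK0 _ (hBU q hq)) (inv_ne_zero (pow_ne_zero 2 (hB0 q hq))))]
  exact and_congr_right fun _ => forall₂_congr fun q hq =>
    detEqs_pdeP_iff hU hK (hBU q hq) (hB0 q hq)

/-- The first equation gives η = H p with H free of p. The last two then take the form P = p² E with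
P and E free of p, so all four functions vanish. The first of them yields ξ_t = 0 and shows that ξ
K'/K + ξ_u is a constant α; the second yields τ_tt = 0 and ξ_uuu = 0. -/
theorem detP_solution (hU : IsOpen U) (hK : ContDiffOn ℝ ∞ K U)
    (hK0 : ∀ u ∈ U, K u ≠ 0) (hB : IsOpen B) (hc : IsPreconnected B) (hBU : ∀ q ∈ B, q 1 ∈ U)
    (hB0 : ∀ q ∈ B, q 2 ≠ 0) (sτ : ContDiffOn ℝ ∞ τ B) (sξ : ContDiffOn ℝ ∞ ξ B)
    (h : ∀ q ∈ B, DetP K τ ξ η q) :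
    ∃ c d k m n α, ∀ q ∈ B, τ q = c * q 0 + d ∧ ξ q = k / 2 * q 1 ^ 2 + m * q 1 + n ∧
      η q = q 2 * (α - 3 * (k * q 1 + m) + c) / 2 ∧
      deriv K (q 1) * ξ q = (α - (k * q 1 + m)) * K (q 1) := by
  have sK := hK.deriv_infty hU
  have sK2 := sK.deriv_infty hU
  have hKq : ∀ q ∈ B, K (q 1) ≠ 0 := fun q hq => hK0 _ (hBU q hq)
  have pK := fun (i : Fin 3) q (hq : q ∈ B) =>
    HasPD.comp_coord i 1 (hK.hasDerivAt_of_open hU (hBU q hq))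
  have pK1 := fun (i : Fin 3) q (hq : q ∈ B) =>
    HasPD.comp_coord i 1 (sK.hasDerivAt_of_open hU (hBU q hq))
  have pK2 := fun (i : Fin 3) q (hq : q ∈ B) =>
    HasPD.comp_coord i 1 (sK2.hasDerivAt_of_open hU (hBU q hq))
  have s0 := sτ.pd hB 0
  have s1 := sξ.pd hB 1
  have s11 := s1.pd hB 1
  have x2 : ∀ q ∈ B, pd 2 ξ q = 0 := fun q hq => (h q hq).1.2.2
  have x21 : ∀ q ∈ B, pd 2 (pd 1 ξ) q = 0 := fun q hq => (pd_comm sξ hB hq 2 1).trans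
    (pd_eq_zero_of_eq_const hB x2 1 hq)
  have x211 : ∀ q ∈ B, pd 2 (pd 1 (pd 1 ξ)) q = 0 := fun q hq => (pd_comm s1 hB hq 2 1).trans
    (pd_eq_zero_of_eq_const hB x21 1 hq)
  have x20 : ∀ q ∈ B, pd 2 (pd 0 ξ) q = 0 := fun q hq => (pd_comm sξ hB hq 2 0).trans
    (pd_eq_zero_of_eq_const hB x2 0 hq)
  have t2 : ∀ q ∈ B, pd 2 (pd 0 τ) q = 0 := fun q hq => (pd_comm sτ hB hq 2 0).trans
    (pd_eq_zero_of_eq_const hB (fun q hq => (h q hq).1.2.1) 0 hq)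
  have t1 : ∀ q ∈ B, pd 1 (pd 0 τ) q = 0 := fun q hq => (pd_comm sτ hB hq 1 0).trans
    (pd_eq_zero_of_eq_const hB (fun q hq => (h q hq).1.1) 0 hq)
  -- M is ξ times the logarithmic derivative of K, the quantity whose sum with ξ_u will turn out to
  -- be constant.
  set M : (Fin 3 → ℝ) → ℝ := fun q => deriv K (q 1) / K (q 1) * ξ q with hM
  have sM : ContDiffOn ℝ ∞ M B :=
    ((sK.comp_coord 1 hBU).div (hK.comp_coord 1 hBU) hKq).mul sξ
  have hKM : ∀ q ∈ B, K (q 1) * M q = deriv K (q 1) * ξ q := fun q hq => by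
    have := hKq q hq
    simp only [hM]
    field_simp
  have dKM : ∀ i, ∀ q ∈ B, (if i = 1 then deriv K (q 1) else 0) * M q + K (q 1) * pd i M q
      = (if i = 1 then deriv (deriv K) (q 1) else 0) * ξ q + deriv K (q 1) * pd i ξ q :=
    fun i q hq => (((pK i q hq).mul (sM.hasPD hB hq i)).congr_on hB hq
      (fun q hq => (hKM q hq).symm)).unique ((pK1 i q hq).mul (sξ.hasPD hB hq i))
  have M2 : ∀ q ∈ B, pd 2 M q = 0 := fun q hq => by
    have := dKM 2 q hq
    simpa [x2 q hq, hKq q hq] using this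
  set H : (Fin 3 → ℝ) → ℝ := fun q => 1 / 2 * M q - pd 1 ξ q + 1 / 2 * pd 0 τ q with hH
  have sH : ContDiffOn ℝ ∞ H B := by fun_prop
  have dH : ∀ i, ∀ q ∈ B, pd i H q = 1 / 2 * pd i M q - pd i (pd 1 ξ) q + 1 / 2 * pd i (pd 0 τ) q :=
    fun i q hq => ((((sM.hasPD hB hq i).const_mul (1 / 2)).sub (s1.hasPD hB hq i)).add
      ((s0.hasPD hB hq i).const_mul (1 / 2))).pd_eq
  have H2 : ∀ q ∈ B, pd 2 H q = 0 := fun q hq => by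
    rw [dH 2 q hq, M2 q hq, x21 q hq, t2 q hq]; simp
  have hη : ∀ q ∈ B, η q = H q * q 2 := fun q hq => by
    have h1 := (h q hq).2.1
    rw [← hKM q hq] at h1
    have h2 := hKq q hq
    have h3 : K (q 1) * (η q - H q * q 2) = 0 := by
      simp only [hH]
      linear_combination 1 / 2 * h1
    linarith [(mul_eq_zero.1 h3).resolve_left h2]
  have dη : ∀ i, ∀ q ∈ B, pd i η q = pd i H q * q 2 + H q * (if i = 2 then 1 else 0) :=
    fun i q hq => (((sH.hasPD hB hq i).mul (HasPD.coord i 2 q)).congr_on hB hq hη).pd_eq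
  have dη2 : ∀ q ∈ B, pd 2 η q = H q := fun q hq => by rw [dη 2 q hq, H2 q hq]; simp
  have dη1 : ∀ q ∈ B, pd 1 η q = pd 1 H q * q 2 := fun q hq => by rw [dη 1 q hq]; simp
  have dη12 : ∀ q ∈ B, pd 1 (pd 2 η) q = pd 1 H q := fun q hq => pd_congr hB hq dη2
  have dη11 : ∀ q ∈ B, pd 1 (pd 1 η) q = pd 1 (pd 1 H) q * q 2 := fun q hq => by
    rw [((((sH.pd hB 1).hasPD hB hq 1).mul (HasPD.coord 1 2 q)).congr_on hB hq dη1).pd_eq]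
    simp
  have H21 : ∀ q ∈ B, pd 2 (pd 1 H) q = 0 := fun q hq => (pd_comm sH hB hq 2 1).trans
    (pd_eq_zero_of_eq_const hB H2 1 hq)
  have H211 : ∀ q ∈ B, pd 2 (pd 1 (pd 1 H)) q = 0 := fun q hq =>
    (pd_comm (sH.pd hB 1) hB hq 2 1).trans (pd_eq_zero_of_eq_const hB H21 1 hq)
  have H20 : ∀ q ∈ B, pd 2 (pd 0 H) q = 0 := fun q hq => (pd_comm sH hB hq 2 0).trans
    (pd_eq_zero_of_eq_const hB H2 0 hq)
  have hWne : ∀ w ∈ ({0}ᶜ : Set ℝ), deriv (fun p : ℝ => p ^ 2) w ≠ 0 := fun w hw => by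
    simpa using hw
  -- Divided by p, the fourth determining equation reads P = p² ξ_t.
  have e1 := eq_zero_of_eq_mul hB isOpen_compl_singleton (f := fun p : ℝ => p ^ 2)
    (by fun_prop) (fun q hq => hB0 q hq) hWne (E := pd 0 ξ)
    (P := fun q => 2 * (deriv K (q 1) * (pd 1 ξ q - pd 0 τ q)) + (2 * (K (q 1) * pd 1 H q)
      + K (q 1) * pd 1 (pd 1 ξ) q - 2 * (deriv (deriv K) (q 1) * ξ q)
      + 4 * (deriv K (q 1) * H q)))
    (sξ.pd hB 0)
    (fun q hq => ((((pK1 2 q hq).mul ((s1.hasPD hB hq 2).sub (s0.hasPD hB hq 2))).const_mul 2).add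
      ((((((pK 2 q hq).mul ((sH.pd hB 1).hasPD hB hq 2)).const_mul 2).add
        ((pK 2 q hq).mul (s11.hasPD hB hq 2))).sub
        (((pK2 2 q hq).mul (sξ.hasPD hB hq 2)).const_mul 2)).add
        (((pK1 2 q hq).mul (sH.hasPD hB hq 2)).const_mul 4))).congr (by
          simp [x21 q hq, t2 q hq, H21 q hq, x211 q hq, x2 q hq, H2 q hq]))
    x20
    (fun q hq => by
      have h1 := (h q hq).2.2.2.1
      rw [dη12 q hq, dη1 q hq, hη q hq] at h1
      have h2 := hB0 q hq
      refine mul_right_cancel₀ h2 ?_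
      linear_combination h1)
  have x0 : ∀ q ∈ B, pd 0 ξ q = 0 := fun q hq => (e1 q hq).2
  have x01 : ∀ q ∈ B, pd 0 (pd 1 ξ) q = 0 := fun q hq => (pd_comm sξ hB hq 0 1).trans
    (pd_eq_zero_of_eq_const hB x0 1 hq)
  have M0 : ∀ q ∈ B, pd 0 M q = 0 := fun q hq => by
    have := dKM 0 q hq
    simpa [x0 q hq, hKq q hq] using this
  -- With H expressed through M, and K M = K' ξ differentiated once, the relation P = 0 collapses to
  -- K (M_u + ξ_uu) = 0.
  have M1 : ∀ q ∈ B, pd 1 M q = -pd 1 (pd 1 ξ) q := fun q hq => by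
    have h1 := (e1 q hq).1
    have h2 := dKM 1 q hq
    rw [dH 1 q hq, t1 q hq] at h1
    simp only [if_true] at h2
    have h3 := hKq q hq
    have h4 : K (q 1) * (pd 1 M q + pd 1 (pd 1 ξ) q) = 0 := by
      simp only [hH] at h1
      linear_combination -h1 + 2 * h2
    linarith [(mul_eq_zero.1 h4).resolve_left h3]
  obtain ⟨α, hα⟩ := exists_eq_const hB hc (sM.add s1)
    (fun q hq => by
      rw [((sM.hasPD hB hq 0).add (s1.hasPD hB hq 0)).pd_eq, M0 q hq, x01 q hq, add_zero])
    (fun q hq => by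
      rw [((sM.hasPD hB hq 1).add (s1.hasPD hB hq 1)).pd_eq, M1 q hq, neg_add_cancel])
    (fun q hq => by
      rw [((sM.hasPD hB hq 2).add (s1.hasPD hB hq 2)).pd_eq, M2 q hq, x21 q hq, add_zero])
  have hM' : ∀ q ∈ B, M q = α - pd 1 ξ q := fun q hq => by linarith [hα q hq]
  have H1 : ∀ q ∈ B, pd 1 H q = -3 / 2 * pd 1 (pd 1 ξ) q := fun q hq => by
    rw [dH 1 q hq, M1 q hq, t1 q hq]; ring
  have H11 : ∀ q ∈ B, pd 1 (pd 1 H) q = -3 / 2 * pd 1 (pd 1 (pd 1 ξ)) q := fun q hq =>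
    (((s11.hasPD hB hq 1).const_mul (-3 / 2)).congr_on hB hq H1).pd_eq
  -- Divided by p, the last determining equation reads P = p² H_t, and H_t = τ_tt/2 because M and ξ
  -- do not depend on t.
  have e2 := eq_zero_of_eq_mul hB isOpen_compl_singleton (f := fun p : ℝ => p ^ 2)
    (by fun_prop) (fun q hq => hB0 q hq) hWne (E := pd 0 H)
    (P := fun q => K (q 1) * pd 1 (pd 1 H) q + (2 * (deriv K (q 1) * pd 1 H q)
      + deriv (deriv K) (q 1) * (2 * H q - pd 0 τ q) - deriv (deriv (deriv K)) (q 1) * ξ q))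
    (sH.pd hB 0)
    (fun q hq => (((pK 2 q hq).mul (((sH.pd hB 1).pd hB 1).hasPD hB hq 2)).add
      (((((pK1 2 q hq).mul ((sH.pd hB 1).hasPD hB hq 2)).const_mul 2).add
        ((pK2 2 q hq).mul (((sH.hasPD hB hq 2).const_mul 2).sub (s0.hasPD hB hq 2)))).sub
        ((HasPD.comp_coord 2 1 ((sK2.deriv_infty hU).hasDerivAt_of_open hU (hBU q hq))).mul
          (sξ.hasPD hB hq 2)))).congr (by
          simp [t2 q hq, H21 q hq, H211 q hq, x2 q hq, H2 q hq]))
    H20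
    (fun q hq => by
      have h1 := (h q hq).2.2.2.2
      rw [dη11 q hq, dη1 q hq, dη2 q hq, dη 0 q hq, hη q hq] at h1
      have h2 := hB0 q hq
      refine mul_right_cancel₀ h2 ?_
      simp at h1
      linear_combination -h1)
  have t00 : ∀ q ∈ B, pd 0 (pd 0 τ) q = 0 := fun q hq => by
    have h1 := (e2 q hq).2
    rw [dH 0 q hq, M0 q hq, x01 q hq] at h1
    linarith
  have r0 : ∀ q ∈ B, deriv K (q 1) * ξ q = K (q 1) * (α - pd 1 ξ q) := fun q hq => by
    rw [← hKM q hq, hM' q hq]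
  have pα := fun q (hq : q ∈ B) => (HasPD.const (i := 1) (q := q) α).sub (s1.hasPD hB hq 1)
  have r1 : ∀ q ∈ B, deriv (deriv K) (q 1) * ξ q + deriv K (q 1) * pd 1 ξ q
      = deriv K (q 1) * (α - pd 1 ξ q) + K (q 1) * (0 - pd 1 (pd 1 ξ) q) := fun q hq => by
    have := (((pK1 1 q hq).mul (sξ.hasPD hB hq 1)).congr_on hB hq
      (fun q hq => (r0 q hq).symm)).unique ((pK 1 q hq).mul (pα q hq))
    simpa using this
  have r2 : ∀ q ∈ B, deriv (deriv (deriv K)) (q 1) * ξ q + deriv (deriv K) (q 1) * pd 1 ξ q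
      + (deriv (deriv K) (q 1) * pd 1 ξ q + deriv K (q 1) * pd 1 (pd 1 ξ) q)
      = deriv (deriv K) (q 1) * (α - pd 1 ξ q) + deriv K (q 1) * (0 - pd 1 (pd 1 ξ) q)
        + (deriv K (q 1) * (0 - pd 1 (pd 1 ξ) q) + K (q 1) * (0 - pd 1 (pd 1 (pd 1 ξ)) q)) :=
    fun q hq => by
      have := ((((pK2 1 q hq).mul (sξ.hasPD hB hq 1)).add
        ((pK1 1 q hq).mul (s1.hasPD hB hq 1))).congr_on hB hq
        (fun q hq => (r1 q hq).symm)).unique (((pK1 1 q hq).mul (pα q hq)).add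
          ((pK 1 q hq).mul ((HasPD.const 0).sub (s11.hasPD hB hq 1))))
      simpa using this
  -- The twice differentiated equation K' ξ = (α − ξ_u) K eliminates K''' ξ from P = 0; what remains
  -- is K ξ_uuu = 0.
  have x111 : ∀ q ∈ B, pd 1 (pd 1 (pd 1 ξ)) q = 0 := fun q hq => by
    have h1 := (e2 q hq).1
    have h2 := r2 q hq
    have h4 : K (q 1) * pd 1 (pd 1 (pd 1 ξ)) q = 0 := by
      rw [H11 q hq, H1 q hq] at h1
      simp only [hH, hM' q hq] at h1
      linear_combination -2 * h1 - 2 * h2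
    exact (mul_eq_zero.1 h4).resolve_left (hKq q hq)
  obtain ⟨c, d, hcd⟩ := exists_affine_time hB hc sτ (fun q hq => (h q hq).1.1)
    (fun q hq => (h q hq).1.2.1) t00
  obtain ⟨k, m, n, hkmn⟩ := exists_quadratic_space hB hc sξ x0 x2 x111
  refine ⟨c, d, k, m, n, α, fun q hq => ⟨(hcd q hq).2, (hkmn q hq).2.2, ?_, ?_⟩⟩
  · rw [hη q hq]
    simp only [hH, hM' q hq, (hcd q hq).1, (hkmn q hq).2.1]
    ring
  · rw [r0 q hq, (hkmn q hq).2.1]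
    ring

/-- Up to factors ±p and ±2p, the first two equations are the ordinary differential equation itself,
and the last two are its first and second derivatives. -/
theorem detP_of_solution (hU : IsOpen U) (hK : ContDiffOn ℝ ∞ K U)
    (hB : IsOpen B) (hBU : ∀ q ∈ B, q 1 ∈ U) {c d c₀ c₁ c₂ α : ℝ}
    (hode : ∀ q ∈ B, deriv K (q 1) * (c₀ + c₁ * q 1 + c₂ * q 1 ^ 2)
      = (α - (c₁ + 2 * c₂ * q 1)) * K (q 1))
    (hτ : ∀ q ∈ B, τ q = c * q 0 + d) (hξ : ∀ q ∈ B, ξ q = c₀ + c₁ * q 1 + c₂ * q 1 ^ 2)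
    (hη : ∀ q ∈ B, η q = q 2 * (α - 3 * (c₁ + 2 * c₂ * q 1) + c) / 2) :
    ∀ q ∈ B, DetP K τ ξ η q := by
  have sK := hK.deriv_infty hU
  have sK2 := sK.deriv_infty hU
  have pK := fun (i : Fin 3) q (hq : q ∈ B) =>
    HasPD.comp_coord i 1 (hK.hasDerivAt_of_open hU (hBU q hq))
  have pK1 := fun (i : Fin 3) q (hq : q ∈ B) =>
    HasPD.comp_coord i 1 (sK.hasDerivAt_of_open hU (hBU q hq))
  have pK2 := fun (i : Fin 3) q (hq : q ∈ B) =>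
    HasPD.comp_coord i 1 (sK2.hasDerivAt_of_open hU (hBU q hq))
  have co := fun (i k : Fin 3) (q : Fin 3 → ℝ) => HasPD.coord i k q
  have k := fun (i : Fin 3) (r : ℝ) (q : Fin 3 → ℝ) => HasPD.const (i := i) (q := q) r
  have pτ : ∀ i, ∀ q ∈ B, pd i τ q = if i = 0 then c else 0 := fun i q hq => by
    rw [((((co i 0 q).const_mul c).add (k i d q)).congr_on hB hq hτ).pd_eq]
    split_ifs <;> simp
  have pξ : ∀ i, ∀ q ∈ B, pd i ξ q = if i = 1 then c₁ + 2 * c₂ * q 1 else 0 := fun i q hq => by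
    rw [((((k i c₀ q).add ((co i 1 q).const_mul c₁)).add
      (((co i 1 q).mul (co i 1 q)).const_mul c₂)).congr_on (g := ξ) hB hq
        (fun q hq => by rw [hξ q hq]; ring)).pd_eq]
    split_ifs <;> ring
  have pξ1 : ∀ q ∈ B, pd 1 (pd 1 ξ) q = 2 * c₂ := fun q hq => by
    rw [(((k 1 c₁ q).add ((co 1 1 q).const_mul (2 * c₂))).congr_on (g := pd 1 ξ) hB hq
        (fun q hq => by rw [pξ 1 q hq]; simp)).pd_eq]
    simp
  have pη : ∀ i, ∀ q ∈ B, pd i η q = if i = 1 then -3 * c₂ * q 2 else if i = 2 then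
      (α - 3 * (c₁ + 2 * c₂ * q 1) + c) / 2 else 0 := fun i q hq => by
    rw [(((co i 2 q).mul ((k i ((α - 3 * c₁ + c) / 2) q).add
      ((co i 1 q).const_mul (-3 * c₂)))).congr_on (g := η) hB hq
        (fun q hq => by rw [hη q hq]; ring)).pd_eq]
    fin_cases i <;> simp <;> ring
  have pη2 : ∀ i, ∀ q ∈ B, pd i (pd 2 η) q = if i = 1 then -3 * c₂ else 0 := fun i q hq => by
    rw [(((k i ((α - 3 * c₁ + c) / 2) q).add
      ((co i 1 q).const_mul (-3 * c₂))).congr_on (g := pd 2 η) hB hq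
        (fun q hq => by rw [pη 2 q hq]; simp; ring)).pd_eq]
    split_ifs <;> simp
  have pη11 : ∀ q ∈ B, pd 1 (pd 1 η) q = 0 := fun q hq => by
    rw [(((co 1 2 q).const_mul (-3 * c₂)).congr_on (g := pd 1 η) hB hq
        (fun q hq => by rw [pη 1 q hq]; simp)).pd_eq]
    simp
  have q2 := fun q (hq : q ∈ B) => ((k 1 c₀ q).add ((co 1 1 q).const_mul c₁)).add
    (((co 1 1 q).mul (co 1 1 q)).const_mul c₂)
  have q1 := fun q (hq : q ∈ B) => (k 1 α q).sub ((k 1 c₁ q).add ((co 1 1 q).const_mul (2 * c₂)))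
  have r1 : ∀ q ∈ B, deriv (deriv K) (q 1) * (c₀ + c₁ * q 1 + c₂ * (q 1 * q 1))
      + deriv K (q 1) * (c₁ + 2 * c₂ * q 1)
      = -(2 * c₂) * K (q 1) + (α - (c₁ + 2 * c₂ * q 1)) * deriv K (q 1) := fun q hq => by
    have := (((pK1 1 q hq).mul (q2 q hq)).congr_on hB hq
      (fun q hq => by rw [← hode q hq]; ring)).unique ((q1 q hq).mul (pK 1 q hq))
    simp at this
    linear_combination this
  have r2 : ∀ q ∈ B, deriv (deriv (deriv K)) (q 1) * (c₀ + c₁ * q 1 + c₂ * (q 1 * q 1))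
      + deriv (deriv K) (q 1) * (c₁ + 2 * c₂ * q 1)
      + (deriv (deriv K) (q 1) * (c₁ + 2 * c₂ * q 1) + deriv K (q 1) * (2 * c₂))
      = -(2 * c₂) * deriv K (q 1) + (-(2 * c₂) * deriv K (q 1)
        + (α - (c₁ + 2 * c₂ * q 1)) * deriv (deriv K) (q 1)) := fun q hq => by
    have := ((((pK2 1 q hq).mul (q2 q hq)).add ((pK1 1 q hq).mul ((k 1 c₁ q).add
      ((co 1 1 q).const_mul (2 * c₂))))).congr_on hB hq
      (fun q hq => (r1 q hq).symm)).unique (((pK 1 q hq).const_mul (-(2 * c₂))).add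
        ((q1 q hq).mul (pK1 1 q hq)))
    simp at this
    linear_combination this
  intro q hq
  have e0 := hode q hq
  have e1 := r1 q hq
  have e2 := r2 q hq
  refine ⟨⟨by simp [pτ _ q hq], by simp [pτ _ q hq], by simp [pξ _ q hq]⟩, ?_, ?_, ?_, ?_⟩
  · rw [hη q hq, hξ q hq, pξ 1 q hq, pτ 0 q hq]
    simp
    linear_combination -q 2 * e0
  · rw [hη q hq, hξ q hq, pξ 1 q hq, pτ 0 q hq, pη2 2 q hq, pη 2 q hq]
    simp
    linear_combination -2 * q 2 * e0
  · rw [hη q hq, hξ q hq, pξ 1 q hq, pξ 0 q hq, pτ 0 q hq, pη2 1 q hq, pη 1 q hq, pξ1 q hq]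
    simp
    linear_combination -2 * q 2 * e1
  · rw [hη q hq, hξ q hq, pτ 0 q hq, pη 0 q hq, pη 2 q hq, pη11 q hq, pη 1 q hq]
    simp
    linear_combination q 2 * e2

theorem isPointSymmetry_pdeP_of_solution (hU : IsOpen U) (hK : ContDiffOn ℝ ∞ K U)
    (hK0 : ∀ u ∈ U, K u ≠ 0) (hB : IsOpen B) (hBU : ∀ q ∈ B, q 1 ∈ U)
    (hB0 : ∀ q ∈ B, q 2 ≠ 0) {c d c₀ c₁ c₂ α : ℝ}
    (hode : ∀ q ∈ B, deriv K (q 1) * (c₀ + c₁ * q 1 + c₂ * q 1 ^ 2)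
        = (α - (c₁ + 2 * c₂ * q 1)) * K (q 1))
    (hX : ∀ q ∈ B, X q = ![c * q 0 + d, c₀ + c₁ * q 1 + c₂ * q 1 ^ 2,
        q 2 * (α - 3 * (c₁ + 2 * c₂ * q 1) + c) / 2]) : IsPointSymmetry (pdeP K) B X := by
  rw [isPointSymmetry_pdeP_iff_detP hU hK hK0 hB hBU hB0]
  refine ⟨ContDiffOn.congr (f := fun q => ![c * q 0 + d, c₀ + c₁ * q 1 + c₂ * q 1 ^ 2,
        q 2 * (α - 3 * (c₁ + 2 * c₂ * q 1) + c) / 2])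
      (contDiffOn_of_components ?_ ?_ ?_) hX, ?_⟩
  · simp only [Matrix.cons_val]; fun_prop
  · simp only [Matrix.cons_val]; fun_prop
  · simp only [Matrix.cons_val]; fun_prop
  · exact detP_of_solution (c := c) (d := d) hU hK hB hBU hode (fun q hq => by simp [hX q hq])
        (fun q hq => by simp [hX q hq]) (fun q hq => by simp [hX q hq])

/-- The point symmetries of `p_t = -(K(u)/p)_uu` on a connected open set. -/
theorem isPointSymmetry_pdeP_iff (hU : IsOpen U) (hK : ContDiffOn ℝ ∞ K U)
    (hK0 : ∀ u ∈ U, K u ≠ 0) (hB : IsOpen B) (hc : IsPreconnected B) (hBU : ∀ q ∈ B, q 1 ∈ U)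
    (hB0 : ∀ q ∈ B, q 2 ≠ 0) :
    IsPointSymmetry (pdeP K) B X ↔ ∃ c d c₀ c₁ c₂ α : ℝ,
      (∀ q ∈ B, deriv K (q 1) * (c₀ + c₁ * q 1 + c₂ * q 1 ^ 2)
        = (α - (c₁ + 2 * c₂ * q 1)) * K (q 1)) ∧
      ∀ q ∈ B, X q = ![c * q 0 + d, c₀ + c₁ * q 1 + c₂ * q 1 ^ 2,
        q 2 * (α - 3 * (c₁ + 2 * c₂ * q 1) + c) / 2] := by
  refine ⟨fun hs => ?_, fun ⟨c, d, c₀, c₁, c₂, α, hode, hX⟩ =>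
    isPointSymmetry_pdeP_of_solution hU hK hK0 hB hBU hB0 hode hX⟩
  rw [isPointSymmetry_pdeP_iff_detP hU hK hK0 hB hBU hB0] at hs
  obtain ⟨sX, h⟩ := hs
  obtain ⟨c, d, k, m, n, α, hs⟩ := detP_solution hU hK hK0 hB hc hBU hB0 (sX.comp_apply 0)
    (sX.comp_apply 1) h
  refine ⟨c, d, n, m, k / 2, α, fun q hq => ?_, fun q hq => ?_⟩
  · obtain ⟨-, e1, -, e3⟩ := hs q hq
    rw [show X q 1 = _ from e1] at e3
    linear_combination e3
  · obtain ⟨e0, e1, e2, -⟩ := hs q hq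
    ext i
    fin_cases i
    · exact e0
    · simp only [Fin.mk_one, Matrix.cons_val] at e1 ⊢
      linear_combination e1
    · simp only [Fin.reduceFinMk, Matrix.cons_val] at e2 ⊢
      linear_combination e2

end SolutionP

/-! ### Equivalence transformations of the second class. -/

section EquivalenceP

variable {B : Set (Fin 3 → ℝ)} {X X' : VField} {U U' : Set ℝ} {K K' : ℝ → ℝ}
  {a a₁ a₂ a₃ a₄ a₅ : ℝ}

theorem IsPointSymmetry.mono {F : (Fin 8 → ℝ) → ℝ} {N : Set (Fin 3 → ℝ)}
    (h : IsPointSymmetry F B X) (hN : N ⊆ B) : IsPointSymmetry F N X :=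
  ⟨h.1.mono hN, fun j hj => h.2 j (hN hj)⟩

/-- The normal form in `isPointSymmetry_pdeP_iff` requires a connected domain, whereas the
transformations are studied on arbitrary open sets. Locality allows the normal form to be used on
balls. -/
theorem isPointSymmetry_of_local {F : (Fin 8 → ℝ) → ℝ}
    (h : ∀ q ∈ B, ∃ N, q ∈ N ∧ IsOpen N ∧ IsPointSymmetry F N X) : IsPointSymmetry F B X := by
  constructor
  · intro q hq
    obtain ⟨N, hqN, oN, hN⟩ := h q hq
    exact (hN.1.contDiffAt (oN.mem_nhds hqN)).contDiffWithinAt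
  · intro j hj
    obtain ⟨N, hqN, -, hN⟩ := h _ hj
    exact hN.2 j hqN

theorem isOpen_image_of_leftInverse {E : Type*} [TopologicalSpace E] {m n : E → E} {V W V' : Set E}
    (hn : ∀ u ∈ V, n (m u) = u) (hW : IsOpen W) (cn : ContinuousOn n W)
    (hV' : ∀ y ∈ W, m (n y) = y) (hm : ∀ u ∈ V, m u ∈ W) (hV : IsOpen V)
    (hi : V' = m '' V) : IsOpen V' := by
  have : V' = W ∩ n ⁻¹' V := by
    rw [hi]
    ext y
    constructor
    · rintro ⟨u, hu, rfl⟩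
      exact ⟨hm u hu, by simpa [hn u hu] using hu⟩
    · rintro ⟨hy, hy'⟩
      exact ⟨n y, hy', hV' y hy⟩
  rw [this]
  exact cn.isOpen_inter_preimage hW hV

theorem IsConstitutive.map {m n f : ℝ → ℝ} {W : Set ℝ} (hK : IsConstitutive U K)
    (hm : ContinuousOn m U) (hn : ∀ u ∈ U, n (m u) = u) (hW : IsOpen W) (sn : ContDiffOn ℝ ∞ n W)
    (hW' : ∀ y ∈ W, m (n y) = y) (hmW : ∀ u ∈ U, m u ∈ W) (hU' : U' = m '' U)
    (sf : ContDiffOn ℝ ∞ f U) (hf : ∀ u ∈ U, f u ≠ 0) (hK' : ∀ u ∈ U, K' (m u) = f u * K u) :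
    IsConstitutive U' K' := by
  have hmaps : ∀ y ∈ U', y ∈ W ∧ n y ∈ U ∧ K' y = f (n y) * K (n y) := by
    rw [hU']
    rintro _ ⟨u, hu, rfl⟩
    rw [hn u hu]
    exact ⟨hmW u hu, hu, hK' u hu⟩
  refine ⟨⟨isOpen_image_of_leftInverse hn hW sn.continuousOn hW' hmW hK.1.1 hU',
    hU' ▸ hK.1.2.1.image m, ?_⟩, ?_, ?_⟩
  · rw [hU']
    exact ((Set.OrdConnected.isPreconnected hK.1.2.2).image m hm).ordConnected
  · have sn' := sn.mono fun y hy => (hmaps y hy).1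
    have := (sf.mul hK.2.1).comp sn' fun y hy => (hmaps y hy).2.1
    exact this.congr fun y hy => (hmaps y hy).2.2
  · intro y hy
    obtain ⟨-, h1, h2⟩ := hmaps y hy
    rw [h2]
    exact mul_ne_zero (hf _ h1) (hK.2.2 _ h1)

theorem AffineStepP.ne_zero (h : AffineStepP a₁ a₂ a₃ a₄ a₅ U K U' K') :
    a₂ ≠ 0 ∧ a₃ ≠ 0 ∧ a₄ ≠ 0 :=
  ⟨fun e => h.1 (by simp [e]), fun e => h.1 (by simp [e]), fun e => h.1 (by simp [e])⟩

theorem AffineStepP.symm (h : AffineStepP a₁ a₂ a₃ a₄ a₅ U K U' K') :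
    AffineStepP (-a₁ / a₂) a₂⁻¹ a₃⁻¹ a₄⁻¹ (-a₅ / a₄) U' K' U K := by
  obtain ⟨h2, h3, h4⟩ := h.ne_zero
  have e : ∀ u, a₂⁻¹ * (a₂ * u + a₁) + -a₁ / a₂ = u := fun u => by field_simp; ring
  obtain ⟨-, rfl, hK⟩ := h
  refine ⟨by simp [h2, h3, h4], ?_, ?_⟩
  · simp only [Set.image_image, e, Set.image_id']
  · rintro _ ⟨u, hu, rfl⟩
    simp only [e, hK u hu]
    field_simp

theorem AffineStepP.isConstitutive (h : AffineStepP a₁ a₂ a₃ a₄ a₅ U K U' K')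
    (hK : IsConstitutive U K) : IsConstitutive U' K' := by
  obtain ⟨h2, h3, h4⟩ := h.ne_zero
  refine hK.map (m := fun u => a₂ * u + a₁) (n := fun y => (y - a₁) / a₂) (W := Set.univ)
    (f := fun _ => a₂ ^ 2 * a₃ ^ 2 / a₄) (by fun_prop) (fun u _ => by field_simp; ring) isOpen_univ
    ((contDiff_id.sub contDiff_const).div_const _).contDiffOn (fun y _ => by field_simp; ring)
    (fun _ _ => trivial) h.2.1 contDiffOn_const (fun _ _ => ?_) h.2.2
  exact div_ne_zero (mul_ne_zero (pow_ne_zero 2 h2) (pow_ne_zero 2 h3)) h4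

theorem one_add_mul_div {u : ℝ} (hu : 1 - a * u ≠ 0) :
    1 + a * (u / (1 - a * u)) = 1 / (1 - a * u) := by
  field_simp; ring

theorem div_one_sub_mul_inv {u : ℝ} (hu : 1 - a * u ≠ 0) :
    u / (1 - a * u) / (1 + a * (u / (1 - a * u))) = u := by
  rw [one_add_mul_div hu, div_div_div_cancel_right₀ hu, div_one]

theorem ProjStepP.symm (h : ProjStepP a U K U' K') : ProjStepP (-a) U' K' U K := by
  obtain ⟨h0, rfl, hK⟩ := h
  have e : ∀ u ∈ U, 1 - -a * (u / (1 - a * u)) = 1 / (1 - a * u) := fun u hu => by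
    rw [← one_add_mul_div (h0 u hu)]; ring
  have e' : ∀ u ∈ U, u / (1 - a * u) / (1 - -a * (u / (1 - a * u))) = u := fun u hu => by
    rw [e u hu, div_div_div_cancel_right₀ (h0 u hu), div_one]
  refine ⟨?_, ?_, ?_⟩
  · rintro _ ⟨u, hu, rfl⟩
    rw [e u hu]
    exact one_div_ne_zero (h0 u hu)
  · rw [Set.image_image, Set.image_congr e', Set.image_id']
  · rintro _ ⟨u, hu, rfl⟩
    rw [e' u hu, e u hu, hK u hu, ← mul_assoc, ← mul_pow, one_div_mul_cancel (h0 u hu), one_pow,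
      one_mul]

theorem isOpen_one_add_mul_ne : IsOpen {y : ℝ | 1 + a * y ≠ 0} :=
  isOpen_ne_fun (by fun_prop) (by fun_prop)

theorem ProjStepP.isConstitutive (h : ProjStepP a U K U' K')
    (hK : IsConstitutive U K) : IsConstitutive U' K' := by
  obtain ⟨h0, hU', h2⟩ := h
  refine hK.map (m := fun u => u / (1 - a * u)) (n := fun y => y / (1 + a * y))
    (W := {y | 1 + a * y ≠ 0}) (f := fun u => (1 - a * u) ^ 2) ?_
    (fun u hu => div_one_sub_mul_inv (h0 u hu)) isOpen_one_add_mul_ne ?_ ?_ ?_ hU' (by fun_prop)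
    (fun u hu => pow_ne_zero 2 (h0 u hu)) h2
  · exact continuousOn_id.div (by fun_prop) h0
  · exact contDiffOn_id.div (by fun_prop) fun y hy => hy
  · intro y hy
    have hy : 1 + a * y ≠ 0 := hy
    have : 1 - a * (y / (1 + a * y)) = 1 / (1 + a * y) := by field_simp; ring
    simp only [this]
    rw [div_div_div_cancel_right₀ hy, div_one]
  · intro u hu
    simp only [Set.mem_ofPred_eq, one_add_mul_div (h0 u hu)]
    exact one_div_ne_zero (h0 u hu)

/-- The ordinary differential equation `K' ξ = (α - ξ') K`, `ξ = c₀ + c₁ u + c₂ u²`. -/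
def SolP (K : ℝ → ℝ) (c₀ c₁ c₂ α u : ℝ) : Prop :=
  deriv K u * (c₀ + c₁ * u + c₂ * u ^ 2) = (α - (c₁ + 2 * c₂ * u)) * K u

/-- The new coefficients are those of the vector field ξ ∂_u pushed forward by u ↦ a₂u + a₁. The
constant factor in K cancels from the equation, and α is unchanged. -/
theorem AffineStepP.solP {c₀ c₁ c₂ α u : ℝ} (h : AffineStepP a₁ a₂ a₃ a₄ a₅ U K U' K')
    (hK : IsConstitutive U K) (hu : u ∈ U) (hs : SolP K c₀ c₁ c₂ α u) :
    SolP K' (a₂ * c₀ - a₁ * c₁ + a₁ ^ 2 / a₂ * c₂) (c₁ - 2 * c₂ * a₁ / a₂) (c₂ / a₂) α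
      (a₂ * u + a₁) := by
  have hK' := h.isConstitutive hK
  obtain ⟨h2, h3, h4⟩ := h.ne_zero
  have hu' : a₂ * u + a₁ ∈ U' := h.2.1 ▸ ⟨u, hu, rfl⟩
  have d1 : HasDerivAt (fun x => K' (a₂ * x + a₁)) (deriv K' (a₂ * u + a₁) * (a₂ * 1)) u :=
    (hK'.2.1.hasDerivAt_of_open hK'.1.1 hu').comp u
      (((hasDerivAt_id u).const_mul a₂).add_const a₁)
  have d2 := (hK.2.1.hasDerivAt_of_open hK.1.1 hu).const_mul (a₂ ^ 2 * a₃ ^ 2 / a₄)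
  have e := d1.unique (d2.congr_of_eventuallyEq (by
    filter_upwards [hK.1.1.mem_nhds hu] with x hx using h.2.2 x hx))
  unfold SolP at hs ⊢
  rw [h.2.2 u hu]
  field_simp at e ⊢
  linear_combination a₂ ^ 2 * (c₀ + c₁ * u + c₂ * u ^ 2) * e + a₂ ^ 3 * a₃ ^ 2 * hs

/-- The push-forward of ξ ∂_u under y = u/(1 − au) is c₀(1 + ay)² + c₁y(1 + ay) + c₂y², again
quadratic. The factor (1 − au)² in K compensates the change of ξ', so α is unchanged. -/
theorem ProjStepP.solP {c₀ c₁ c₂ α u : ℝ} (h : ProjStepP a U K U' K')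
    (hK : IsConstitutive U K) (hu : u ∈ U) (hs : SolP K c₀ c₁ c₂ α u) :
    SolP K' c₀ (2 * a * c₀ + c₁) (a ^ 2 * c₀ + a * c₁ + c₂) α (u / (1 - a * u)) := by
  have hK' := h.isConstitutive hK
  have h0 := h.1 u hu
  have hu' : u / (1 - a * u) ∈ U' := h.2.1 ▸ ⟨u, hu, rfl⟩
  have dd : HasDerivAt (fun u => 1 - a * u) (-a) u := by
    simpa using ((hasDerivAt_id u).const_mul a).const_sub 1
  have dm : HasDerivAt (fun u => u / (1 - a * u)) (1 / (1 - a * u) ^ 2) u :=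
    ((hasDerivAt_id u).div dd h0).congr_deriv (by simp only [id]; ring)
  have d1 := (hK'.2.1.hasDerivAt_of_open hK'.1.1 hu').comp u dm
  have d2 := (dd.pow 2).mul (hK.2.1.hasDerivAt_of_open hK.1.1 hu)
  have e := d1.unique (d2.congr_of_eventuallyEq (by
    filter_upwards [hK.1.1.mem_nhds hu] with x hx using h.2.2 x hx))
  unfold SolP at hs ⊢
  rw [h.2.2 u hu]
  -- The denominator is treated as an independent letter while fractions are cleared, and its value
  -- is restored at the end.
  obtain ⟨d, hd⟩ : ∃ d, d = 1 - a * u := ⟨_, rfl⟩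
  simp only [← hd] at e h0 ⊢
  generalize deriv K' (u / d) = D at e ⊢
  have e : D = d ^ 2 * (-(2 * a * d) * K u + d ^ 2 * deriv K u) := by
    field_simp at e
    rw [e]
    simp only [Pi.pow_apply, ← hd]
    push_cast
    ring
  rw [e]
  field_simp
  rw [hd]
  linear_combination (1 - a * u) * hs

theorem pushesTo_affineMapP_iff : PushesTo (affineMapP a₁ a₂ a₃ a₄ a₅) B X X' ↔
    ∀ q ∈ B, X' (affineMapP a₁ a₂ a₃ a₄ a₅ q) = ![a₄ * X q 0, a₂ * X q 1, a₃ * X q 2] := by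
  refine forall₂_congr fun q hq => ?_
  rw [fderiv_apply_eq (d := ![a₄ * X q 0, a₂ * X q 1, a₃ * X q 2])]
  · have : ∀ i : Fin 3, Differentiable ℝ fun q => affineMapP a₁ a₂ a₃ a₄ a₅ q i := fun i => by
      fin_cases i <;> simp [affineMapP] <;> fun_prop
    exact differentiableAt_pi.2 fun i => (this i).differentiableAt
  · have d := fun i => hasDerivAt_jet_apply q (X q) i
    exact hasDerivAt_vec3 (((d 0).const_mul a₄).add_const a₅) (((d 1).const_mul a₂).add_const a₁)
      ((d 2).const_mul a₃)

theorem pushesTo_projMapP_iff (h0 : ∀ q ∈ B, 1 - a * q 1 ≠ 0) : PushesTo (projMapP a) B X X' ↔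
    ∀ q ∈ B, X' (projMapP a q) = ![X q 0, X q 1 / (1 - a * q 1) ^ 2,
      (1 - a * q 1) ^ 3 * X q 2 - 3 * a * (1 - a * q 1) ^ 2 * q 2 * X q 1] := by
  refine forall₂_congr fun q hq => ?_
  have hq0 := h0 q hq
  rw [fderiv_apply_eq (d := ![X q 0, X q 1 / (1 - a * q 1) ^ 2,
      (1 - a * q 1) ^ 3 * X q 2 - 3 * a * (1 - a * q 1) ^ 2 * q 2 * X q 1])]
  · have : ∀ i : Fin 3, DifferentiableAt ℝ (fun q => projMapP a q i) q := fun i => by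
      fin_cases i <;> simp [projMapP] <;> fun_prop (disch := assumption)
    exact differentiableAt_pi.2 this
  · have d := fun i => hasDerivAt_jet_apply q (X q) i
    have dd := ((d 1).const_mul a).const_sub 1
    refine hasDerivAt_vec3 (d 0) (((d 1).div dd (by simpa using hq0)).congr_deriv ?_)
      (((dd.pow 3).mul (d 2)).congr_deriv ?_)
    · simp
      ring
    · simp
      ring

/-- By the normal form it suffices to transform constants: `ht` supplies the new ones for given old
ones. They may vary from ball to ball. -/
theorem isPointSymmetry_pdeP_transport {φ : (Fin 3 → ℝ) → (Fin 3 → ℝ)} (hK : IsConstitutive U K)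
    (hK' : IsConstitutive U' K') (hB : IsOpen B) (hBU : ∀ q ∈ B, q 1 ∈ U ∧ q 2 ≠ 0)
    (hφ : ∀ q ∈ B, φ q 1 ∈ U' ∧ φ q 2 ≠ 0) (ho : ∀ N ⊆ B, IsOpen N → IsOpen (φ '' N))
    (ht : ∀ c d c₀ c₁ c₂ α : ℝ, ∃ c' d' b₀ b₁ b₂ β, ∀ q ∈ B, SolP K c₀ c₁ c₂ α (q 1) →
      X q = ![c * q 0 + d, c₀ + c₁ * q 1 + c₂ * q 1 ^ 2,
        q 2 * (α - 3 * (c₁ + 2 * c₂ * q 1) + c) / 2] →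
      SolP K' b₀ b₁ b₂ β (φ q 1) ∧
      X' (φ q) = ![c' * φ q 0 + d', b₀ + b₁ * φ q 1 + b₂ * φ q 1 ^ 2,
        φ q 2 * (β - 3 * (b₁ + 2 * b₂ * φ q 1) + c') / 2])
    (h : IsPointSymmetry (pdeP K) B X) : IsPointSymmetry (pdeP K') (φ '' B) X' := by
  refine isPointSymmetry_of_local ?_
  rintro _ ⟨q, hq, rfl⟩
  obtain ⟨ε, hε, hN⟩ := Metric.isOpen_iff.1 hB q hq
  refine ⟨φ '' Metric.ball q ε, ⟨q, Metric.mem_ball_self hε, rfl⟩, ho _ hN Metric.isOpen_ball, ?_⟩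
  obtain ⟨c, d, c₀, c₁, c₂, α, h1, h2⟩ := (isPointSymmetry_pdeP_iff hK.1.1 hK.2.1 hK.2.2
    Metric.isOpen_ball (convex_ball q ε).isPreconnected (fun q hq => (hBU q (hN hq)).1)
    (fun q hq => (hBU q (hN hq)).2)).1 (h.mono hN)
  obtain ⟨c', d', b₀, b₁, b₂, β, h3⟩ := ht c d c₀ c₁ c₂ α
  refine isPointSymmetry_pdeP_of_solution (c := c') (d := d') (c₀ := b₀) (c₁ := b₁) (c₂ := b₂)
    (α := β) hK'.1.1 hK'.2.1 hK'.2.2 (ho _ hN Metric.isOpen_ball) ?_ ?_ ?_ ?_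
  · rintro _ ⟨q, hq, rfl⟩
    exact (hφ q (hN hq)).1
  · rintro _ ⟨q, hq, rfl⟩
    exact (hφ q (hN hq)).2
  · rintro _ ⟨q, hq, rfl⟩
    exact (h3 q (hN hq) (h1 q hq) (h2 q hq)).1
  · rintro _ ⟨q, hq, rfl⟩
    exact (h3 q (hN hq) (h1 q hq) (h2 q hq)).2

theorem affineMapP_affineMapP_inv (h2 : a₂ ≠ 0) (h3 : a₃ ≠ 0) (h4 : a₄ ≠ 0) (q : Fin 3 → ℝ) :
    affineMapP (-a₁ / a₂) a₂⁻¹ a₃⁻¹ a₄⁻¹ (-a₅ / a₄) (affineMapP a₁ a₂ a₃ a₄ a₅ q) = q ∧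
    affineMapP a₁ a₂ a₃ a₄ a₅ (affineMapP (-a₁ / a₂) a₂⁻¹ a₃⁻¹ a₄⁻¹ (-a₅ / a₄) q) = q := by
  constructor <;> ext i <;> fin_cases i <;> simp [affineMapP] <;> field_simp <;> ring

theorem continuous_affineMapP : Continuous (affineMapP a₁ a₂ a₃ a₄ a₅) := by
  refine continuous_pi fun i => ?_
  fin_cases i <;> simp [affineMapP] <;> fun_prop

theorem AffineStepP.isPointSymmetry (h : AffineStepP a₁ a₂ a₃ a₄ a₅ U K U' K')
    (hK : IsConstitutive U K) (hB : IsOpen B) (hBU : ∀ q ∈ B, q 1 ∈ U ∧ q 2 ≠ 0)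
    (hX : PushesTo (affineMapP a₁ a₂ a₃ a₄ a₅) B X X') (hs : IsPointSymmetry (pdeP K) B X) :
    IsOpen (affineMapP a₁ a₂ a₃ a₄ a₅ '' B) ∧
    IsPointSymmetry (pdeP K') (affineMapP a₁ a₂ a₃ a₄ a₅ '' B) X' := by
  obtain ⟨h2, h3, h4⟩ := h.ne_zero
  have ho : ∀ N ⊆ B, IsOpen N → IsOpen (affineMapP a₁ a₂ a₃ a₄ a₅ '' N) := fun N _ oN =>
    isOpen_image_of_leftInverse (fun q _ => (affineMapP_affineMapP_inv h2 h3 h4 q).1) isOpen_univ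
      continuous_affineMapP.continuousOn (fun q _ => (affineMapP_affineMapP_inv h2 h3 h4 q).2)
      (fun _ _ => trivial) oN rfl
  refine ⟨ho B subset_rfl hB, isPointSymmetry_pdeP_transport hK (h.isConstitutive hK) hB hBU
    (fun q hq => ⟨h.2.1 ▸ ⟨q 1, (hBU q hq).1, rfl⟩, mul_ne_zero h3 (hBU q hq).2⟩) ho ?_ hs⟩
  intro c d c₀ c₁ c₂ α
  -- From a₄(ct + d) = c(a₄t + a₅) + (a₄d − ca₅); the coefficients of the new ξ are those produced
  -- by `AffineStepP.solP`.
  refine ⟨c, a₄ * d - c * a₅, _, _, _, α, fun q hq e1 e2 =>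
    ⟨h.solP hK (hBU q hq).1 e1, ?_⟩⟩
  rw [pushesTo_affineMapP_iff.1 hX q hq, e2]
  ext i
  fin_cases i <;> simp [affineMapP] <;> field_simp <;> ring

theorem isPointSymmetry_affineMapP_iff (hK : IsConstitutive U K)
    (h : AffineStepP a₁ a₂ a₃ a₄ a₅ U K U' K') (hB : IsOpen B)
    (hBU : ∀ q ∈ B, q 1 ∈ U ∧ q 2 ≠ 0) (hX : PushesTo (affineMapP a₁ a₂ a₃ a₄ a₅) B X X') :
    IsPointSymmetry (pdeP K) B X ↔
      IsPointSymmetry (pdeP K') (affineMapP a₁ a₂ a₃ a₄ a₅ '' B) X' := by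
  refine ⟨fun hs => (h.isPointSymmetry hK hB hBU hX hs).2, fun hs => ?_⟩
  obtain ⟨h2, h3, h4⟩ := h.ne_zero
  have e := affineMapP_affineMapP_inv (a₁ := a₁) (a₅ := a₅) h2 h3 h4
  have hB' : IsOpen (affineMapP a₁ a₂ a₃ a₄ a₅ '' B) :=
    isOpen_image_of_leftInverse (fun q _ => (e q).1) isOpen_univ
      continuous_affineMapP.continuousOn (fun q _ => (e q).2) (fun _ _ => trivial) hB rfl
  have := (h.symm.isPointSymmetry (X' := X) (h.isConstitutive hK) hB' ?_ ?_ hs).2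
  · simpa only [Set.image_image, (e _).1, Set.image_id'] using this
  · rintro _ ⟨q, hq, rfl⟩
    exact ⟨h.2.1 ▸ ⟨q 1, (hBU q hq).1, rfl⟩, mul_ne_zero h3 (hBU q hq).2⟩
  · rw [pushesTo_affineMapP_iff] at hX ⊢
    rintro _ ⟨q, hq, rfl⟩
    rw [(e q).1, hX q hq]
    ext i
    fin_cases i <;> simp [h2, h3, h4]

theorem projMapP_projMapP_neg {q : Fin 3 → ℝ} (h : 1 - a * q 1 ≠ 0) :
    projMapP (-a) (projMapP a q) = q := by
  have e : 1 - -a * (q 1 / (1 - a * q 1)) = 1 / (1 - a * q 1) := by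
    rw [← one_add_mul_div h]; ring
  ext i
  fin_cases i
  · rfl
  · change q 1 / (1 - a * q 1) / (1 - -a * (q 1 / (1 - a * q 1))) = q 1
    rw [e, div_div_div_cancel_right₀ h, div_one]
  · change (1 - -a * (q 1 / (1 - a * q 1))) ^ 3 * ((1 - a * q 1) ^ 3 * q 2) = q 2
    rw [e, ← mul_assoc, ← mul_pow, one_div_mul_cancel h, one_pow, one_mul]

theorem isOpen_projMapP_image (hB : IsOpen B) (h0 : ∀ q ∈ B, 1 - a * q 1 ≠ 0) :
    IsOpen (projMapP a '' B) := by
  refine isOpen_image_of_leftInverse (n := projMapP (-a)) (W := {q | 1 - -a * q 1 ≠ 0})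
    (fun q hq => projMapP_projMapP_neg (h0 q hq)) (isOpen_ne_fun (by fun_prop) (by fun_prop)) ?_
    (fun q hq => ?_) (fun q hq => ?_) hB rfl
  · refine continuousOn_pi.2 fun i => ?_
    have : ContinuousOn (fun q : Fin 3 → ℝ => q 1 / (1 - -a * q 1)) {q | 1 - -a * q 1 ≠ 0} :=
      ContinuousOn.div (by fun_prop) (by fun_prop) fun q hq => hq
    fin_cases i
    · exact (continuous_apply 0).continuousOn
    · exact this
    · exact ContinuousOn.mul (by fun_prop) (by fun_prop)
  · simpa using projMapP_projMapP_neg (a := -a) (q := q) hq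
  · change 1 - -a * (q 1 / (1 - a * q 1)) ≠ 0
    rw [neg_mul, sub_neg_eq_add, one_add_mul_div (h0 q hq)]
    exact one_div_ne_zero (h0 q hq)

theorem ProjStepP.isPointSymmetry (h : ProjStepP a U K U' K')
    (hK : IsConstitutive U K) (hB : IsOpen B) (hBU : ∀ q ∈ B, q 1 ∈ U ∧ q 2 ≠ 0)
    (hX : PushesTo (projMapP a) B X X') (hs : IsPointSymmetry (pdeP K) B X) :
    IsPointSymmetry (pdeP K') (projMapP a '' B) X' := by
  have h0 : ∀ q ∈ B, 1 - a * q 1 ≠ 0 := fun q hq => h.1 _ (hBU q hq).1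
  refine isPointSymmetry_pdeP_transport hK (h.isConstitutive hK) hB hBU
    (fun q hq => ⟨h.2.1 ▸ ⟨q 1, (hBU q hq).1, rfl⟩, mul_ne_zero (pow_ne_zero 3 (h0 q hq))
      (hBU q hq).2⟩) (fun N hN oN => isOpen_projMapP_image oN fun q hq => h0 q (hN hq)) ?_ hs
  intro c d c₀ c₁ c₂ α
  refine ⟨c, d, _, _, _, α, fun q hq e1 e2 => ⟨h.solP hK (hBU q hq).1 e1, ?_⟩⟩
  rw [(pushesTo_projMapP_iff h0).1 hX q hq, e2]
  have hq0 := h0 q hq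
  obtain ⟨d, hd⟩ : ∃ d, d = 1 - a * q 1 := ⟨_, rfl⟩
  ext i
  fin_cases i
  · rfl
  · simp only [projMapP, Matrix.cons_val, Fin.mk_one, ← hd] at hq0 ⊢
    field_simp
    rw [hd]
    ring
  · simp only [projMapP, Matrix.cons_val, Fin.reduceFinMk, ← hd] at hq0 ⊢
    field_simp
    rw [hd]
    ring

theorem isPointSymmetry_projMapP_iff (hK : IsConstitutive U K) (h : ProjStepP a U K U' K')
    (hB : IsOpen B) (hBU : ∀ q ∈ B, q 1 ∈ U ∧ q 2 ≠ 0) (hX : PushesTo (projMapP a) B X X') :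
    IsPointSymmetry (pdeP K) B X ↔ IsPointSymmetry (pdeP K') (projMapP a '' B) X' := by
  refine ⟨fun hs => h.isPointSymmetry hK hB hBU hX hs, fun hs => ?_⟩
  have h0 : ∀ q ∈ B, 1 - a * q 1 ≠ 0 := fun q hq => h.1 _ (hBU q hq).1
  have := h.symm.isPointSymmetry (X' := X) (h.isConstitutive hK) (isOpen_projMapP_image hB h0)
    ?_ ?_ hs
  · rwa [Set.image_image, Set.image_congr fun q hq => projMapP_projMapP_neg (h0 q hq),
      Set.image_id'] at this
  · rintro _ ⟨q, hq, rfl⟩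
    exact ⟨h.2.1 ▸ ⟨q 1, (hBU q hq).1, rfl⟩, mul_ne_zero (pow_ne_zero 3 (h0 q hq)) (hBU q hq).2⟩
  · rw [pushesTo_projMapP_iff h0] at hX
    rw [pushesTo_projMapP_iff]
    · rintro _ ⟨q, hq, rfl⟩
      rw [projMapP_projMapP_neg (h0 q hq), hX q hq]
      have e : 1 - -a * projMapP a q 1 = 1 / (1 - a * q 1) := by
        rw [neg_mul, sub_neg_eq_add]; exact one_add_mul_div (h0 q hq)
      have hq0 := h0 q hq
      rw [e]
      obtain ⟨d, hd⟩ : ∃ d, d = 1 - a * q 1 := ⟨_, rfl⟩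
      simp only [projMapP, ← hd] at hq0 ⊢
      ext i
      fin_cases i
      · rfl
      · simp only [Matrix.cons_val, Fin.mk_one]
        field_simp
      · simp only [Matrix.cons_val, Fin.reduceFinMk]
        field_simp
        ring
    · rintro _ ⟨q, hq, rfl⟩
      change 1 - -a * (q 1 / (1 - a * q 1)) ≠ 0
      rw [neg_mul, sub_neg_eq_add, one_add_mul_div (h0 q hq)]
      exact one_div_ne_zero (h0 q hq)

end EquivalenceP

/-! ### The rows of the second class and the invariant that separates them. -/

section ClassificationP

variable {B : Set (Fin 3 → ℝ)} {X X' : VField} {U U' : Set ℝ} {K K' : ℝ → ℝ}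

theorem IsDomainP.mem (h : IsDomainP U B) {q : Fin 3 → ℝ} (hq : q ∈ B) : q 1 ∈ U :=
  h.2.2.2 ▸ ⟨q, hq, rfl⟩

theorem IsDomainP.exists (h : IsDomainP U B) {u : ℝ} (hu : u ∈ U) : ∃ q ∈ B, q 1 = u := by
  rw [← h.2.2.2] at hu
  exact hu

theorem isPointSymmetry_W_basic (hK : IsConstitutive U K) (h : IsDomainP U B) (i : Fin 2) :
    IsPointSymmetry (pdeP K) B (![W₁, W₂] i) := by
  have key : ∀ c d : ℝ, (∀ q ∈ B, (![W₁, W₂] i : VField) q = ![c * q 0 + d, 0, q 2 * c / 2]) →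
      IsPointSymmetry (pdeP K) B (![W₁, W₂] i) := fun c d hX =>
    isPointSymmetry_pdeP_of_solution (c := c) (d := d) (c₀ := 0) (c₁ := 0) (c₂ := 0) (α := 0)
      hK.1.1 hK.2.1 hK.2.2 h.1 (fun q => h.mem) h.2.2.1 (by simp) (by simpa using hX)
  fin_cases i
  · exact key 0 1 fun q _ => by simp [W₁]
  · exact key 2 0 fun q _ => by simp [W₂]

/-- The symmetry algebra is determined by the solutions of the ordinary differential equation
`SolP`. -/
theorem symmetryAlgebraIs_pdeP {n : ℕ} {V : Fin n → VField} (hK : IsConstitutive U K)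
    (h : IsDomainP U B) (b₀ b₁ b₂ β : Fin n → ℝ)
    (hsol : ∀ c₀ c₁ c₂ α, (∀ u ∈ U, SolP K c₀ c₁ c₂ α u) ↔ ∃ k : Fin n → ℝ,
      c₀ = ∑ i, k i * b₀ i ∧ c₁ = ∑ i, k i * b₁ i ∧ c₂ = ∑ i, k i * b₂ i ∧ α = ∑ i, k i * β i)
    (hli : ∀ k : Fin n → ℝ, ∑ i, k i * b₀ i = 0 → ∑ i, k i * b₁ i = 0 →
      ∑ i, k i * b₂ i = 0 → ∀ i, k i = 0)
    (hV : ∀ i q, V i q = ![0, b₀ i + b₁ i * q 1 + b₂ i * q 1 ^ 2,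
      q 2 * (β i - 3 * (b₁ i + 2 * b₂ i * q 1)) / 2]) :
    SymmetryAlgebraIs (pdeP K) B (Matrix.vecCons W₁ (Matrix.vecCons W₂ V)) := by
  have hsum : ∀ (a b : ℝ) (k : Fin n → ℝ) q, a • W₁ q + (b • W₂ q + ∑ i, k i • V i q) =
      ![2 * b * q 0 + a, ∑ i, k i * b₀ i + (∑ i, k i * b₁ i) * q 1 + (∑ i, k i * b₂ i) * q 1 ^ 2,
        q 2 * (∑ i, k i * β i - 3 * (∑ i, k i * b₁ i + 2 * (∑ i, k i * b₂ i) * q 1) + 2 * b) / 2] := by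
    intro a b k q
    ext j
    simp only [hV, Pi.add_apply, Finset.sum_apply, Pi.smul_apply, smul_eq_mul]
    fin_cases j
    · simp [W₁, W₂]
      ring
    · simp [W₁, W₂, mul_add, Finset.sum_add_distrib, Finset.sum_mul, mul_assoc]
    · simp only [W₁, W₂, Fin.reduceFinMk, Matrix.cons_val, mul_zero, zero_add, Finset.mul_sum,
        Finset.sum_mul, ← Finset.sum_add_distrib, ← Finset.sum_sub_distrib]
      rw [mul_add, add_div, Finset.mul_sum, Finset.sum_div, add_comm]
      congr 1
      · exact Finset.sum_congr rfl fun i _ => by ring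
      · ring
  refine symmetryAlgebraIs_of_iff (fun X => ?_) fun c hc => ?_
  · rw [isPointSymmetry_pdeP_iff hK.1.1 hK.2.1 hK.2.2 h.1 h.2.1.isPreconnected (fun q => h.mem)
      h.2.2.1]
    constructor
    · rintro ⟨c, d, c₀, c₁, c₂, α, hs, hX⟩
      obtain ⟨k, rfl, rfl, rfl, rfl⟩ := (hsol c₀ c₁ c₂ α).1 fun u hu => by
        obtain ⟨q, hq, rfl⟩ := h.exists hu
        exact hs q hq
      refine ⟨Matrix.vecCons d (Matrix.vecCons (c / 2) k), fun q hq => ?_⟩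
      simp only [Fin.sum_univ_succ, Matrix.cons_val_zero, Matrix.cons_val_succ]
      rw [hX q hq, hsum, mul_div_cancel₀ c two_ne_zero]
    · rintro ⟨c, hX⟩
      refine ⟨2 * c 1, c 0, _, _, _, _, fun q hq => (hsol _ _ _ _).2
        ⟨fun i => c i.succ.succ, rfl, rfl, rfl, rfl⟩ _ (h.mem hq), fun q hq => ?_⟩
      rw [hX q hq]
      simp only [Fin.sum_univ_succ, Matrix.cons_val_zero, Matrix.cons_val_succ]
      exact hsum _ _ _ _
  · simp only [Fin.sum_univ_succ, Matrix.cons_val_zero, Matrix.cons_val_succ, hsum] at hc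
    obtain ⟨q, hq⟩ := h.2.1.nonempty
    obtain ⟨e0, e1, -⟩ := line_coeff_eq_zero h.1 hq 0
      (c0 := 2 * c (Fin.succ 0) * q 0 + c 0) (c1 := 2 * c (Fin.succ 0)) (c2 := 0) fun s hs => by
        have := congrFun (hc _ hs) 0
        simp at this ⊢
        linear_combination this
    have e1 : c (Fin.succ 0) = 0 := (mul_eq_zero.1 e1).resolve_left two_ne_zero
    have e0 : c 0 = 0 := by rw [e1] at e0; linear_combination e0
    obtain ⟨f0, f1, f2, -⟩ := cubic_coeff_eq_zero hK.1.1 hK.1.2.1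
      (c0 := ∑ i, c (Fin.succ (Fin.succ i)) * b₀ i) (c1 := ∑ i, c (Fin.succ (Fin.succ i)) * b₁ i)
      (c2 := ∑ i, c (Fin.succ (Fin.succ i)) * b₂ i) (c3 := 0) fun u hu => by
        obtain ⟨q, hq, rfl⟩ := h.exists hu
        simpa using congrFun (hc q hq) 1
    exact Fin.cases e0 (Fin.cases e1 (hli _ f0 f1 f2))

theorem IsPower.isConstitutive {μ : ℝ} (hU : IsOpenInterval U) (h : IsPower μ U K) :
    IsConstitutive U K := by
  refine ⟨hU, ContDiffOn.congr (f := fun u : ℝ => u ^ μ) ?_ h.2, fun u hu => ?_⟩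
  · exact contDiffOn_id.rpow_const_of_ne fun u hu => (h.1 hu).ne'
  · rw [h.2 u hu]
    exact (Real.rpow_pos_of_pos (h.1 hu) μ).ne'

theorem IsExp.isConstitutive (hU : IsOpenInterval U) (h : IsExp U K) : IsConstitutive U K :=
  ⟨hU, Real.contDiff_exp.contDiffOn.congr h, fun u hu => by
    rw [h u hu]; exact Real.exp_ne_zero u⟩

theorem hasDerivAt_arctan_diffusivity (l u : ℝ) :
    HasDerivAt (fun u : ℝ => 1 / (1 + u ^ 2) * Real.exp (l * Real.arctan u))
      ((l - 2 * u) / (1 + u ^ 2) * (1 / (1 + u ^ 2) * Real.exp (l * Real.arctan u))) u := by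
  have h0 : 1 + u ^ 2 ≠ 0 := by positivity
  have h1 : HasDerivAt (fun u : ℝ => 1 + u ^ 2) (2 * u) u := by
    simpa using ((hasDerivAt_id u).pow 2).const_add 1
  have h2 := (((hasDerivAt_const u (1 : ℝ)).div h1 h0)).mul
    (((Real.hasDerivAt_arctan u).const_mul l).exp)
  refine h2.congr_deriv ?_
  simp only [Pi.div_apply]
  field_simp
  ring

theorem contDiff_arctan_diffusivity (l : ℝ) :
    ContDiff ℝ ∞ fun u : ℝ => 1 / (1 + u ^ 2) * Real.exp (l * Real.arctan u) := by
  refine (contDiff_const.div (by fun_prop) fun u => by positivity).mul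
    (Real.contDiff_exp.comp (contDiff_const.mul ?_))
  exact Real.contDiff_arctan

theorem IsArctan.isConstitutive {l : ℝ} (hU : IsOpenInterval U) (h : IsArctan l U K) :
    IsConstitutive U K :=
  ⟨hU, (contDiff_arctan_diffusivity l).contDiffOn.congr h, fun u hu => by
    rw [h u hu]; positivity⟩

theorem deriv_eq_of_eqOn {f : ℝ → ℝ} {d u : ℝ} (hU : IsOpen U) (h : ∀ u ∈ U, K u = f u)
    (hu : u ∈ U) (hf : HasDerivAt f d u) : deriv K u = d :=
  (hf.congr_of_eventuallyEq (by filter_upwards [hU.mem_nhds hu] with x hx using h x hx)).deriv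

/-- After division by u^(μ−1) the equation is a polynomial identity on the open set U, so it can be
checked coefficientwise. The exceptional value μ = −2 is where c₂ becomes free. -/
theorem IsPower.solP_iff {μ c₀ c₁ c₂ α : ℝ} (hU : IsOpenInterval U) (h : IsPower μ U K) :
    (∀ u ∈ U, SolP K c₀ c₁ c₂ α u) ↔
      μ * c₀ = 0 ∧ α = (μ + 1) * c₁ ∧ (μ + 2) * c₂ = 0 := by
  have hd : ∀ u ∈ U, SolP K c₀ c₁ c₂ α u ↔
      μ * c₀ + (μ * c₁ - (α - c₁)) * u + (μ * c₂ + 2 * c₂) * u ^ 2 + 0 * u ^ 3 = 0 := by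
    intro u hu
    have hp : 0 < u := h.1 hu
    rw [SolP, deriv_eq_of_eqOn hU.1 h.2 hu (Real.hasDerivAt_rpow_const (Or.inl hp.ne')), h.2 u hu,
      Real.rpow_sub_one hp.ne']
    have := (Real.rpow_pos_of_pos hp μ).ne'
    field_simp
    constructor <;> intro e <;> linear_combination e
  constructor
  · intro hs
    obtain ⟨e0, e1, e2, -⟩ := cubic_coeff_eq_zero hU.1 hU.2.1 fun u hu => (hd u hu).1 (hs u hu)
    exact ⟨e0, by linear_combination -e1, by linear_combination e2⟩
  · rintro ⟨e0, e1, e2⟩ u hu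
    rw [hd u hu]
    linear_combination e0 - u * e1 + u ^ 2 * e2

theorem IsExp.solP_iff {c₀ c₁ c₂ α : ℝ} (hU : IsOpenInterval U) (h : IsExp U K) :
    (∀ u ∈ U, SolP K c₀ c₁ c₂ α u) ↔ c₁ = 0 ∧ c₂ = 0 ∧ α = c₀ := by
  have hd : ∀ u ∈ U, SolP K c₀ c₁ c₂ α u ↔
      (c₀ - (α - c₁)) + (c₁ + 2 * c₂) * u + c₂ * u ^ 2 + 0 * u ^ 3 = 0 := by
    intro u hu
    rw [SolP, deriv_eq_of_eqOn hU.1 h hu (Real.hasDerivAt_exp u), h u hu, mul_comm,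
      mul_right_cancel_iff_of_pos (Real.exp_pos u)]
    constructor <;> intro e <;> linear_combination e
  constructor
  · intro hs
    obtain ⟨e0, e1, e2, -⟩ := cubic_coeff_eq_zero hU.1 hU.2.1 fun u hu => (hd u hu).1 (hs u hu)
    have : c₁ = 0 := by linear_combination e1 - 2 * e2
    exact ⟨this, e2, by linear_combination this - e0⟩
  · rintro ⟨rfl, rfl, rfl⟩ u hu
    rw [hd u hu]
    ring

theorem IsArctan.solP_iff {l c₀ c₁ c₂ α : ℝ} (hU : IsOpenInterval U) (h : IsArctan l U K) :
    (∀ u ∈ U, SolP K c₀ c₁ c₂ α u) ↔ c₁ = 0 ∧ c₂ = c₀ ∧ α = l * c₀ := by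
  have hd : ∀ u ∈ U, SolP K c₀ c₁ c₂ α u ↔ (l * c₀ - (α - c₁)) + (l * c₁ - 2 * c₀ + 2 * c₂) * u
      + (l * c₂ - 2 * c₁ - (α - c₁)) * u ^ 2 + 0 * u ^ 3 = 0 := by
    intro u hu
    have hp : 0 < 1 / (1 + u ^ 2) * Real.exp (l * Real.arctan u) := by positivity
    rw [SolP, deriv_eq_of_eqOn hU.1 h hu (hasDerivAt_arctan_diffusivity l u), h u hu, mul_right_comm,
      mul_right_cancel_iff_of_pos hp]
    have : 1 + u ^ 2 ≠ 0 := by positivity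
    field_simp
    constructor <;> intro e <;> linear_combination e
  constructor
  · intro hs
    obtain ⟨e0, e1, e2, -⟩ := cubic_coeff_eq_zero hU.1 hU.2.1 fun u hu => (hd u hu).1 (hs u hu)
    -- The combination eliminates c₀, c₂ and α from the three coefficient equations.
    have h1 : c₁ * (l ^ 2 + 4) = 0 := by linear_combination l * e1 + 2 * e0 - 2 * e2
    have h1 : c₁ = 0 := (mul_eq_zero.1 h1).resolve_right (by positivity)
    subst h1
    exact ⟨rfl, by linear_combination e1 / 2, by linear_combination -e0⟩
  · rintro ⟨rfl, rfl, rfl⟩ u hu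
    rw [hd u hu]
    ring

theorem symmetryAlgebraIs_pdeP_power {μ : ℝ} (hU : IsOpenInterval U) (hB : IsDomainP U B)
    (h0 : μ ≠ 0) (h2 : μ ≠ -2) (h : IsPower μ U K) :
    SymmetryAlgebraIs (pdeP K) B ![W₁, W₂, W₃ μ] := by
  have h2' : μ + 2 ≠ 0 := fun e => h2 (by linear_combination e)
  refine symmetryAlgebraIs_pdeP (h.isConstitutive hU) hB ![0] ![2] ![0] ![2 * (μ + 1)]
    (fun c₀ c₁ c₂ α => ?_) (fun k => by simp) (fun i q => ?_)
  · rw [h.solP_iff hU]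
    simp only [mul_eq_zero, h0, h2', false_or]
    constructor
    · rintro ⟨rfl, rfl, rfl⟩
      exact ⟨![c₁ / 2], by simp, by simp, by simp, by simp; ring⟩
    · rintro ⟨k, rfl, rfl, rfl, rfl⟩
      exact ⟨by simp, by simp; ring, by simp⟩
  · fin_cases i
    ext j
    fin_cases j <;> simp [W₃]; ring

theorem symmetryAlgebraIs_pdeP_exp (hU : IsOpenInterval U) (hB : IsDomainP U B) (h : IsExp U K) :
    SymmetryAlgebraIs (pdeP K) B ![W₁, W₂, W₄] := by
  refine symmetryAlgebraIs_pdeP (h.isConstitutive hU) hB ![2] ![0] ![0] ![2]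
    (fun c₀ c₁ c₂ α => ?_) (fun k => by simp) (fun i q => ?_)
  · rw [h.solP_iff hU]
    simp
    constructor
    · rintro ⟨rfl, rfl, rfl⟩
      exact ⟨![α / 2], by simp, rfl, rfl, by simp⟩
    · rintro ⟨k, rfl, rfl, rfl, rfl⟩
      exact ⟨rfl, rfl, rfl⟩
  · fin_cases i
    ext j
    fin_cases j <;> simp [W₄]

theorem symmetryAlgebraIs_pdeP_arctan {l : ℝ} (hU : IsOpenInterval U) (hB : IsDomainP U B)
    (h : IsArctan l U K) : SymmetryAlgebraIs (pdeP K) B ![W₁, W₂, W₅ l] := by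
  refine symmetryAlgebraIs_pdeP (h.isConstitutive hU) hB ![2] ![0] ![2] ![2 * l]
    (fun c₀ c₁ c₂ α => ?_) (fun k => by simp) (fun i q => ?_)
  · rw [h.solP_iff hU]
    simp
    constructor
    · rintro ⟨rfl, rfl, rfl⟩
      exact ⟨![c₂ / 2], by simp, rfl, by simp, by simp; ring⟩
    · rintro ⟨k, rfl, rfl, rfl, rfl⟩
      exact ⟨rfl, rfl, by ring⟩
  · fin_cases i
    ext j
    fin_cases j <;> simp [W₅] <;> ring

theorem symmetryAlgebraIs_pdeP_power_special (hU : IsOpenInterval U) (hB : IsDomainP U B)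
    (h : IsPower (-2) U K) : SymmetryAlgebraIs (pdeP K) B ![W₁, W₂, W₃ (-2), W₆] := by
  refine symmetryAlgebraIs_pdeP (h.isConstitutive hU) hB ![0, 0] ![2, 0] ![0, 1] ![-2, 0]
    (fun c₀ c₁ c₂ α => ?_) (fun k => ?_) (fun i q => ?_)
  · rw [h.solP_iff hU]
    constructor
    · rintro ⟨e0, rfl, -⟩
      refine ⟨![c₁ / 2, c₂], ?_, by simp, by simp, by simp; ring⟩
      simpa using e0
    · rintro ⟨k, rfl, rfl, rfl, rfl⟩
      exact ⟨by simp, by simp; ring, by simp⟩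
  · simp only [Fin.forall_fin_two, Fin.sum_univ_two]
    simp
    tauto
  · fin_cases i
    · ext j
      fin_cases j <;> simp [W₃]; ring
    · ext j
      fin_cases j <;> simp [W₆]; ring

/-- Some nonzero quadratic polynomial with discriminant of sign `s` solves `SolP`. -/
def HasQuadP (s : SignType) (U : Set ℝ) (K : ℝ → ℝ) : Prop :=
  ∃ c₀ c₁ c₂ α : ℝ, ¬ (c₀ = 0 ∧ c₁ = 0 ∧ c₂ = 0) ∧ SignType.sign (c₁ ^ 2 - 4 * c₀ * c₂) = s ∧
    ∀ u ∈ U, SolP K c₀ c₁ c₂ α u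

/-- The discriminant of the transformed quadratic equals the original one, and the substitution on
the coefficients is invertible, so a nonzero quadratic stays nonzero. -/
theorem AffineStepP.hasQuadP {a₁ a₂ a₃ a₄ a₅ : ℝ} {s : SignType}
    (h : AffineStepP a₁ a₂ a₃ a₄ a₅ U K U' K') (hK : IsConstitutive U K)
    (hs : HasQuadP s U K) : HasQuadP s U' K' := by
  obtain ⟨c₀, c₁, c₂, α, hne, hd, hs⟩ := hs
  obtain ⟨h2, -, -⟩ := h.ne_zero
  refine ⟨a₂ * c₀ - a₁ * c₁ + a₁ ^ 2 / a₂ * c₂, c₁ - 2 * c₂ * a₁ / a₂, c₂ / a₂, α,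
    fun ⟨e0, e1, e2⟩ => hne ?_, ?_, ?_⟩
  · have e2 : c₂ = 0 := by simpa [h2] using e2
    have e1 : c₁ = 0 := by simpa [e2] using e1
    exact ⟨by simpa [e1, e2, h2] using e0, e1, e2⟩
  · rw [← hd]
    congr 1
    field_simp
    ring
  · rw [h.2.1]
    rintro _ ⟨u, hu, rfl⟩
    exact h.solP hK hu (hs u hu)

theorem ProjStepP.hasQuadP {a : ℝ} {s : SignType} (h : ProjStepP a U K U' K')
    (hK : IsConstitutive U K) (hs : HasQuadP s U K) : HasQuadP s U' K' := by
  obtain ⟨c₀, c₁, c₂, α, hne, hd, hs⟩ := hs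
  refine ⟨c₀, 2 * a * c₀ + c₁, a ^ 2 * c₀ + a * c₁ + c₂, α,
    fun ⟨e0, e1, e2⟩ => hne ?_, ?_, ?_⟩
  · subst e0
    have e1 : c₁ = 0 := by simpa using e1
    exact ⟨rfl, e1, by simpa [e1] using e2⟩
  · rw [← hd]
    congr 1
    ring
  · rw [h.2.1]
    rintro _ ⟨u, hu, rfl⟩
    exact h.solP hK hu (hs u hu)

/-- Every generating step has an inverse of the same kind, so the set of discriminant signs is the
same throughout an equivalence class. Regularity of K is carried along the chain because each step
needs it. -/
theorem EquivP.hasQuadP_iff {s : SignType} (h : EquivP U K U' K') (hK : IsConstitutive U K) :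
    HasQuadP s U K ↔ HasQuadP s U' K' := by
  suffices IsConstitutive U' K' ∧ (HasQuadP s U K ↔ HasQuadP s U' K') from this.2
  unfold EquivP at h
  generalize hd : (U', K') = d at h
  have : U' = d.1 ∧ K' = d.2 := by rw [← hd]; exact ⟨rfl, rfl⟩
  rw [this.1, this.2]
  clear this hd
  induction h with
  | refl => exact ⟨hK, Iff.rfl⟩
  | tail _ hstep ih =>
    obtain ⟨h1, h2⟩ := ih
    rcases hstep with ⟨a₁, a₂, a₃, a₄, a₅, hst⟩ | ⟨a, hst⟩
    · exact ⟨hst.isConstitutive h1, h2.trans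
        ⟨hst.hasQuadP h1, hst.symm.hasQuadP (hst.isConstitutive h1)⟩⟩
    · exact ⟨hst.isConstitutive h1, h2.trans
        ⟨hst.hasQuadP h1, hst.symm.hasQuadP (hst.isConstitutive h1)⟩⟩

theorem RowP.isConstitutive {i : Fin 4} (h : RowP i U K) : IsConstitutive U K := by
  obtain ⟨hU, h⟩ := h
  fin_cases i
  · obtain ⟨μ, -, -, h⟩ := h
    exact h.isConstitutive hU
  · exact IsExp.isConstitutive hU h
  · obtain ⟨l, h⟩ := h
    exact h.isConstitutive hU
  · exact IsPower.isConstitutive hU h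

/-- The admissible ξ are the multiples of u, of 1, of 1 + u², and the span of u and u²,
respectively; their discriminants have the signs listed. -/
theorem RowP.hasQuadP_iff {i : Fin 4} {s : SignType} (h : RowP i U K) :
    HasQuadP s U K ↔ s ∈ (![{1}, {0}, {-1}, {0, 1}] i : Finset SignType) := by
  obtain ⟨hU, h⟩ := h
  fin_cases i
  · obtain ⟨μ, h0, h2, h⟩ := h
    have h2' : μ + 2 ≠ 0 := fun e => h2 (by linear_combination e)
    change _ ↔ s ∈ ({1} : Finset SignType)
    rw [Finset.mem_singleton]
    constructor
    · rintro ⟨c₀, c₁, c₂, α, hne, rfl, hs⟩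
      simp only [h.solP_iff hU, mul_eq_zero, h0, h2', false_or] at hs
      obtain ⟨rfl, -, rfl⟩ := hs
      simp only [true_and, and_true] at hne
      exact sign_pos (by simp; positivity)
    · rintro rfl
      exact ⟨0, 1, 0, μ + 1, by simp, by simp, (h.solP_iff hU).2 (by simp)⟩
  · have h : IsExp U K := h
    change _ ↔ s ∈ ({0} : Finset SignType)
    rw [Finset.mem_singleton]
    constructor
    · rintro ⟨c₀, c₁, c₂, α, hne, rfl, hs⟩
      obtain ⟨rfl, rfl, -⟩ := (h.solP_iff hU).1 hs
      simp
    · rintro rfl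
      exact ⟨1, 0, 0, 1, by simp, by simp, (h.solP_iff hU).2 (by simp)⟩
  · obtain ⟨l, h⟩ := h
    change _ ↔ s ∈ ({-1} : Finset SignType)
    rw [Finset.mem_singleton]
    constructor
    · rintro ⟨c₀, c₁, c₂, α, hne, rfl, hs⟩
      obtain ⟨rfl, rfl, -⟩ := (h.solP_iff hU).1 hs
      have hne : c₂ ≠ 0 := fun e => hne ⟨e, rfl, e⟩
      have := mul_self_pos.2 hne
      exact sign_neg (by linarith)
    · rintro rfl
      exact ⟨1, 0, 1, l, by simp, sign_neg (by norm_num), (h.solP_iff hU).2 (by simp)⟩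
  · have h : IsPower (-2) U K := h
    change _ ↔ s ∈ ({0, 1} : Finset SignType)
    rw [Finset.mem_insert, Finset.mem_singleton]
    constructor
    · rintro ⟨c₀, c₁, c₂, α, hne, rfl, hs⟩
      obtain ⟨e0, -, -⟩ := (h.solP_iff hU).1 hs
      have e0 : c₀ = 0 := by simpa using e0
      subst e0
      by_cases h1 : c₁ = 0
      · simp [h1]
      · right
        exact sign_pos (by simp; positivity)
    · rintro (rfl | rfl)
      · exact ⟨0, 0, 1, 0, by simp, by simp, (h.solP_iff hU).2 (by simp)⟩
      · exact ⟨0, 1, 0, -1, by simp, by simp, (h.solP_iff hU).2 (by norm_num)⟩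

theorem RowP.eq_of_equivP {i i' : Fin 4} (h : RowP i U K) (h' : RowP i' U' K')
    (he : EquivP U K U' K') : i = i' := by
  -- The four sets of signs are pairwise different, so they determine the row; this is a finite
  -- check.
  have : ∀ s : SignType, s ∈ (![{1}, {0}, {-1}, {0, 1}] i : Finset SignType) ↔
      s ∈ (![{1}, {0}, {-1}, {0, 1}] i' : Finset SignType) := fun s => by
    rw [← h.hasQuadP_iff, ← h'.hasQuadP_iff]
    exact he.hasQuadP_iff h.isConstitutive
  revert this
  clear he h h'
  revert i i'
  decide

end ClassificationP

/-! ### Reduction of every K with a nonzero quadratic ξ to a row. -/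

section GenericP

variable {B : Set (Fin 3 → ℝ)} {U U' : Set ℝ} {K K' : ℝ → ℝ}

theorem AffineStepP.equivP {a₁ a₂ a₃ a₄ a₅ : ℝ} (h : AffineStepP a₁ a₂ a₃ a₄ a₅ U K U' K') :
    EquivP U K U' K' :=
  Relation.ReflTransGen.single (Or.inl ⟨a₁, a₂, a₃, a₄, a₅, h⟩)

theorem ProjStepP.equivP {a : ℝ} (h : ProjStepP a U K U' K') : EquivP U K U' K' :=
  Relation.ReflTransGen.single (Or.inr ⟨a, h⟩)

theorem affineStepP_of_eq {e s C : ℝ} {f : ℝ → ℝ} (he : e ≠ 0) (hC : C ≠ 0)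
    (h : ∀ u ∈ U, K u = C * f (e * u + s)) :
    AffineStepP s e 1 (e ^ 2 * C) 0 U K ((fun u => e * u + s) '' U) f := by
  refine ⟨by simp [he, hC], rfl, fun u hu => ?_⟩
  rw [h u hu]
  field_simp

theorem exists_row_of_power {e s C σ : ℝ} (hK : IsConstitutive U K) (he : e ≠ 0) (hC : C ≠ 0)
    (hσ : σ ≠ 0) (h : ∀ u ∈ U, 0 < e * u + s ∧ K u = C * (e * u + s) ^ σ) :
    ∃ (i : Fin 4) (U' : Set ℝ) (K' : ℝ → ℝ), EquivP U K U' K' ∧ RowP i U' K' := by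
  have hst := affineStepP_of_eq (f := fun y => y ^ σ) he hC fun u hu => (h u hu).2
  have hp : IsPower σ ((fun u => e * u + s) '' U) (fun y => y ^ σ) := by
    refine ⟨?_, fun _ _ => rfl⟩
    rintro _ ⟨u, hu, rfl⟩
    exact (h u hu).1
  by_cases h2 : σ = -2
  · subst h2
    exact ⟨3, _, _, hst.equivP, (hst.isConstitutive hK).1, hp⟩
  · exact ⟨0, _, _, hst.equivP, (hst.isConstitutive hK).1, σ, hσ, h2, hp⟩

/-- For affine ξ this is the equation of the first class with a = c₁, b = c₀, r = α − c₁. A constant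
K is kept apart, since it belongs to no row. -/
theorem const_or_exists_row_of_affine {c₀ c₁ α : ℝ} (hK : IsConstitutive U K)
    (hne : ¬ (c₀ = 0 ∧ c₁ = 0)) (h : ∀ u ∈ U, SolP K c₀ c₁ 0 α u) :
    (∃ C, C ≠ 0 ∧ ∀ u ∈ U, K u = C) ∨
    ∃ (i : Fin 4) (U' : Set ℝ) (K' : ℝ → ℝ), EquivP U K U' K' ∧ RowP i U' K' := by
  obtain ⟨u₀, hu₀⟩ := hK.1.2.1
  rcases const_or_exp_or_power_of_ode (a := c₁) (b := c₀) (r := α - c₁) hK.1.1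
    hK.1.2.2.isPreconnected hu₀ hK.2.1 hK.2.2
    (fun u hu => by have := h u hu; unfold SolP at this; linear_combination this)
    (fun hz => hne ⟨hz.2.1, hz.1⟩) with
    hC | ⟨e, C, he, hC0, hC⟩ | ⟨e, s, C, σ, he, hC0, hC⟩
  · exact Or.inl hC
  · have hst := affineStepP_of_eq (s := 0) (f := Real.exp) he hC0 (by simpa using hC)
    exact Or.inr ⟨1, _, _, hst.equivP, (hst.isConstitutive hK).1, fun _ _ => rfl⟩
  · by_cases hσ : σ = 0
    · subst hσ
      exact Or.inl ⟨C, hC0, fun u hu => by simpa using (hC u hu).2⟩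
    · exact Or.inr (exists_row_of_power hK he hC0 hσ hC)

/-- Completing the square gives ξ = c₂((u + m)² + n²) with n > 0. In the variable y = (u + m)/n it
is proportional to 1 + y², and with l = α/(c₂n) the quotient of K by the arctangent diffusivity at y
has derivative zero. -/
theorem exists_row_of_neg {c₀ c₁ c₂ α : ℝ} (hK : IsConstitutive U K)
    (hd : c₁ ^ 2 - 4 * c₀ * c₂ < 0) (h : ∀ u ∈ U, SolP K c₀ c₁ c₂ α u) :
    ∃ (i : Fin 4) (U' : Set ℝ) (K' : ℝ → ℝ), EquivP U K U' K' ∧ RowP i U' K' := by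
  have h2 : c₂ ≠ 0 := by
    rintro rfl
    nlinarith [sq_nonneg c₁]
  obtain ⟨n, hn, hn2⟩ : ∃ n : ℝ, 0 < n ∧ 4 * c₂ ^ 2 * n ^ 2 = 4 * c₀ * c₂ - c₁ ^ 2 := by
    have hpos : 0 < (4 * c₀ * c₂ - c₁ ^ 2) / (4 * c₂ ^ 2) := div_pos (by linarith) (by positivity)
    refine ⟨√((4 * c₀ * c₂ - c₁ ^ 2) / (4 * c₂ ^ 2)), Real.sqrt_pos.2 hpos, ?_⟩
    rw [Real.sq_sqrt hpos.le]
    field_simp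
  obtain ⟨u₀, hu₀⟩ := hK.1.2.1
  set l := α / (c₂ * n) with hl
  set m := c₁ / (2 * c₂) with hm
  have e1 : c₁ = 2 * c₂ * m := by rw [hm]; field_simp
  have e0 : c₀ = c₂ * (m ^ 2 + n ^ 2) := by
    have : c₂ * (c₀ - c₂ * (m ^ 2 + n ^ 2)) = 0 := by
      rw [e1] at hn2
      linear_combination -hn2 / 4
    linear_combination (mul_eq_zero.1 this).resolve_left h2
  have eα : α = l * (c₂ * n) := by rw [hl]; field_simp
  clear_value l m
  subst e1 e0 eα
  set g : ℝ → ℝ := fun y => 1 / (1 + y ^ 2) * Real.exp (l * Real.arctan y) with hg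
  have hg0 : ∀ y, g y ≠ 0 := fun y => by rw [hg]; positivity
  obtain ⟨C, hC⟩ := exists_eq_const_of_hasDerivAt_zero hK.1.1 hK.1.2.2.isPreconnected
    (g := fun u => K u / g (n⁻¹ * u + m / n)) (fun u hu => by
      have d1 := (hasDerivAt_arctan_diffusivity l (n⁻¹ * u + m / n)).comp u
        (((hasDerivAt_id u).const_mul n⁻¹).add_const (m / n))
      refine ((hK.2.1.hasDerivAt_of_open hK.1.1 hu).div d1 (hg0 _)).congr_deriv ?_
      rw [div_eq_zero_iff]
      left
      have hs : deriv K u * (c₂ * (m ^ 2 + n ^ 2) + 2 * c₂ * m * u + c₂ * u ^ 2)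
        = (l * (c₂ * n) - (2 * c₂ * m + 2 * c₂ * u)) * K u := h u hu
      have hy : 1 + (n⁻¹ * u + m / n) ^ 2 ≠ 0 := by positivity
      have hs : deriv K u = K u * ((l - 2 * (n⁻¹ * u + m / n)) / (1 + (n⁻¹ * u + m / n) ^ 2)
          * (n⁻¹ * 1)) := by
        have e2 : c₂ * n ^ 2 * (1 + (n⁻¹ * u + m / n) ^ 2) * deriv K u =
            c₂ * n * (l - 2 * (n⁻¹ * u + m / n)) * K u := by
          field_simp at hs ⊢
          linear_combination hs
        generalize n⁻¹ * u + m / n = y at hy e2 ⊢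
        field_simp at e2 ⊢
        linear_combination e2
      rw [hs]
      simp only [Function.comp, id]
      ring)
  have hC0 : C ≠ 0 := hC u₀ hu₀ ▸ div_ne_zero (hK.2.2 u₀ hu₀) (hg0 _)
  have hst := affineStepP_of_eq (f := g) (inv_ne_zero hn.ne') hC0 fun u hu =>
    (div_eq_iff (hg0 _)).1 (hC u hu)
  exact ⟨2, _, _, hst.equivP, (hst.isConstitutive hK).1, l, fun _ _ => rfl⟩

/-- At a root in U the equation forces α = ξ', and ξ' takes the values ±s at the two roots, s² being
the discriminant. If neither root lay outside U, then s = −s = 0 and the root r would be double;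
cancelling c₂(u − r) and letting u tend to r gives 2K(r) = 0, which is impossible. -/
theorem exists_root_notMem {c₀ c₁ c₂ α : ℝ} (hK : IsConstitutive U K) (h2 : c₂ ≠ 0)
    (hd : 0 ≤ c₁ ^ 2 - 4 * c₀ * c₂) (h : ∀ u ∈ U, SolP K c₀ c₁ c₂ α u) :
    ∃ r ∉ U, c₀ + c₁ * r + c₂ * r ^ 2 = 0 := by
  obtain ⟨s, hs⟩ : ∃ s : ℝ, s ^ 2 = c₁ ^ 2 - 4 * c₀ * c₂ := ⟨_, Real.sq_sqrt hd⟩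
  have key : ∀ t : ℝ, t ^ 2 = c₁ ^ 2 - 4 * c₀ * c₂ →
      c₀ + c₁ * ((t - c₁) / (2 * c₂)) + c₂ * ((t - c₁) / (2 * c₂)) ^ 2 = 0 ∧
      ((t - c₁) / (2 * c₂) ∈ U → α = t) := by
    intro t ht
    have h0 : c₀ + c₁ * ((t - c₁) / (2 * c₂)) + c₂ * ((t - c₁) / (2 * c₂)) ^ 2 = 0 := by
      field_simp
      linear_combination ht
    refine ⟨h0, fun hu => ?_⟩
    have := h _ hu
    rw [SolP, h0, mul_zero] at this
    have := (mul_eq_zero.1 this.symm).resolve_right (hK.2.2 _ hu)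
    field_simp at this
    linear_combination this
  by_contra! hcon
  have h1 : (s - c₁) / (2 * c₂) ∈ U := by
    by_contra hu
    exact hcon _ hu (key s hs).1
  have h1' : (-s - c₁) / (2 * c₂) ∈ U := by
    by_contra hu
    exact hcon _ hu (key (-s) (by rw [← hs]; ring)).1
  have es := (key s hs).2 h1
  have es' := (key (-s) (by rw [← hs]; ring)).2 h1'
  have hs0 : s = 0 := by linarith
  subst hs0
  subst es
  set r := (0 - c₁) / (2 * c₂) with hr
  have e1 : c₁ = -2 * c₂ * r := by rw [hr]; field_simp; ring
  have e0 := (key 0 hs).1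
  rw [← hr] at e0
  have := eq_zero_of_eq_zero_of_ne (g := fun u => deriv K u * (u - r) + 2 * K u) hK.1.1 h1
    (((((hK.2.1.deriv_infty hK.1.1).contDiffAt (hK.1.1.mem_nhds h1)).continuousAt).mul
      (by fun_prop)).add (continuousAt_const.mul
        (hK.2.1.contDiffAt (hK.1.1.mem_nhds h1)).continuousAt)) fun u hu hur => by
    have h3 := h u hu
    have h4 : c₂ * (u - r) ≠ 0 := mul_ne_zero h2 (sub_ne_zero.2 hur)
    rw [SolP, e1] at h3
    rw [e1] at e0
    have h5 : c₂ * (u - r) * (deriv K u * (u - r) + 2 * K u) = 0 := by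
      linear_combination h3 - deriv K u * e0
    exact (mul_eq_zero.1 h5).resolve_left h4
  simp [hK.2.2 r h1] at this

/-- A translation moves the root to 1 and the projective step with parameter 1 sends it to infinity,
so the transformed ξ has no quadratic term and the affine case applies. The root has to lie outside
U for that step to be defined. -/
theorem exists_row_of_root {c₀ c₁ c₂ α r : ℝ} (hK : IsConstitutive U K) (h2 : c₂ ≠ 0)
    (hr : r ∉ U) (hr0 : c₀ + c₁ * r + c₂ * r ^ 2 = 0) (h : ∀ u ∈ U, SolP K c₀ c₁ c₂ α u) :
    ∃ (i : Fin 4) (U' : Set ℝ) (K' : ℝ → ℝ), EquivP U K U' K' ∧ RowP i U' K' := by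
  have s1 : AffineStepP (1 - r) 1 1 1 0 U K ((fun u => 1 * u + (1 - r)) '' U)
      (fun y => K (y - (1 - r))) := ⟨by norm_num, rfl, fun u _ => by simp⟩
  set U₁ := (fun u => 1 * u + (1 - r)) '' U with hU₁
  have h1 : ∀ y ∈ U₁, 1 - 1 * y ≠ 0 := by
    rintro _ ⟨u, hu, rfl⟩ he
    have : u = r := by simp only at he; linarith
    exact hr (this ▸ hu)
  set K₁ : ℝ → ℝ := fun y => K (y - (1 - r)) with hK₁
  have s2 : ProjStepP 1 U₁ K₁ ((fun u => u / (1 - 1 * u)) '' U₁)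
      (fun y => (1 - 1 * (y / (1 + 1 * y))) ^ 2 * K₁ (y / (1 + 1 * y))) :=
    ⟨h1, rfl, fun u hu => by simp only [div_one_sub_mul_inv (h1 u hu)]⟩
  have hK1 := s1.isConstitutive hK
  have hK2 := s2.isConstitutive hK1
  have eq2 := s1.equivP.trans s2.equivP
  have hs : ∀ y ∈ (fun u => u / (1 - 1 * u)) '' U₁,
      SolP (fun y => (1 - 1 * (y / (1 + 1 * y))) ^ 2 * K₁ (y / (1 + 1 * y)))
      (c₀ - (1 - r) * c₁ + (1 - r) ^ 2 * c₂)
      (2 * (c₀ - (1 - r) * c₁ + (1 - r) ^ 2 * c₂) + (c₁ - 2 * c₂ * (1 - r))) 0 α y := by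
    rintro _ ⟨_, ⟨u, hu, rfl⟩, rfl⟩
    have := s2.solP hK1 ⟨u, hu, rfl⟩ (s1.solP hK hu (h u hu))
    convert this using 1
    · ring
    · ring
    · linear_combination -hr0
  have hne : ¬ (c₀ - (1 - r) * c₁ + (1 - r) ^ 2 * c₂ = 0 ∧
      2 * (c₀ - (1 - r) * c₁ + (1 - r) ^ 2 * c₂) + (c₁ - 2 * c₂ * (1 - r)) = 0) := by
    rintro ⟨e0, e1⟩
    apply h2
    linear_combination hr0 + e0 - e1
  rcases const_or_exists_row_of_affine hK2 hne hs with ⟨C, hC0, hC⟩ | ⟨i, U', K', he, hrow⟩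
  -- If the transformed function is constant, then the original K is C (u − r)^(−2), which reduces
  -- to the row u^(−2) after a translation and possibly a reflection.
  · have hC' : ∀ u ∈ U, K u * (u - r) ^ 2 = C := fun u hu => by
      have hy : 1 * u + (1 - r) ∈ U₁ := ⟨u, hu, rfl⟩
      have := hC _ ⟨_, hy, rfl⟩
      simp only [div_one_sub_mul_inv (h1 _ hy)] at this
      rw [← this, hK₁]
      simp
      ring
    have hp : ∀ e s : ℝ, e ^ 2 = 1 → s = -(e * r) → (∀ u ∈ U, 0 < e * u + s) →
        ∃ (i : Fin 4) (U' : Set ℝ) (K' : ℝ → ℝ), EquivP U K U' K' ∧ RowP i U' K' := by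
      intro e s he hs hpos
      have he0 : e ≠ 0 := by rintro rfl; norm_num at he
      refine exists_row_of_power (σ := -2) hK he0 hC0 (by norm_num) fun u hu => ⟨hpos u hu, ?_⟩
      have := hpos u hu
      rw [Real.rpow_neg this.le, Real.rpow_two, ← div_eq_mul_inv, eq_div_iff (by positivity),
        ← hC' u hu, hs]
      linear_combination K u * (u - r) ^ 2 * he
    rcases pos_or_neg_of_ne_zero hK.1.2.2.isPreconnected (g := fun u => u - r) (by fun_prop)
      (fun u hu he => hr (sub_eq_zero.1 he ▸ hu)) with hp' | hn'
    · exact hp 1 (-r) (by norm_num) (by ring) fun u hu => by have := hp' u hu; linarith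
    · exact hp (-1) r (by norm_num) (by ring) fun u hu => by have := hn' u hu; linarith
  · exact ⟨i, U', K', eq2.trans he, hrow⟩

/-- A nonzero ξ would make K constant or equivalent to a row. With ξ = 0 the equation leaves α K =
0, so α = 0 as well, and no field besides `W₁` and `W₂` is needed. -/
theorem symmetryAlgebraIs_pdeP_generic (hK : IsConstitutive U K) (hB : IsDomainP U B)
    (hne : ∃ u ∈ U, ∃ u' ∈ U, K u ≠ K u')
    (h : ¬ ∃ (i : Fin 4) (U' : Set ℝ) (K' : ℝ → ℝ), EquivP U K U' K' ∧ RowP i U' K') :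
    SymmetryAlgebraIs (pdeP K) B ![W₁, W₂] := by
  refine symmetryAlgebraIs_pdeP (n := 0) hK hB ![] ![] ![] ![] (fun c₀ c₁ c₂ α => ?_)
    (fun k _ _ _ i => i.elim0) (fun i => i.elim0)
  simp only [Finset.univ_eq_empty, Finset.sum_empty, exists_const]
  constructor
  · intro hs
    have h2 : c₂ = 0 := by
      by_contra h2
      rcases lt_or_ge (c₁ ^ 2 - 4 * c₀ * c₂) 0 with hd | hd
      · exact h (exists_row_of_neg hK hd hs)
      · obtain ⟨r, hr, hr0⟩ := exists_root_notMem hK h2 hd hs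
        exact h (exists_row_of_root hK h2 hr hr0 hs)
    subst h2
    by_cases h01 : c₀ = 0 ∧ c₁ = 0
    · obtain ⟨rfl, rfl⟩ := h01
      obtain ⟨u, hu⟩ := hK.1.2.1
      have := hs u hu
      simp [SolP, hK.2.2 u hu] at this
      exact ⟨rfl, rfl, rfl, this⟩
    · rcases const_or_exists_row_of_affine hK h01 hs with ⟨C, -, hC⟩ | hrow
      · obtain ⟨u, hu, u', hu', hne⟩ := hne
        exact absurd ((hC u hu).trans (hC u' hu').symm) hne
      · exact absurd hrow h
  · rintro ⟨rfl, rfl, rfl, rfl⟩ u _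
    simp [SolP]

end GenericP

/-! ### Differential functions and the commutator of ∂/∂z_k with the total derivative. -/

section DiffFun

variable {Ω : Set EJet} {H H' P R g : EJet → ℝ} {J v : EJet}

/-- The coordinates of a jet up to order `n - 1`. -/
def jetProj (n : ℕ) (J : EJet) : ℝ × ℝ × (Fin n → ℝ) := (J.1, J.2.1, fun k => J.2.2 k)

/-- The direction `∂/∂z_k`. -/
def jetDir (k : ℕ) : EJet := (0, 0, Pi.single k 1)

/-- The direction of the total derivative at `J`. -/
def dxDir (J : EJet) : EJet := (0, 1, fun k => J.2.2 (k + 1))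

/-- The commutator of a constant field with the total derivative. -/
def shiftDir (v : EJet) : EJet := (0, 0, fun k => v.2.2 (k + 1))

theorem dxDir_add_smul (J v : EJet) (s : ℝ) : dxDir (J + s • v) = dxDir J + s • shiftDir v := by
  ext <;> simp [dxDir, shiftDir]

theorem shiftDir_jetDir_zero : shiftDir (jetDir 0) = 0 := by
  ext <;> simp [shiftDir, jetDir]

theorem shiftDir_jetDir_succ (k : ℕ) : shiftDir (jetDir (k + 1)) = jetDir k := by
  ext i
  · rfl
  · rfl
  · simp [shiftDir, jetDir, Pi.single_apply]

/-- Filling in the higher coordinates from a fixed jet `J` is a continuous section of the projection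
through `J`, so the image contains a neighbourhood of the projection of `J`. -/
theorem isOpen_jetProj_image (hΩ : IsOpen Ω) (n : ℕ) : IsOpen (jetProj n '' Ω) := by
  rw [isOpen_iff_mem_nhds]
  rintro _ ⟨J, hJ, rfl⟩
  let σ : ℝ × ℝ × (Fin n → ℝ) → EJet := fun y =>
    (y.1, y.2.1, fun k => if h : k < n then y.2.2 ⟨k, h⟩ else J.2.2 k)
  have hσ : Continuous σ := by
    refine continuous_fst.prodMk (continuous_snd.fst.prodMk (continuous_pi fun k => ?_))
    split_ifs <;> fun_prop
  have h0 : σ (jetProj n J) = J := by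
    ext k <;> simp [σ, jetProj]
  have h1 : ∀ y, jetProj n (σ y) = y := fun y => by
    ext k <;> simp [σ, jetProj]
  filter_upwards [hσ.continuousAt.preimage_mem_nhds (hΩ.mem_nhds (by rwa [h0]))] with y hy
  exact ⟨σ y, hy, h1 y⟩

theorem eventually_jetLine_mem (hΩ : IsOpen Ω) (hJ : J ∈ Ω) (v : EJet) :
    ∀ᶠ s : ℝ in nhds 0, J + s • v ∈ Ω := by
  have hc : Continuous fun s : ℝ => J + s • v := by fun_prop
  exact hc.continuousAt.preimage_mem_nhds (hΩ.mem_nhds (by simpa using hJ))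

theorem lineDeriv_congr_on (hΩ : IsOpen Ω) (h : ∀ J ∈ Ω, H J = H' J) (hJ : J ∈ Ω) (v : EJet) :
    lineDeriv ℝ H J v = lineDeriv ℝ H' J v := by
  refine Filter.EventuallyEq.deriv_eq ?_
  filter_upwards [eventually_jetLine_mem hΩ hJ v] with s hs using h _ hs

theorem hasLineDerivAt_of_jetProj {n : ℕ} {ψ : ℝ × ℝ × (Fin n → ℝ) → ℝ} (hΩ : IsOpen Ω)
    (hψ : ContDiffOn ℝ ∞ ψ (jetProj n '' Ω)) (hH : ∀ J ∈ Ω, H J = ψ (jetProj n J)) (hJ : J ∈ Ω)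
    (v : EJet) :
    HasDerivAt (fun s : ℝ => H (J + s • v)) (fderiv ℝ ψ (jetProj n J) (jetProj n v)) 0 := by
  have hm : jetProj n '' Ω ∈ nhds (jetProj n J) :=
    (isOpen_jetProj_image hΩ n).mem_nhds ⟨J, hJ, rfl⟩
  have hd : HasLineDerivAt ℝ ψ (fderiv ℝ ψ (jetProj n J) (jetProj n v)) (jetProj n J)
      (jetProj n v) :=
    ((hψ.contDiffAt hm).differentiableAt (by simp)).hasFDerivAt.hasLineDerivAt _
  refine HasDerivAt.congr_of_eventuallyEq hd ?_
  filter_upwards [eventually_jetLine_mem hΩ hJ v] with s hs using hH _ hs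

theorem IsDiffFun.hasDerivAt (h : IsDiffFun Ω H) (hΩ : IsOpen Ω) (hJ : J ∈ Ω) (v : EJet) :
    HasDerivAt (fun s : ℝ => H (J + s • v)) (lineDeriv ℝ H J v) 0 := by
  obtain ⟨n, ψ, hψ, hH⟩ := h
  have := hasLineDerivAt_of_jetProj hΩ hψ hH hJ v
  exact this.differentiableAt.hasDerivAt

/-- Commutation of a constant field with the total derivative. -/
theorem IsDiffFun.lineDeriv_Dx (h : IsDiffFun Ω H) (hΩ : IsOpen Ω) (hJ : J ∈ Ω) (v : EJet) :
    lineDeriv ℝ (Dx H) J v =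
      Dx (fun I => lineDeriv ℝ H I v) J + lineDeriv ℝ H J (shiftDir v) := by
  obtain ⟨n, ψ, hψ, hH⟩ := h
  have hd : ∀ I ∈ Ω, ∀ w, lineDeriv ℝ H I w = fderiv ℝ ψ (jetProj n I) (jetProj n w) :=
    fun I hI w => (hasLineDerivAt_of_jetProj hΩ hψ hH hI w).deriv
  have hm : jetProj n '' Ω ∈ nhds (jetProj n J) :=
    (isOpen_jetProj_image hΩ n).mem_nhds ⟨J, hJ, rfl⟩
  have hs := hψ.contDiffAt hm
  have hd2 : HasFDerivAt (fderiv ℝ ψ) (fderiv ℝ (fderiv ℝ ψ) (jetProj n J)) (jetProj n J) :=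
    ((hs.fderiv_right (m := 1)
      (WithTop.coe_le_coe.2 (le_top : (1 + 1 : ℕ∞) ≤ ⊤))).differentiableAt
      one_ne_zero).hasFDerivAt
  have hline : ∀ w : EJet, HasDerivAt (fun s : ℝ => fderiv ℝ ψ (jetProj n (J + s • w)))
      (fderiv ℝ (fderiv ℝ ψ) (jetProj n J) (jetProj n w)) 0 := fun w =>
    hd2.hasLineDerivAt (jetProj n w)
  -- The direction of D_x itself moves along J + s v; its rate of change `shiftDir v` contributes
  -- the second term of the product rule.
  have e1 : lineDeriv ℝ (Dx H) J v = fderiv ℝ (fderiv ℝ ψ) (jetProj n J) (jetProj n v)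
      (jetProj n (dxDir J)) + fderiv ℝ ψ (jetProj n J) (jetProj n (shiftDir v)) := by
    have hw : HasDerivAt (fun s : ℝ => jetProj n (dxDir (J + s • v))) (jetProj n (shiftDir v)) 0 := by
      simp only [dxDir_add_smul]
      have := (((hasDerivAt_id (0 : ℝ)).smul_const (jetProj n (shiftDir v))).const_add
        (jetProj n (dxDir J)))
      rw [one_smul] at this
      exact this
    have := (hline v).clm_apply hw
    simp only [zero_smul, add_zero] at this
    refine HasDerivAt.deriv (this.congr_of_eventuallyEq ?_)
    filter_upwards [eventually_jetLine_mem hΩ hJ v] with s hs using hd _ hs _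
  have e2 : Dx (fun I => lineDeriv ℝ H I v) J = fderiv ℝ (fderiv ℝ ψ) (jetProj n J)
      (jetProj n (dxDir J)) (jetProj n v) := by
    have := (hline (dxDir J)).clm_apply (hasDerivAt_const (0 : ℝ) (jetProj n v))
    simp only [map_zero, add_zero] at this
    refine HasDerivAt.deriv (this.congr_of_eventuallyEq ?_)
    filter_upwards [eventually_jetLine_mem hΩ hJ (dxDir J)] with s hs using hd _ hs _
  rw [e1, e2, hd J hJ, (hs.isSymmSndFDerivAt (by
    simpa using WithTop.coe_le_coe.2 (le_top : (2 : ℕ∞) ≤ ⊤))).eq]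

theorem IsDiffFun.exists_order (h : IsDiffFun Ω H) (hΩ : IsOpen Ω) :
    ∃ n, ∀ k, n ≤ k → ∀ J ∈ Ω, lineDeriv ℝ H J (jetDir k) = 0 := by
  obtain ⟨n, ψ, hψ, hH⟩ := h
  refine ⟨n, fun k hk J hJ => ?_⟩
  refine (hasLineDerivAt_of_jetProj hΩ hψ hH hJ _).deriv.trans ?_
  have : jetProj n (jetDir k) = 0 := by
    ext i
    · rfl
    · rfl
    · have : (i : ℕ) ≠ k := by omega
      simp [jetProj, jetDir, this]
  rw [this, map_zero]

/-- Descending induction on k, starting above the finite order of H: in ∂_{k+1}(D_x H) = D_x(∂_{k+1}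
H) + ∂_k H the left side vanishes by `h0` and the first term on the right by induction. -/
theorem IsDiffFun.lineDeriv_eq_zero_of_Dx (h : IsDiffFun Ω H) (hΩ : IsOpen Ω)
    (hR : ∀ J ∈ Ω, Dx H J = R J) {m : ℕ}
    (h0 : ∀ k, m ≤ k → ∀ J ∈ Ω, lineDeriv ℝ R J (jetDir (k + 1)) = 0) :
    ∀ k, m ≤ k → ∀ J ∈ Ω, lineDeriv ℝ H J (jetDir k) = 0 := by
  obtain ⟨n, hn⟩ := h.exists_order hΩ
  have key : ∀ d k, m ≤ k → n ≤ k + d → ∀ J ∈ Ω, lineDeriv ℝ H J (jetDir k) = 0 := by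
    intro d
    induction d with
    | zero => exact fun k _ hk => hn k hk
    | succ d ih =>
      intro k hk hkd J hJ
      have e1 := h.lineDeriv_Dx hΩ hJ (jetDir (k + 1))
      have e2 : Dx (fun I => lineDeriv ℝ H I (jetDir (k + 1))) J = 0 := by
        rw [Dx, lineDeriv_congr_on (H' := fun _ => 0) hΩ (ih (k + 1) (by omega) (by omega)) hJ]
        simp [lineDeriv]
      rw [lineDeriv_congr_on hΩ hR hJ, h0 k hk J hJ, e2, shiftDir_jetDir_succ, zero_add] at e1
      exact e1.symm
  exact fun k hk => key n k hk (by omega)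

/-- Lowest order part of the condition that `R` is a total derivative. -/
theorem IsDiffFun.lineDeriv_zero_eq_zero_of_Dx (h : IsDiffFun Ω H) (hΩ : IsOpen Ω)
    (hR : ∀ J ∈ Ω, Dx H J = R J)
    (h0 : ∀ k, ∀ J ∈ Ω, lineDeriv ℝ R J (jetDir (k + 1)) = 0) (hJ : J ∈ Ω) :
    lineDeriv ℝ R J (jetDir 0) = 0 := by
  -- H is free of every z_k. As ∂/∂z₀ commutes with D_x, the z₀-derivative of R is the total
  -- derivative of zero.
  have hz := h.lineDeriv_eq_zero_of_Dx hΩ hR (m := 0) fun k _ => h0 k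
  rw [← lineDeriv_congr_on hΩ hR hJ, h.lineDeriv_Dx hΩ hJ, shiftDir_jetDir_zero, Dx,
    lineDeriv_congr_on (H' := fun _ => 0) hΩ (hz 0 le_rfl) hJ]
  simp [lineDeriv]

theorem IsDiffFun.exists_of_le (h : IsDiffFun Ω H) : ∃ n, ∀ m, n ≤ m →
    ∃ ψ : ℝ × ℝ × (Fin m → ℝ) → ℝ, ContDiffOn ℝ ∞ ψ (jetProj m '' Ω) ∧
      ∀ J ∈ Ω, H J = ψ (jetProj m J) := by
  obtain ⟨n, ψ, hψ, hH⟩ := h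
  refine ⟨n, fun m hm => ⟨fun y => ψ (y.1, y.2.1, fun k => y.2.2 (Fin.castLE hm k)), ?_, hH⟩⟩
  refine hψ.comp (ContDiff.contDiffOn ?_) ?_
  · exact contDiff_fst.prodMk (contDiff_snd.fst.prodMk (contDiff_pi.2 fun k => by fun_prop))
  · rintro _ ⟨J, hJ, rfl⟩
    exact ⟨J, hJ, rfl⟩

theorem IsDiffFun.add (h : IsDiffFun Ω H) (h' : IsDiffFun Ω H') :
    IsDiffFun Ω fun J => H J + H' J := by
  obtain ⟨n, hn⟩ := h.exists_of_le
  obtain ⟨n', hn'⟩ := h'.exists_of_le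
  obtain ⟨ψ, s, e⟩ := hn (max n n') (le_max_left _ _)
  obtain ⟨ψ', s', e'⟩ := hn' (max n n') (le_max_right _ _)
  exact ⟨_, fun y => ψ y + ψ' y, s.add s', fun J hJ => congrArg₂ (· + ·) (e J hJ) (e' J hJ)⟩

theorem IsDiffFun.mul (h : IsDiffFun Ω H) (h' : IsDiffFun Ω H') :
    IsDiffFun Ω fun J => H J * H' J := by
  obtain ⟨n, hn⟩ := h.exists_of_le
  obtain ⟨n', hn'⟩ := h'.exists_of_le
  obtain ⟨ψ, s, e⟩ := hn (max n n') (le_max_left _ _)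
  obtain ⟨ψ', s', e'⟩ := hn' (max n n') (le_max_right _ _)
  exact ⟨_, fun y => ψ y * ψ' y, s.mul s', fun J hJ => congrArg₂ (· * ·) (e J hJ) (e' J hJ)⟩

theorem IsDiffFun.inv (h : IsDiffFun Ω H) (h0 : ∀ J ∈ Ω, H J ≠ 0) :
    IsDiffFun Ω fun J => (H J)⁻¹ := by
  obtain ⟨n, ψ, s, e⟩ := h
  refine ⟨n, fun y => (ψ y)⁻¹, s.inv ?_, fun J hJ => congrArg (·⁻¹) (e J hJ)⟩
  rintro _ ⟨J, hJ, rfl⟩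
  exact fun h => h0 J hJ ((e J hJ).trans h)

theorem IsDiffFun.div (h : IsDiffFun Ω H) (h' : IsDiffFun Ω H') (h0 : ∀ J ∈ Ω, H' J ≠ 0) :
    IsDiffFun Ω fun J => H J / H' J := by
  simpa only [div_eq_mul_inv] using h.mul (h'.inv h0)

theorem isDiffFun_const (c : ℝ) : IsDiffFun Ω fun _ => c :=
  ⟨0, fun _ => c, contDiffOn_const, fun _ _ => rfl⟩

theorem isDiffFun_time : IsDiffFun Ω fun J => J.1 :=
  ⟨0, fun y => y.1, contDiff_fst.contDiffOn, fun _ _ => rfl⟩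

theorem isDiffFun_coord (k : ℕ) : IsDiffFun Ω fun J => J.2.2 k :=
  ⟨k + 1, fun y => y.2.2 ⟨k, k.lt_succ_self⟩, ContDiff.contDiffOn (by fun_prop), fun _ _ => rfl⟩

end DiffFun

/-! ### Obstructions to locality under the exchange of x and z. -/

section Nonlocal

variable {Ω : Set EJet} {g h : EJet → ℝ} {J v : EJet} {F : EJet → ℝ} {X : VField} {K : ℝ → ℝ}

theorem hasDerivAt_jet_coord (J v : EJet) (k : ℕ) :
    HasDerivAt (fun s : ℝ => (J + s • v).2.2 k) (v.2.2 k) 0 := by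
  simpa using hasDerivAt_affine (J.2.2 k) (v.2.2 k)

theorem hasDerivAt_jet_time (J v : EJet) :
    HasDerivAt (fun s : ℝ => (J + s • v).1) v.1 0 := by
  simpa using hasDerivAt_affine J.1 v.1

theorem Dx_one_div (h : J.2.2 1 ≠ 0) :
    Dx (fun I => 1 / I.2.2 1) J = -J.2.2 2 / J.2.2 1 ^ 2 := by
  refine HasDerivAt.deriv ?_
  refine ((hasDerivAt_const (0 : ℝ) (1 : ℝ)).div (hasDerivAt_jet_coord J (dxDir J) 1)
    (by simpa using h)).congr_deriv ?_
  simp [dxDir]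

/-- The equation `hodoVariation = hodoChar`, solved for the total derivative of `g / z₁`. -/
theorem Dx_div_of_hodoVariation (h1 : J.2.2 1 ≠ 0) (h : hodoVariation g J = hodoChar F X J) :
    Dx (fun I => g I / I.2.2 1) J = -J.2.2 1 * X (hodoPoint J) 2
      - X (hodoPoint J) 1 * J.2.2 2 / J.2.2 1 ^ 2
      - X (hodoPoint J) 0 * Dx (fun I => F I / I.2.2 1) J := by
  rw [hodoChar, Dx_one_div h1, hodoVariation, hodoVariation] at h
  field_simp at h ⊢
  linear_combination -h

theorem eq_zero_of_hasDerivAt {f : EJet → ℝ} {d : ℝ} (hΩ : IsOpen Ω) (hf : ∀ J ∈ Ω, f J = 0)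
    (hJ : J ∈ Ω) (hd : HasDerivAt (fun s : ℝ => f (J + s • v)) d 0) : d = 0 := by
  rw [← hd.deriv, Filter.EventuallyEq.deriv_eq (f := fun _ => 0), deriv_const]
  filter_upwards [eventually_jetLine_mem hΩ hJ v] with s hs using hf _ hs

/-- No variation of `z` induces a field with the components `ξ = a t + b₀ + b₂ y²` and
`η = (e y + f) ω`, unless `e + 2 b₂ = 0`. -/
theorem not_hodoVariation_quadratic {a b₀ b₂ e f : ℝ} (hΩ : IsOpen Ω) (hne : Ω.Nonempty)
    (h1 : ∀ J ∈ Ω, J.2.2 1 ≠ 0) (hX : ∀ J ∈ Ω, X (hodoPoint J) = ![0, a * J.1 + b₀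
      + b₂ * J.2.2 0 ^ 2, (e * J.2.2 0 + f) * (1 / J.2.2 1)]) (he : e + 2 * b₂ ≠ 0)
    (hg : IsDiffFun Ω g) : ¬ ∀ J ∈ Ω, hodoVariation g J = hodoChar F X J := by
  intro hvar
  have hP : IsDiffFun Ω fun J => g J / J.2.2 1 := hg.div (isDiffFun_coord 1) h1
  -- Subtracting ξ/z₁ from g/z₁ removes the term in z₂. What is left, −((e + 2b₂)z₀ + f), would be a
  -- total derivative while depending on z₀ alone.
  have hH : IsDiffFun Ω fun J => g J / J.2.2 1 +
      (a * J.1 + b₀ + b₂ * (J.2.2 0 * J.2.2 0)) * -(1 / J.2.2 1) := by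
    have := hP.add ((((((isDiffFun_const a).mul isDiffFun_time).add (isDiffFun_const b₀)).add
      ((isDiffFun_const b₂).mul ((isDiffFun_coord 0).mul (isDiffFun_coord 0)))).mul
      ((isDiffFun_const (-1)).div (isDiffFun_coord 1) h1)))
    simpa only [neg_div] using this
  have hR : ∀ J ∈ Ω, Dx (fun J => g J / J.2.2 1 +
      (a * J.1 + b₀ + b₂ * (J.2.2 0 * J.2.2 0)) * -(1 / J.2.2 1)) J
      = -((e + 2 * b₂) * J.2.2 0 + f) := fun J hJ => by
    have e1 := Dx_div_of_hodoVariation (h1 J hJ) (hvar J hJ)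
    have c0 := hasDerivAt_jet_coord J (dxDir J) 0
    have c1 := hasDerivAt_jet_coord J (dxDir J) 1
    have h1J := h1 J hJ
    have d := (hP.hasDerivAt hΩ hJ (dxDir J)).add
      ((((((hasDerivAt_jet_time J (dxDir J)).const_mul a).add_const b₀).add
        ((c0.mul c0).const_mul b₂))).mul
        (((hasDerivAt_const (0 : ℝ) (1 : ℝ)).div c1 (by simpa using h1J)).neg))
    refine (HasDerivAt.deriv d).trans ?_
    rw [show lineDeriv ℝ (fun J => g J / J.2.2 1) J (dxDir J) = _ from e1, hX J hJ]
    simp [dxDir]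
    field_simp
    ring
  obtain ⟨J, hJ⟩ := hne
  have hd : ∀ k (J : EJet), lineDeriv ℝ (fun J : EJet => -((e + 2 * b₂) * J.2.2 0 + f)) J
      (jetDir k) = -((e + 2 * b₂) * (jetDir k).2.2 0) := fun k J =>
    HasDerivAt.deriv (((hasDerivAt_jet_coord J (jetDir k) 0).const_mul _).add_const f).neg
  have := hH.lineDeriv_zero_eq_zero_of_Dx hΩ hR (fun k J _ => by rw [hd]; simp [jetDir]) hJ
  rw [hd] at this
  simp [jetDir] at this
  exact he (by linear_combination -this)

/-- The field `V₇`. -/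
theorem not_hodoVariation_V₇ (hΩ : IsOpen Ω) (hne : Ω.Nonempty)
    (h1 : ∀ J ∈ Ω, J.2.2 1 ≠ 0) (hF : IsDiffFun Ω F)
    (hg : IsDiffFun Ω g) : ¬ ∀ J ∈ Ω, hodoVariation g J = hodoChar F V₇ J := by
  intro hvar
  have hP : IsDiffFun Ω fun J => g J / J.2.2 1 := hg.div (isDiffFun_coord 1) h1
  have hQ : IsDiffFun Ω fun J => F J / J.2.2 1 := hF.div (isDiffFun_coord 1) h1
  -- The corrections 4t z₀/z₁ and 4t² F/z₁ come from the v- and t-components of `V₇`. The remainder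
  -- z₀² − 2t can be a total derivative only where z₀ = 0, which is impossible on a nonempty open
  -- set.
  have hH : IsDiffFun Ω fun J => g J / J.2.2 1 + -4 * (J.1 * (J.2.2 0 / J.2.2 1)) +
      4 * (J.1 * J.1 * (F J / J.2.2 1)) :=
    (hP.add ((isDiffFun_const _).mul (isDiffFun_time.mul
      ((isDiffFun_coord 0).div (isDiffFun_coord 1) h1)))).add
      ((isDiffFun_const _).mul ((isDiffFun_time.mul isDiffFun_time).mul hQ))
  have hR : ∀ J ∈ Ω, Dx (fun J => g J / J.2.2 1 + -4 * (J.1 * (J.2.2 0 / J.2.2 1)) +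
      4 * (J.1 * J.1 * (F J / J.2.2 1))) J = J.2.2 0 ^ 2 - 2 * J.1 := fun J hJ => by
    have e1 := Dx_div_of_hodoVariation (h1 J hJ) (hvar J hJ)
    have c0 := hasDerivAt_jet_coord J (dxDir J) 0
    have c1 := hasDerivAt_jet_coord J (dxDir J) 1
    have ct := hasDerivAt_jet_time J (dxDir J)
    have h1J := h1 J hJ
    have d := ((hP.hasDerivAt hΩ hJ (dxDir J)).add
      ((ct.mul (c0.div c1 (by simpa using h1J))).const_mul (-4))).add
      (((ct.mul ct).mul (hQ.hasDerivAt hΩ hJ (dxDir J))).const_mul 4)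
    refine (HasDerivAt.deriv d).trans ?_
    rw [show lineDeriv ℝ (fun J => g J / J.2.2 1) J (dxDir J) = _ from e1,
      show lineDeriv ℝ (fun J => F J / J.2.2 1) J (dxDir J) = Dx (fun J => F J / J.2.2 1) J from rfl]
    simp [dxDir, V₇, hodoPoint]
    field_simp
    ring
  have hd : ∀ k (J : EJet), lineDeriv ℝ (fun J : EJet => J.2.2 0 ^ 2 - 2 * J.1) J
      (jetDir k) = 2 * J.2.2 0 * (jetDir k).2.2 0 := fun k J => by
    refine HasDerivAt.deriv ((((hasDerivAt_jet_coord J (jetDir k) 0).pow 2).sub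
      ((hasDerivAt_jet_time J (jetDir k)).const_mul 2)).congr_deriv ?_)
    simp [jetDir]
  have key : ∀ J ∈ Ω, J.2.2 0 = 0 := fun J hJ => by
    have := hH.lineDeriv_zero_eq_zero_of_Dx hΩ hR (fun k J _ => by rw [hd]; simp [jetDir]) hJ
    rw [hd] at this
    simpa [jetDir] using this
  obtain ⟨J, hJ⟩ := hne
  have := eq_zero_of_hasDerivAt hΩ key hJ (hasDerivAt_jet_coord J (jetDir 0) 0)
  simp [jetDir] at this

theorem Dx_eq_of_div (hΩ : IsOpen Ω) (h1 : ∀ J ∈ Ω, J.2.2 1 ≠ 0) (hh : IsDiffFun Ω h)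
    (hJ : J ∈ Ω) : Dx h J = Dx (fun J => h J / J.2.2 1) J * J.2.2 1
      + h J / J.2.2 1 * J.2.2 2 := by
  have hP : IsDiffFun Ω fun J => h J / J.2.2 1 := hh.div (isDiffFun_coord 1) h1
  have e := lineDeriv_congr_on (H' := fun J => h J / J.2.2 1 * J.2.2 1) hΩ
    (fun J hJ => (div_mul_cancel₀ _ (h1 J hJ)).symm) hJ (dxDir J)
  refine e.trans (HasDerivAt.deriv (((hP.hasDerivAt hΩ hJ _).mul
    (hasDerivAt_jet_coord J (dxDir J) 1)).congr_deriv ?_))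
  simp only [zero_smul, add_zero]
  rfl

/-- `derivJet` forgets z₀: a local variation of u = v_x cannot depend on the value of the potential
v. -/
theorem lineDeriv_comp_derivJet (hΩ : IsOpen Ω) (hD : ∀ J ∈ Ω, Dx h J = g (derivJet J))
    (hJ : J ∈ Ω) : lineDeriv ℝ (Dx h) J (jetDir 0) = 0 := by
  rw [lineDeriv_congr_on hΩ hD hJ]
  have : ∀ s : ℝ, derivJet (J + s • jetDir 0) = derivJet J := fun s => by
    ext <;> simp [derivJet, jetDir]
  simp [lineDeriv, this]

/-- The fields `G(t, v) ∂_w`. -/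
theorem eq_zero_of_hodoVariation_VInf {S : Set (ℝ × ℝ)} {G : ℝ × ℝ → ℝ} (hΩ : IsOpen Ω)
    (h1 : ∀ J ∈ Ω, J.2.2 1 ≠ 0) (hS : IsOpen S) (hG : ContDiffOn ℝ ∞ G S)
    (hm : ∀ J ∈ Ω, (J.1, J.2.2 0) ∈ S) (hh : IsDiffFun Ω h)
    (hD : ∀ J ∈ Ω, Dx h J = g (derivJet J))
    (hvar : ∀ J ∈ Ω, hodoVariation h J = hodoChar F (VInf G) J) :
    ∀ J ∈ Ω, G (J.1, J.2.2 0) = 0 := by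
  have hP : IsDiffFun Ω fun J => h J / J.2.2 1 := hh.div (isDiffFun_coord 1) h1
  have hR : ∀ J ∈ Ω, Dx (fun J => h J / J.2.2 1) J = -J.2.2 1 * G (J.1, J.2.2 0) := fun J hJ => by
    rw [Dx_div_of_hodoVariation (h1 J hJ) (hvar J hJ)]
    simp [VInf, hodoPoint]
  have hRd : ∀ k (J : EJet), lineDeriv ℝ (fun J : EJet => -J.2.2 1 * G (J.1, J.2.2 0)) J
      (jetDir (k + 1)) = -(jetDir (k + 1)).2.2 1 * G (J.1, J.2.2 0) := fun k J => by
    have e : ∀ s : ℝ, ((J + s • jetDir (k + 1)).1, (J + s • jetDir (k + 1)).2.2 0)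
        = (J.1, J.2.2 0) := fun s => by simp [jetDir]
    refine HasDerivAt.deriv ?_
    simp only [e]
    exact (hasDerivAt_jet_coord J (jetDir (k + 1)) 1).neg.mul_const _
  have hP1 := hP.lineDeriv_eq_zero_of_Dx hΩ hR (m := 1) fun k hk J _ => by
    rw [hRd]
    have : (jetDir (k + 1)).2.2 1 = 0 := Pi.single_eq_of_ne (by omega) _
    simp [this]
  -- Since h/z₁ is free of z₁, applying ∂/∂z₁ to D_x(h/z₁) = −z₁ G leaves only the commutator term
  -- ∂(h/z₁)/∂z₀.
  have hP0 : ∀ J ∈ Ω, lineDeriv ℝ (fun J => h J / J.2.2 1) J (jetDir 0) = -G (J.1, J.2.2 0) :=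
    fun J hJ => by
    have e1 := hP.lineDeriv_Dx hΩ hJ (jetDir 1)
    have e2 : Dx (fun I => lineDeriv ℝ (fun J => h J / J.2.2 1) I (jetDir 1)) J = 0 := by
      rw [Dx, lineDeriv_congr_on (H' := fun _ => 0) hΩ (hP1 1 le_rfl) hJ]
      simp [lineDeriv]
    rw [lineDeriv_congr_on hΩ hR hJ, hRd 0 J, e2, shiftDir_jetDir_succ 0, zero_add, zero_add] at e1
    rw [← e1]
    simp [jetDir]
  -- This is the vanishing z₀-derivative of D_x h = −z₁² G + (h/z₁) z₂. Since z₂ is a free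
  -- coordinate, its coefficient G must vanish; that is the last step.
  have key : ∀ J ∈ Ω, J.2.2 1 ^ 2 * lineDeriv ℝ G (J.1, J.2.2 0) (0, 1)
      + G (J.1, J.2.2 0) * J.2.2 2 = 0 := fun J hJ => by
    have e0 := lineDeriv_comp_derivJet hΩ hD hJ
    have e1 : ∀ J ∈ Ω, Dx h J = -J.2.2 1 * G (J.1, J.2.2 0) * J.2.2 1
        + h J / J.2.2 1 * J.2.2 2 := fun J hJ => by
      rw [Dx_eq_of_div hΩ h1 hh hJ, hR J hJ]
    have c1 := hasDerivAt_jet_coord J (jetDir 0) 1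
    have c2 := hasDerivAt_jet_coord J (jetDir 0) 2
    have cG : HasDerivAt (fun s : ℝ => G ((J + s • jetDir 0).1, (J + s • jetDir 0).2.2 0))
        (lineDeriv ℝ G (J.1, J.2.2 0) (0, 1)) 0 := by
      have hd : DifferentiableAt ℝ G (J.1, J.2.2 0) :=
        (hG.contDiffAt (hS.mem_nhds (hm J hJ))).differentiableAt (by simp)
      have := hd.hasFDerivAt.hasLineDerivAt (0, 1)
      rw [hd.lineDeriv_eq_fderiv]
      refine HasDerivAt.congr_of_eventuallyEq this (Filter.Eventually.of_forall fun s => ?_)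
      simp [jetDir]
    rw [lineDeriv_congr_on hΩ e1 hJ] at e0
    have d := ((c1.neg.mul cG).mul c1).add ((hP.hasDerivAt hΩ hJ (jetDir 0)).mul c2)
    have := (HasDerivAt.deriv d).symm.trans e0
    rw [hP0 J hJ] at this
    simp [jetDir] at this
    linear_combination -this
  intro J hJ
  have c1 := hasDerivAt_jet_coord J (jetDir 2) 1
  have c2 := hasDerivAt_jet_coord J (jetDir 2) 2
  have e : ∀ s : ℝ, ((J + s • jetDir 2).1, (J + s • jetDir 2).2.2 0) = (J.1, J.2.2 0) :=
    fun s => by simp [jetDir]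
  have := eq_zero_of_hasDerivAt (v := jetDir 2) hΩ key hJ (d := G (J.1, J.2.2 0)) (by
    simp only [e]
    refine (((c1.pow 2).mul_const _).add (c2.const_mul _)).congr_deriv ?_
    simp [jetDir])
  exact this

/-- The field `V₈`. -/
theorem not_hodoVariation_V₈ (hΩ : IsOpen Ω) (hne : Ω.Nonempty) (h1 : ∀ J ∈ Ω, J.2.2 1 ≠ 0)
    (hh : IsDiffFun Ω h) (hD : ∀ J ∈ Ω, Dx h J = g (derivJet J)) :
    ¬ ∀ J ∈ Ω, hodoVariation h J = hodoChar F V₈ J := by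
  intro hvar
  have hP : IsDiffFun Ω fun J => h J / J.2.2 1 := hh.div (isDiffFun_coord 1) h1
  have hR : ∀ J ∈ Ω, Dx (fun J => h J / J.2.2 1) J
      = -2 * J.2.2 1 - J.2.2 0 * J.2.2 2 / J.2.2 1 ^ 2 := fun J hJ => by
    rw [Dx_div_of_hodoVariation (h1 J hJ) (hvar J hJ)]
    simp [V₈, hodoPoint]
    ring
  -- The added terms leave D_x of the sum equal to −1, so the sum is free of every z_k. This
  -- determines the z₀-derivative of h/z₁.
  have hH : IsDiffFun Ω fun J => h J / J.2.2 1 + (2 * J.2.2 0 + -1 * (J.2.2 0 / J.2.2 1)) :=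
    hP.add (((isDiffFun_const _).mul (isDiffFun_coord 0)).add
      ((isDiffFun_const _).mul ((isDiffFun_coord 0).div (isDiffFun_coord 1) h1)))
  have hd : ∀ J ∈ Ω, ∀ v, HasDerivAt (fun s : ℝ => (fun J : EJet => h J / J.2.2 1
      + (2 * J.2.2 0 + -1 * (J.2.2 0 / J.2.2 1))) (J + s • v))
      (lineDeriv ℝ (fun J => h J / J.2.2 1) J v + (2 * v.2.2 0 -
        (v.2.2 0 * J.2.2 1 - J.2.2 0 * v.2.2 1) / J.2.2 1 ^ 2)) 0 := fun J hJ v => by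
    have c0 := hasDerivAt_jet_coord J v 0
    have c1 := hasDerivAt_jet_coord J v 1
    refine ((hP.hasDerivAt hΩ hJ v).add ((c0.const_mul 2).add
      ((c0.div c1 (by simpa using h1 J hJ)).const_mul (-1)))).congr_deriv ?_
    simp
    ring
  have hHx : ∀ J ∈ Ω, Dx (fun J => h J / J.2.2 1 + (2 * J.2.2 0 + -1 * (J.2.2 0 / J.2.2 1))) J
      = -1 := fun J hJ => by
    have h1J := h1 J hJ
    refine (hd J hJ (dxDir J)).deriv.trans ?_
    rw [show lineDeriv ℝ (fun J => h J / J.2.2 1) J (dxDir J) = _ from hR J hJ]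
    simp only [dxDir]
    field_simp
    ring
  have hP0 : ∀ J ∈ Ω, lineDeriv ℝ (fun J => h J / J.2.2 1) J (jetDir 0) = -2 + 1 / J.2.2 1 :=
    fun J hJ => by
    have h1J := h1 J hJ
    have e := hH.lineDeriv_eq_zero_of_Dx hΩ hHx (m := 0) (fun k _ J _ => by simp [lineDeriv]) 0
      le_rfl J hJ
    replace e := (hd J hJ (jetDir 0)).deriv.symm.trans e
    have j0 : (jetDir 0).2.2 0 = 1 := by simp [jetDir]
    have j1 : (jetDir 0).2.2 1 = 0 := by simp [jetDir]
    rw [j0, j1] at e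
    field_simp at e ⊢
    refine mul_left_cancel₀ h1J ?_
    linear_combination e
  -- The z₀-derivative of D_x h simplifies to −2z₂. It must vanish for a local variation of u, yet
  -- z₂ is free on an open set.
  have key : ∀ J ∈ Ω, J.2.2 2 = 0 := fun J hJ => by
    have h1J := h1 J hJ
    have e0 := lineDeriv_comp_derivJet hΩ hD hJ
    have e1 : ∀ J ∈ Ω, Dx h J = (-2 * J.2.2 1 - J.2.2 0 * J.2.2 2 / J.2.2 1 ^ 2) * J.2.2 1
        + h J / J.2.2 1 * J.2.2 2 := fun J hJ => by
      rw [Dx_eq_of_div hΩ h1 hh hJ, hR J hJ]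
    have c0 := hasDerivAt_jet_coord J (jetDir 0) 0
    have c1 := hasDerivAt_jet_coord J (jetDir 0) 1
    have c2 := hasDerivAt_jet_coord J (jetDir 0) 2
    rw [lineDeriv_congr_on hΩ e1 hJ] at e0
    have d := ((((c1.const_mul (-2)).sub ((c0.mul c2).div (c1.pow 2) (by simpa using h1J))).mul
      c1)).add ((hP.hasDerivAt hΩ hJ (jetDir 0)).mul c2)
    have := (HasDerivAt.deriv d).symm.trans e0
    rw [hP0 J hJ] at this
    simp [jetDir] at this
    field_simp at this
    have : J.2.2 1 * J.2.2 2 = 0 := by linear_combination -this / 2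
    exact (mul_eq_zero.1 this).resolve_left h1J
  obtain ⟨J, hJ⟩ := hne
  have := eq_zero_of_hasDerivAt hΩ key hJ (hasDerivAt_jet_coord J (jetDir 2) 2)
  simp [jetDir] at this

end Nonlocal

/-! ### The individual fields, and the assembly of the theorem. -/

section Assembly

variable {Ω : Set EJet} {B : Set (Fin 3 → ℝ)} {X Y : VField} {K : ℝ → ℝ} {U : Set ℝ}
  {S : Set (ℝ × ℝ)} {a b₀ b₂ e f : ℝ}

theorem pushesTo_invCoord (h : ∀ q : Fin 3 → ℝ, q 2 ≠ 0 →
    Y (invCoord q) = ![X q 0, X q 1, -X q 2 / q 2 ^ 2]) : PushesTo invCoord {q | q 2 ≠ 0} X Y := by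
  intro q hq
  have hq : q 2 ≠ 0 := hq
  rw [h q hq, fderiv_apply_eq (d := ![X q 0, X q 1, -X q 2 / q 2 ^ 2])]
  · have : ∀ i : Fin 3, DifferentiableAt ℝ (fun q => invCoord q i) q := fun i => by
      fin_cases i <;> simp [invCoord] <;> fun_prop (disch := assumption)
    exact differentiableAt_pi.2 this
  · have d := fun i => hasDerivAt_jet_apply q (X q) i
    refine hasDerivAt_vec3 (d 0) (d 1)
      (((hasDerivAt_const (0 : ℝ) (1 : ℝ)).div (d 2) (by simpa using hq)).congr_deriv ?_)
    simp

theorem isOpenInterval_Ioi : IsOpenInterval (Set.Ioi (0 : ℝ)) :=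
  ⟨isOpen_Ioi, Set.nonempty_Ioi, Set.ordConnected_Ioi⟩

theorem isPower_Ioi (μ : ℝ) : IsPower μ (Set.Ioi 0) fun u => u ^ μ := ⟨subset_rfl, fun _ _ => rfl⟩

theorem coord_one_ne_zero_of_mem_domW {J : EJet} (h : hodoPoint J ∈ domW S U) : J.2.2 1 ≠ 0 :=
  fun e => h.2.1 (by simp [hodoPoint, e])

theorem yieldsNonlocalV_of_quadratic (hX : IsPointSymmetry (pdeW K) (domW S U) X)
    (hq : ∀ q, X q = ![0, a * q 0 + b₀ + b₂ * q 1 ^ 2, (e * q 1 + f) * q 2])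
    (he : e + 2 * b₂ ≠ 0) : YieldsNonlocalV K (domW S U) X := by
  refine ⟨hX, fun Ω hΩ hB ⟨J, hJ, _⟩ ⟨g, hg, hvar⟩ => ?_⟩
  exact not_hodoVariation_quadratic hΩ ⟨J, hJ⟩ (fun J hJ => coord_one_ne_zero_of_mem_domW (hB J hJ))
    (fun J _ => hq _) he hg.1 hvar

theorem yieldsNonlocalU_of_quadratic (hX : IsPointSymmetry (pdeW K) (domW S U) X)
    (hq : ∀ q, X q = ![0, a * q 0 + b₀ + b₂ * q 1 ^ 2, (e * q 1 + f) * q 2])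
    (he : e + 2 * b₂ ≠ 0) : YieldsNonlocalU K (domW S U) X := by
  refine ⟨hX, fun Ω hΩ hB ⟨J, hJ, _⟩ ⟨g, h, _, hh, hvar⟩ => ?_⟩
  exact not_hodoVariation_quadratic hΩ ⟨J, hJ⟩ (fun J hJ => coord_one_ne_zero_of_mem_domW (hB J hJ))
    (fun J _ => hq _) he hh fun J hJ => (hvar J hJ).2

theorem yieldsNonlocalP_of_quadratic (hX : IsPointSymmetry (pdeP K) B X)
    (hB : ∀ q ∈ B, q 2 ≠ 0)
    (hq : ∀ q, X q = ![0, a * q 0 + b₀ + b₂ * q 1 ^ 2, (e * q 1 + f) * q 2])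
    (he : e + 2 * b₂ ≠ 0) : YieldsNonlocalP K B X := by
  refine ⟨hX, fun Ω hΩ hΩB ⟨J, hJ, _⟩ ⟨g, hg, hvar⟩ => ?_⟩
  exact not_hodoVariation_quadratic hΩ ⟨J, hJ⟩
    (fun J hJ h0 => hB _ (hΩB J hJ) (by simp [hodoPoint, h0])) (fun J _ => hq _) he hg.1 hvar

theorem isPointSymmetry_V₅ :
    IsPointSymmetry (pdeW fun u => u ^ (-2 / 3 : ℝ)) (domW Set.univ (Set.Ioi 0)) V₅ :=
  isPointSymmetry_pdeW_power_special isOpen_Ioi isOpen_univ (isPower_Ioi _) 0 0 0 0 1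
    fun q _ => by simp [V₅]

theorem V₅_eq (q : Fin 3 → ℝ) :
    V₅ q = ![0, 0 * q 0 + 0 + -1 * q 1 ^ 2, (3 * q 1 + 0) * q 2] := by
  simp [V₅]

theorem isHeatSolution_zero : IsHeatSolution S fun _ => 0 :=
  ⟨contDiffOn_const, fun s _ => by simp [lineDeriv]⟩

theorem yieldsNonlocalU_V₆ :
    YieldsNonlocalU (fun u => u ^ (-2 : ℝ)) (domW Set.univ (Set.Ioi 0)) V₆ := by
  refine yieldsNonlocalU_of_quadratic (a := 2) (b₀ := 0) (b₂ := 0) (e := -1) (f := 0)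
    (isPointSymmetry_pdeW_heat isOpen_Ioi isOpen_univ (isPower_Ioi _) isHeatSolution_zero 0 0 0 0 1
      0 fun q _ => by simp [V₆]) (fun q => by simp [V₆]) (by norm_num)

theorem yieldsNonlocalU_V₇ :
    YieldsNonlocalU (fun u => u ^ (-2 : ℝ)) (domW Set.univ (Set.Ioi 0)) V₇ := by
  refine ⟨isPointSymmetry_pdeW_heat isOpen_Ioi isOpen_univ (isPower_Ioi _) isHeatSolution_zero 0 0 0
    0 0 1 fun q _ => ?_, fun Ω hΩ hB ⟨J, hJ, _⟩ ⟨g, h, _, hh, hvar⟩ => ?_⟩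
  · ext i
    fin_cases i <;> simp [V₇] <;> ring
  · have h1 : ∀ J ∈ Ω, J.2.2 1 ≠ 0 := fun J hJ => coord_one_ne_zero_of_mem_domW (hB J hJ)
    refine not_hodoVariation_V₇ hΩ ⟨J, hJ⟩ h1 ?_ hh fun J hJ => (hvar J hJ).2
    -- Over this domain z₁ > 0, so the real power z₁^(−2) is the inverse of z₁ · z₁ and the
    -- right-hand side is a differential function.
    obtain ⟨n, ψ, s, hψ⟩ := (((isDiffFun_coord 1).mul (isDiffFun_coord 1)).inv
      fun J hJ => mul_ne_zero (h1 J hJ) (h1 J hJ)).mul (isDiffFun_coord (Ω := Ω) 2)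
    refine ⟨n, ψ, s, fun J hJ => (?_ : _ = _).trans (hψ J hJ)⟩
    have hpos : 0 < J.2.2 1 := by
      have : 1 / (1 / J.2.2 1) ∈ Set.Ioi (0 : ℝ) := (hB J hJ).2.2
      simpa using this
    rw [rhsV, Real.rpow_neg hpos.le, Real.rpow_two, pow_two]

theorem yieldsNonlocalU_VInf {G : ℝ × ℝ → ℝ} (hS : IsOpen S) (hG : IsHeatSolution S G) :
    YieldsNonlocalU (fun u => u ^ (-2 : ℝ)) (domW S (Set.Ioi 0)) (VInf G) := by
  refine ⟨isPointSymmetry_pdeW_heat isOpen_Ioi hS (isPower_Ioi _) hG 0 0 0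
    0 0 0 fun q _ => by simp [VInf], fun Ω hΩ hB ⟨J, hJ, hX⟩ ⟨g, h, _, hh, hvar⟩ => hX ?_⟩
  have := eq_zero_of_hodoVariation_VInf hΩ
    (fun J hJ => coord_one_ne_zero_of_mem_domW (hB J hJ)) hS hG.1 (fun J hJ => (hB J hJ).1) hh
    (fun J hJ => (hvar J hJ).1) (fun J hJ => (hvar J hJ).2) J hJ
  simp [VInf, hodoPoint, this]

theorem yieldsNonlocalU_V₈ :
    YieldsNonlocalU (fun u => Real.exp (1 / u) * (u ^ 2)⁻¹) (domW Set.univ {0}ᶜ) V₈ := by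
  refine ⟨isPointSymmetry_pdeW_expInv isOpen_compl_singleton (by simp) isOpen_univ
    (fun u _ => rfl) 0 0 0 1 fun q _ => by simp [V₈],
    fun Ω hΩ hB ⟨J, hJ, _⟩ ⟨g, h, _, hh, hvar⟩ => ?_⟩
  exact not_hodoVariation_V₈ hΩ ⟨J, hJ⟩ (fun J hJ => coord_one_ne_zero_of_mem_domW (hB J hJ)) hh
    (fun J hJ => (hvar J hJ).1) fun J hJ => (hvar J hJ).2

theorem yieldsNonlocalP_W₅ (l : ℝ) :
    YieldsNonlocalP (fun u => 1 / (1 + u ^ 2) * Real.exp (l * Real.arctan u))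
      {q | q 2 ≠ 0} (W₅ l) := by
  have hU : IsOpenInterval (Set.univ : Set ℝ) := ⟨isOpen_univ, Set.univ_nonempty, Set.ordConnected_univ⟩
  have hA : IsArctan l Set.univ fun u => 1 / (1 + u ^ 2) * Real.exp (l * Real.arctan u) :=
    fun _ _ => rfl
  have hK := hA.isConstitutive hU
  -- The obstruction e + 2b₂ equals −6 + 4 = −2, whatever l is.
  refine yieldsNonlocalP_of_quadratic (a := 0) (b₀ := 2) (b₂ := 2) (e := -6) (f := l)
    (isPointSymmetry_pdeP_of_solution (c := 0) (d := 0) (c₀ := 2) (c₁ := 0) (c₂ := 2)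
      (α := l * 2) hK.1.1 hK.2.1 hK.2.2 (isOpen_ne_fun (by fun_prop) (by fun_prop))
      (fun _ _ => trivial) (fun q hq => hq) (fun q _ => (hA.solP_iff hU).2 (by simp) _ trivial)
      fun q _ => ?_) (fun q hq => hq) (fun q => ?_) (by norm_num)
  · ext i
    fin_cases i <;> simp [W₅] <;> ring
  · ext i
    fin_cases i <;> simp [W₅] <;> ring

theorem yieldsNonlocalP_W₆ :
    YieldsNonlocalP (fun u => u ^ (-2 : ℝ)) {q | 0 < q 1 ∧ q 2 ≠ 0} W₆ := by
  have hU := isOpenInterval_Ioi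
  have hK := (isPower_Ioi (-2)).isConstitutive hU
  have hB : IsOpen {q : Fin 3 → ℝ | 0 < q 1 ∧ q 2 ≠ 0} :=
    (isOpen_lt continuous_const (continuous_apply 1)).inter
      (isOpen_ne_fun (by fun_prop) (by fun_prop))
  refine yieldsNonlocalP_of_quadratic (a := 0) (b₀ := 0) (b₂ := 1) (e := -3) (f := 0)
    (isPointSymmetry_pdeP_of_solution (c := 0) (d := 0) (c₀ := 0) (c₁ := 0) (c₂ := 1)
      (α := 0) hK.1.1 hK.2.1 hK.2.2 hB (fun _ hq => hq.1) (fun q hq => hq.2)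
      (fun q hq => ((isPower_Ioi (-2)).solP_iff hU).2 (by simp) _ hq.1)
      fun q _ => ?_) (fun q hq => hq.2) (fun q => ?_) (by norm_num)
  · ext i
    fin_cases i <;> simp [W₆]
    ring
  · ext i
    fin_cases i <;> simp [W₆]
    ring

end Assembly

theorem mainTheorem7 :
    -- I. The class `w_t = (K(1/w) w_v / w^2)_v`.
    -- The stated transformations are equivalence transformations: they carry symmetries to
    -- symmetries.
    (∀ (a₁ a₂ a₃ a₄ a₅ a₆ : ℝ) (U U' : Set ℝ) (K K' : ℝ → ℝ) (S : Set (ℝ × ℝ)) (X X' : VField),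
      IsConstitutive U K → 0 ∉ U → EquivW a₁ a₂ a₃ a₄ a₅ a₆ U K U' K' → IsOpen S →
      PushesTo (equivMapW a₁ a₂ a₃ a₄ a₅ a₆) (domW S U) X X' →
      (IsPointSymmetry (pdeW K) (domW S U) X ↔
        IsPointSymmetry (pdeW K') (equivMapW a₁ a₂ a₃ a₄ a₅ a₆ '' domW S U) X')) ∧
    -- the special rows are pairwise inequivalent
    (∀ (a₁ a₂ a₃ a₄ a₅ a₆ : ℝ) (U U' : Set ℝ) (K K' : ℝ → ℝ),
      IsOpenInterval U → EquivW a₁ a₂ a₃ a₄ a₅ a₆ U K U' K' →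
      (∀ μ μ' : ℝ, IsPower μ U K → IsPower μ' U' K' → μ = μ') ∧
      (∀ μ : ℝ, IsPower μ U K → ¬ IsExpInv U' K')) ∧
    -- arbitrary `K`
    (∀ (U : Set ℝ) (K : ℝ → ℝ) (S : Set (ℝ × ℝ)),
      IsConstitutive U K → 0 ∉ U → IsOpen S → IsConnected S →
      (∀ i : Fin 3, IsPointSymmetry (pdeW K) (domW S U) (![V₁, V₂, V₃] i)) ∧
      ((¬ ∃ (a₁ a₂ a₃ a₄ a₅ a₆ : ℝ) (U' : Set ℝ) (K' : ℝ → ℝ),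
          EquivW a₁ a₂ a₃ a₄ a₅ a₆ U K U' K' ∧ ((∃ μ : ℝ, IsPower μ U' K') ∨ IsExpInv U' K')) →
        SymmetryAlgebraIs (pdeW K) (domW S U) ![V₁, V₂, V₃])) ∧
    -- the special rows
    (∀ (U : Set ℝ) (K : ℝ → ℝ) (S : Set (ℝ × ℝ)),
      IsOpenInterval U → 0 ∉ U → IsOpen S → IsConnected S →
      (∀ μ : ℝ, μ ≠ -2 / 3 → μ ≠ -2 → IsPower μ U K →
        SymmetryAlgebraIs (pdeW K) (domW S U) ![V₁, V₂, V₃, V₄ μ]) ∧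
      (IsPower (-2 / 3) U K →
        SymmetryAlgebraIs (pdeW K) (domW S U) ![V₁, V₂, V₃, V₄ (-2 / 3), V₅]) ∧
      (IsPower (-2) U K →
        (∀ X : VField, IsPointSymmetry (pdeW K) (domW S U) X ↔
          ∃ (c : Fin 6 → ℝ) (G : ℝ × ℝ → ℝ), IsHeatSolution S G ∧
            ∀ q ∈ domW S U,
              X q = ∑ i, c i • (![V₁, V₂, V₃, V₄ (-2), V₆, V₇] i : VField) q + VInf G q) ∧
        ¬ FiniteDimensional ℝ (symSpace (pdeW K) (domW S U))) ∧
      (IsExpInv U K →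
        SymmetryAlgebraIs (pdeW K) (domW S U) ![V₁, V₂, V₃, V₈])) ∧
    -- the same fields in the coordinates `(t, v, u)`, `u = 1/w`
    (PushesTo invCoord {q | q 2 ≠ 0} V₁ (fun _ => ![1, 0, 0]) ∧
      PushesTo invCoord {q | q 2 ≠ 0} V₂ (fun _ => ![0, 1, 0]) ∧
      PushesTo invCoord {q | q 2 ≠ 0} V₃ (fun q => ![2 * q 0, q 1, 0]) ∧
      (∀ μ : ℝ, PushesTo invCoord {q | q 2 ≠ 0} (V₄ μ)
        (fun q => ![0, (2 + μ) * q 1, 2 * q 2])) ∧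
      PushesTo invCoord {q | q 2 ≠ 0} V₅ (fun q => ![0, -(q 1) ^ 2, -3 * q 2 * q 1]) ∧
      PushesTo invCoord {q | q 2 ≠ 0} V₆ (fun q => ![0, 2 * q 0, q 2 * q 1]) ∧
      PushesTo invCoord {q | q 2 ≠ 0} V₇
        (fun q => ![4 * (q 0) ^ 2, 4 * q 1 * q 0, (2 * q 0 + (q 1) ^ 2) * q 2]) ∧
      (∀ G : ℝ × ℝ → ℝ, PushesTo invCoord {q | q 2 ≠ 0} (VInf G)
        (fun q => ![0, 0, -(q 2) ^ 2 * G (q 0, q 1)])) ∧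
      PushesTo invCoord {q | q 2 ≠ 0} V₈ (fun q => ![0, q 1, -2 * (q 2) ^ 2])) ∧
    -- II. The class `p_t = -(K(u)/p)_uu`.
    -- The stated transformations are equivalence transformations.
    (∀ (a₁ a₂ a₃ a₄ a₅ : ℝ) (U U' : Set ℝ) (K K' : ℝ → ℝ) (B : Set (Fin 3 → ℝ)) (X X' : VField),
      IsConstitutive U K → AffineStepP a₁ a₂ a₃ a₄ a₅ U K U' K' →
      IsOpen B → (∀ q ∈ B, q 1 ∈ U ∧ q 2 ≠ 0) →
      PushesTo (affineMapP a₁ a₂ a₃ a₄ a₅) B X X' →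
      (IsPointSymmetry (pdeP K) B X ↔
        IsPointSymmetry (pdeP K') (affineMapP a₁ a₂ a₃ a₄ a₅ '' B) X')) ∧
    (∀ (a₆ : ℝ) (U U' : Set ℝ) (K K' : ℝ → ℝ) (B : Set (Fin 3 → ℝ)) (X X' : VField),
      IsConstitutive U K → ProjStepP a₆ U K U' K' →
      IsOpen B → (∀ q ∈ B, q 1 ∈ U ∧ q 2 ≠ 0) →
      PushesTo (projMapP a₆) B X X' →
      (IsPointSymmetry (pdeP K) B X ↔ IsPointSymmetry (pdeP K') (projMapP a₆ '' B) X')) ∧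
    -- the special rows are pairwise inequivalent
    (∀ (i i' : Fin 4) (U U' : Set ℝ) (K K' : ℝ → ℝ),
      RowP i U K → RowP i' U' K' → EquivP U K U' K' → i = i') ∧
    -- arbitrary `K`
    (∀ (U : Set ℝ) (K : ℝ → ℝ) (B : Set (Fin 3 → ℝ)),
      IsConstitutive U K → IsDomainP U B →
      (∀ i : Fin 2, IsPointSymmetry (pdeP K) B (![W₁, W₂] i)) ∧
      ((∃ u ∈ U, ∃ u' ∈ U, K u ≠ K u') →
        (¬ ∃ (i : Fin 4) (U' : Set ℝ) (K' : ℝ → ℝ), EquivP U K U' K' ∧ RowP i U' K') →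
        SymmetryAlgebraIs (pdeP K) B ![W₁, W₂])) ∧
    -- the special rows
    (∀ (U : Set ℝ) (K : ℝ → ℝ) (B : Set (Fin 3 → ℝ)),
      IsOpenInterval U → IsDomainP U B →
      (∀ μ : ℝ, μ ≠ 0 → μ ≠ -2 → IsPower μ U K →
        SymmetryAlgebraIs (pdeP K) B ![W₁, W₂, W₃ μ]) ∧
      (IsExp U K → SymmetryAlgebraIs (pdeP K) B ![W₁, W₂, W₄]) ∧
      (∀ l : ℝ, IsArctan l U K → SymmetryAlgebraIs (pdeP K) B ![W₁, W₂, W₅ l]) ∧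
      (IsPower (-2) U K → SymmetryAlgebraIs (pdeP K) B ![W₁, W₂, W₃ (-2), W₆])) ∧
    -- III. Nonlocal symmetries of `v_t = K(v_x) v_xx` and of `u_t = (K(u) u_x)_x`.
    YieldsNonlocalV (fun u => u ^ (-2 / 3 : ℝ)) (domW Set.univ (Set.Ioi 0)) V₅ ∧
    YieldsNonlocalU (fun u => u ^ (-2 / 3 : ℝ)) (domW Set.univ (Set.Ioi 0)) V₅ ∧
    YieldsNonlocalU (fun u => u ^ (-2 : ℝ)) (domW Set.univ (Set.Ioi 0)) V₆ ∧
    YieldsNonlocalU (fun u => u ^ (-2 : ℝ)) (domW Set.univ (Set.Ioi 0)) V₇ ∧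
    (∀ (S : Set (ℝ × ℝ)) (G : ℝ × ℝ → ℝ), IsOpen S → IsHeatSolution S G → (∃ s ∈ S, G s ≠ 0) →
      YieldsNonlocalU (fun u => u ^ (-2 : ℝ)) (domW S (Set.Ioi 0)) (VInf G)) ∧
    YieldsNonlocalU (fun u => Real.exp (1 / u) * (u ^ 2)⁻¹) (domW Set.univ {0}ᶜ) V₈ ∧
    (∀ l : ℝ, YieldsNonlocalP (fun u => 1 / (1 + u ^ 2) * Real.exp (l * Real.arctan u))
      {q | q 2 ≠ 0} (W₅ l)) ∧
    YieldsNonlocalP (fun u => u ^ (-2 : ℝ)) {q | 0 < q 1 ∧ q 2 ≠ 0} W₆ := by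
  refine ⟨fun a₁ a₂ a₃ a₄ a₅ a₆ U U' K K' S X X' hK _ h hS hX =>
      isPointSymmetry_equivMapW_iff hK h hS hX,
    fun a₁ a₂ a₃ a₄ a₅ a₆ U U' K K' hU h =>
      ⟨fun μ μ' hP hP' => h.power_unique hU hP hP', fun μ hP => h.not_power_expInv hU hP⟩,
    fun U K S hK h0 hS hSc => ⟨isPointSymmetry_V_basic hK.1.1 hK.2.1 hK.2.2 hS,
      symmetryAlgebraIs_generic hK h0 hS hSc⟩,
    fun U K S hU h0 hS hSc => ⟨fun μ h1 h2 h => symmetryAlgebraIs_power hU h0 hS hSc h1 h2 h,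
      symmetryAlgebraIs_power_special hU h0 hS hSc,
      fun h => ⟨isPointSymmetry_heat_iff hU h0 hS hSc h, not_finiteDimensional_heat hU h0 hS hSc h⟩,
      symmetryAlgebraIs_expInv hU h0 hS hSc⟩,
    ⟨pushesTo_invCoord fun q hq => ?_, pushesTo_invCoord fun q hq => ?_,
      pushesTo_invCoord fun q hq => ?_, fun μ => pushesTo_invCoord fun q hq => ?_,
      pushesTo_invCoord fun q hq => ?_, pushesTo_invCoord fun q hq => ?_,
      pushesTo_invCoord fun q hq => ?_, fun G => pushesTo_invCoord fun q hq => ?_,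
      pushesTo_invCoord fun q hq => ?_⟩,
    fun a₁ a₂ a₃ a₄ a₅ U U' K K' B X X' hK h hB hBU hX =>
      isPointSymmetry_affineMapP_iff hK h hB hBU hX,
    fun a₆ U U' K K' B X X' hK h hB hBU hX => isPointSymmetry_projMapP_iff hK h hB hBU hX,
    fun i i' U U' K K' h h' he => h.eq_of_equivP h' he,
    fun U K B hK hB => ⟨isPointSymmetry_W_basic hK hB, symmetryAlgebraIs_pdeP_generic hK hB⟩,
    fun U K B hU hB => ⟨fun μ h0 h2 h => symmetryAlgebraIs_pdeP_power hU hB h0 h2 h,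
      symmetryAlgebraIs_pdeP_exp hU hB, fun l h => symmetryAlgebraIs_pdeP_arctan hU hB h,
      symmetryAlgebraIs_pdeP_power_special hU hB⟩,
    yieldsNonlocalV_of_quadratic isPointSymmetry_V₅ V₅_eq (by norm_num),
    yieldsNonlocalU_of_quadratic isPointSymmetry_V₅ V₅_eq (by norm_num),
    yieldsNonlocalU_V₆, yieldsNonlocalU_V₇,
    fun S G hS hG _ => yieldsNonlocalU_VInf hS hG, yieldsNonlocalU_V₈, yieldsNonlocalP_W₅,
    yieldsNonlocalP_W₆⟩
  · simp [V₁]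
  · simp [V₂]
  · simp [V₃, invCoord]
  · simp [V₄, invCoord]
    field_simp
  · simp [V₅, invCoord]
    field_simp
  · simp [V₆, invCoord]
    field_simp
  · simp [V₇, invCoord]
    field_simp
  · simp [VInf, invCoord]
    field_simp
  · simp [V₈, invCoord]
    field_simp
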